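/- A digraph is a finite directed multigraph, with loops and multiple edges allowed; its weight is $|E|-|V|$. It is stable if every vertex $v$ satisfies $\deg^-(v)\ge 2$ and $\deg^+(v)\ge 2$, and semistable if every vertex satisfies $\deg^-(v)\ge 1$, $\deg^+(v)\ge 1$ and $\deg^-(v)+\deg^+(v)\ge 3$. An edge $uv$ of a semistable digraph is contractible if $u\ne v$ and $\deg^+(u)=1$ or $\deg^-(v)=1$. A semistable digraph $H$ is stabilizable if finitely many (possibly zero) successive contractions of contractible edges turn it into a stable digraph, which is then called the stabilization graph of $H$ (it is considered up to isomorphism). ${\rm Aut}(H)$ denotes the group of automorphisms of $H$, acting on vertices and edges. For every dimension $n$, a semistable digraph $H$ encodes an expression in a Kähler metric $(g_{i\bar j})$ on an open subset of $\mathbb C^n$: each vertex $v$ stands for the partial derivative $g_{a_1\bar b_1a_2\cdots a_p\bar b_2\cdots\bar b_q}=\partial_{a_2}\cdots\partial_{a_p}\partial_{\bar b_2}\cdots\partial_{\bar b_q}g_{a_1\bar b_1}$ with one unbarred index for each outward and one barred index for each inward half-edge at $v$, and each edge stands for the contraction, by $g^{a\bar b}$, of the unbarred index at its tail with the barred index at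 its head. An expression $P$ in the metric is a Weyl invariant in dimension $n$ if $P(\varphi^*g)(x)=P(g)(\varphi(x))$ for every biholomorphic map $\varphi$ between open subsets of $\mathbb C^n$, every Kähler metric $g$ on the target of $\varphi$ and every point $x$ of the source. Let $k$ be an integer and let $c$ be a complex-valued function on the set of isomorphism classes of stabilizable semistable digraphs of weight $k$. Then the linear combination $$\sum_{H} c(H)\,\frac{(-1)^{|V(H)|}}{|{\rm Aut}(H)|}\,H,$$ where $H$ runs over these isomorphism classes, is a Weyl invariant in every dimension $n$ if and only if $c(H_1)=c(H_2)$ whenever $H_1$ and $H_2$ have the same stabilization graph. Moreover, for each single dimension $n\ge 3k$, it is a Weyl invariant in dimension $n$ if and only if $c$ satisfies this condition. -/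

import Mathlib

open scoped ComplexOrder ContDiff

noncomputable section

/-- A finite directed multigraph (multiple edges and loops allowed), with vertex set `Fin nV` and
edge set `Fin nE`. Every finite directed multigraph is isomorphic to one of these. -/
structure FinDigraph where
  nV : ℕ
  nE : ℕ
  src : Fin nE → Fin nV
  tgt : Fin nE → Fin nV

namespace FinDigraph

/-- An isomorphism of directed multigraphs: bijections on vertices and on edges that respect
tails and heads. -/
@[ext]
structure Iso (G H : FinDigraph) where
  onV : Fin G.nV ≃ Fin H.nV
  onE : Fin G.nE ≃ Fin H.nE
  map_src : ∀ e, H.src (onE e) = onV (G.src e)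
  map_tgt : ∀ e, H.tgt (onE e) = onV (G.tgt e)

def Iso.refl (G : FinDigraph) : Iso G G :=
  ⟨Equiv.refl _, Equiv.refl _, fun _ => rfl, fun _ => rfl⟩

def Iso.symm {G H : FinDigraph} (f : Iso G H) : Iso H G where
  onV := f.onV.symm
  onE := f.onE.symm
  map_src e := by
    rw [Equiv.eq_symm_apply, ← f.map_src, Equiv.apply_symm_apply]
  map_tgt e := by
    rw [Equiv.eq_symm_apply, ← f.map_tgt, Equiv.apply_symm_apply]

def Iso.trans {G H K : FinDigraph} (f : Iso G H) (g : Iso H K) : Iso G K where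
  onV := f.onV.trans g.onV
  onE := f.onE.trans g.onE
  map_src e := by simp [g.map_src, f.map_src]
  map_tgt e := by simp [g.map_tgt, f.map_tgt]

/-- The order of the automorphism group of a multigraph. Automorphisms act on vertices and on
edges, so that permutations of parallel edges and of loops count. -/
def autCard (G : FinDigraph) : ℕ := Nat.card (Iso G G)

theorem autCard_eq_of_iso {G H : FinDigraph} (f : Iso G H) : G.autCard = H.autCard := by
  refine Nat.card_congr
    { toFun := fun a => (f.symm.trans a).trans f
      invFun := fun a => (f.trans a).trans f.symm
      left_inv := fun a => ?_
      right_inv := fun a => ?_ }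
  · ext x <;> simp [Iso.trans, Iso.symm]
  · ext x <;> simp [Iso.trans, Iso.symm]

def outEdges (G : FinDigraph) (v : Fin G.nV) : Finset (Fin G.nE) :=
  Finset.univ.filter fun e => G.src e = v

def inEdges (G : FinDigraph) (v : Fin G.nV) : Finset (Fin G.nE) :=
  Finset.univ.filter fun e => G.tgt e = v

def outDeg (G : FinDigraph) (v : Fin G.nV) : ℕ := (G.outEdges v).card

def inDeg (G : FinDigraph) (v : Fin G.nV) : ℕ := (G.inEdges v).card

/-- The weight `|E| - |V|`. -/
def weight (G : FinDigraph) : ℤ := (G.nE : ℤ) - (G.nV : ℤ)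

def Stable (G : FinDigraph) : Prop := ∀ v, 2 ≤ G.inDeg v ∧ 2 ≤ G.outDeg v

def Semistable (G : FinDigraph) : Prop :=
  ∀ v, 1 ≤ G.inDeg v ∧ 1 ≤ G.outDeg v ∧ 3 ≤ G.inDeg v + G.outDeg v

/-- An edge `uv` is contractible if `u ≠ v` and `deg⁺ u = 1` or `deg⁻ v = 1`. -/
def ContractibleEdge (G : FinDigraph) (e : Fin G.nE) : Prop :=
  G.src e ≠ G.tgt e ∧ (G.outDeg (G.src e) = 1 ∨ G.inDeg (G.tgt e) = 1)

/-- `G'` is (isomorphic to) the graph obtained from `G` by contracting the edge `e`: the edge `e`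
is deleted, its two ends are identified, and nothing else changes. -/
def IsContraction (G : FinDigraph) (e : Fin G.nE) (G' : FinDigraph) : Prop :=
  ∃ (f : Fin G.nV → Fin G'.nV) (ψ : {d : Fin G.nE // d ≠ e} ≃ Fin G'.nE),
    Function.Surjective f ∧
    (∀ x y, f x = f y ↔
      x = y ∨ (x = G.src e ∧ y = G.tgt e) ∨ (x = G.tgt e ∧ y = G.src e)) ∧
    ∀ d, G'.src (ψ d) = f (G.src d) ∧ G'.tgt (ψ d) = f (G.tgt d)

/-- `G'` arises from `G` by contracting one contractible edge. -/
def ContractStep (G G' : FinDigraph) : Prop :=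
  ∃ e, G.ContractibleEdge e ∧ G.IsContraction e G'

/-- `G` is (up to isomorphism) the stabilization graph of `H`: it is stable, and it is obtained
from `H` by finitely many (possibly zero) contractions of contractible edges. -/
def IsStabilization (H G : FinDigraph) : Prop :=
  G.Stable ∧ ∃ H', Relation.ReflTransGen ContractStep H H' ∧ Nonempty (Iso H' G)

def Stabilizable (H : FinDigraph) : Prop := ∃ G, H.IsStabilization G

theorem sum_outDeg (G : FinDigraph) : ∑ v, G.outDeg v = G.nE := by
  have h := Finset.card_eq_sum_card_fiberwise (s := (Finset.univ : Finset (Fin G.nE)))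
    (t := (Finset.univ : Finset (Fin G.nV))) (f := G.src) (fun _ _ => by simp)
  simpa [outDeg, outEdges] using h.symm

theorem sum_inDeg (G : FinDigraph) : ∑ v, G.inDeg v = G.nE := by
  have h := Finset.card_eq_sum_card_fiberwise (s := (Finset.univ : Finset (Fin G.nE)))
    (t := (Finset.univ : Finset (Fin G.nV))) (f := G.tgt) (fun _ _ => by simp)
  simpa [inDeg, inEdges] using h.symm

theorem Semistable.three_mul_nV_le {G : FinDigraph} (h : G.Semistable) :
    3 * G.nV ≤ 2 * G.nE := by
  have h1 : ∑ _v : Fin G.nV, 3 ≤ ∑ v, (G.inDeg v + G.outDeg v) :=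
    Finset.sum_le_sum fun v _ => (h v).2.2
  rw [Finset.sum_add_distrib, sum_outDeg, sum_inDeg] at h1
  simp at h1
  omega

end FinDigraph

/-- Stabilizable semistable graphs of weight `k`. -/
def StabGraph (k : ℤ) : Type :=
  {H : FinDigraph // H.Semistable ∧ H.weight = k ∧ H.Stabilizable}

instance StabGraph.setoid (k : ℤ) : Setoid (StabGraph k) where
  r H₁ H₂ := Nonempty (FinDigraph.Iso H₁.1 H₂.1)
  iseqv :=
    ⟨fun H => ⟨FinDigraph.Iso.refl H.1⟩, fun ⟨f⟩ => ⟨f.symm⟩, fun ⟨f⟩ ⟨g⟩ => ⟨f.trans g⟩⟩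

/-- Isomorphism classes of stabilizable semistable graphs of weight `k`. -/
abbrev StabClass (k : ℤ) : Type := Quotient (StabGraph.setoid k)

instance StabGraph.finite (k : ℤ) : Finite (StabGraph k) := by
  have hb : ∀ H : StabGraph k, H.1.nV < 2 * k.toNat + 1 ∧ H.1.nE < 3 * k.toNat + 1 := by
    intro H
    have h1 := H.2.1.three_mul_nV_le
    have h2 := H.2.2.1
    unfold FinDigraph.weight at h2
    omega
  let F : StabGraph k →
      (Σ p : Fin (2 * k.toNat + 1), Σ q : Fin (3 * k.toNat + 1),
        (Fin q → Fin p) × (Fin q → Fin p)) :=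
    fun H => ⟨⟨H.1.nV, (hb H).1⟩, ⟨H.1.nE, (hb H).2⟩, (H.1.src, H.1.tgt)⟩
  refine Finite.of_injective F ?_
  rintro ⟨⟨p, q, s, t⟩, h⟩ ⟨⟨p', q', s', t'⟩, h'⟩ hF
  apply Subtype.ext
  simp only [F, Sigma.mk.injEq, Fin.mk.injEq] at hF
  obtain ⟨rfl, h2⟩ := hF
  simp only [heq_eq_eq, Sigma.mk.injEq, Fin.mk.injEq] at h2
  obtain ⟨rfl, h3⟩ := h2
  simp only [heq_eq_eq, Prod.mk.injEq] at h3
  obtain ⟨rfl, rfl⟩ := h3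
  rfl

/-- The sum over isomorphism classes below is a genuine finite sum. -/
instance StabClass.finite (k : ℤ) : Finite (StabClass k) := Quotient.finite _

/-- `c(H₁) = c(H₂)` whenever `H₁`, `H₂` have the same stabilization graph. -/
def IsWeylFunction {k : ℤ} (c : StabClass k → ℂ) : Prop :=
  ∀ H₁ H₂ : StabGraph k, (∃ G, H₁.1.IsStabilization G ∧ H₂.1.IsStabilization G) →
    c ⟦H₁⟧ = c ⟦H₂⟧

/-- The Wirtinger derivative `∂f/∂z_i = (∂f/∂x_i - √-1 ∂f/∂y_i) / 2`. -/
def dHol {n : ℕ} (i : Fin n) (f : (Fin n → ℂ) → ℂ) (z : Fin n → ℂ) : ℂ :=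
  (fderiv ℝ f z (Pi.single i 1) - Complex.I * fderiv ℝ f z (Pi.single i Complex.I)) / 2

/-- The Wirtinger derivative `∂f/∂z̄_i = (∂f/∂x_i + √-1 ∂f/∂y_i) / 2`. -/
def dAnti {n : ℕ} (i : Fin n) (f : (Fin n → ℂ) → ℂ) (z : Fin n → ℂ) : ℂ :=
  (fderiv ℝ f z (Pi.single i 1) + Complex.I * fderiv ℝ f z (Pi.single i Complex.I)) / 2

/-- A Kähler metric on the open set `U ⊆ ℂⁿ`, given by its coefficients `g z i j = g_{i j̄}(z)`:
a smooth positive definite Hermitian matrix function whose Kähler form is closed. (The conjugate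
closedness equation `∂_{l̄} g_{i j̄} = ∂_{j̄} g_{i l̄}` follows as `g` is Hermitian.) -/
structure IsKahlerMetricOn {n : ℕ} (g : (Fin n → ℂ) → Matrix (Fin n) (Fin n) ℂ)
    (U : Set (Fin n → ℂ)) : Prop where
  smooth : ∀ i j, ContDiffOn ℝ ∞ (fun z => g z i j) U
  posDef : ∀ z ∈ U, (g z).PosDef
  closed : ∀ z ∈ U, ∀ i j l,
    dHol l (fun w => g w i j) z = dHol i (fun w => g w l j) z

/-- The derivative `g_{a₁ b̄₁ a₂ ⋯ a_p b̄₂ ⋯ b̄_q} = ∂_{a₂} ⋯ ∂_{a_p} ∂_{b̄₂} ⋯ ∂_{b̄_q} g_{a₁ b̄₁}`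
of the metric coefficients. It is only used when both lists are non-empty. -/
def metricDerivList {n : ℕ} (g : (Fin n → ℂ) → Matrix (Fin n) (Fin n) ℂ) :
    List (Fin n) → List (Fin n) → (Fin n → ℂ) → ℂ
  | a :: as, b :: bs => as.foldr dHol (bs.foldr dAnti fun z => g z a b)
  | _, _ => 0

/-- The same derivative for multisets of indices. On a Kähler metric the order of the unbarred
and of the barred indices is irrelevant, so the increasing order is taken. -/
def metricDeriv {n : ℕ} (g : (Fin n → ℂ) → Matrix (Fin n) (Fin n) ℂ)
    (A B : Multiset (Fin n)) : (Fin n → ℂ) → ℂ :=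
  metricDerivList g (A.sort (· ≤ ·)) (B.sort (· ≤ ·))

/-- The polynomial in the derivatives of the metric encoded by `H`, at the point `z`. Each edge `e`
carries an unbarred index `a e` at its tail and a barred index `b e` at its head, contracted with
`g^{a b̄}`, where `∑_b g_{i b̄} g^{a b̄} = δ_{i a}`, that is `g^{a b̄} = (g⁻¹)_{b a}`. Each vertex
contributes the derivative of the metric whose unbarred (barred) indices are those of its outward
(inward) edges. -/
def FinDigraph.eval {n : ℕ} (H : FinDigraph) (g : (Fin n → ℂ) → Matrix (Fin n) (Fin n) ℂ)
    (z : Fin n → ℂ) : ℂ :=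
  ∑ a : Fin H.nE → Fin n, ∑ b : Fin H.nE → Fin n,
    (∏ e, (g z)⁻¹ (b e) (a e)) *
      ∏ v, metricDeriv g ((H.outEdges v).val.map a) ((H.inEdges v).val.map b) z

theorem FinDigraph.eval_eq_of_iso {n : ℕ} {G H : FinDigraph} (f : FinDigraph.Iso G H)
    (g : (Fin n → ℂ) → Matrix (Fin n) (Fin n) ℂ) (z : Fin n → ℂ) :
    G.eval g z = H.eval g z := by
  unfold FinDigraph.eval
  refine Fintype.sum_equiv (f.onE.arrowCongr (Equiv.refl _)) _ _ fun a => ?_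
  refine Fintype.sum_equiv (f.onE.arrowCongr (Equiv.refl _)) _ _ fun b => ?_
  congr 1
  · exact Fintype.prod_equiv f.onE _ _ fun e => by simp
  · refine Fintype.prod_equiv f.onV _ _ fun v => ?_
    have ho : H.outEdges (f.onV v) = (G.outEdges v).map f.onE.toEmbedding := by
      ext e
      obtain ⟨d, rfl⟩ := f.onE.surjective e
      simp [FinDigraph.outEdges, f.map_src]
    have hi : H.inEdges (f.onV v) = (G.inEdges v).map f.onE.toEmbedding := by
      ext e
      obtain ⟨d, rfl⟩ := f.onE.surjective e
      simp [FinDigraph.inEdges, f.map_tgt]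
    rw [ho, hi]
    simp [Finset.map_val, Multiset.map_map, Function.comp_def]

/-- The contribution `(-1)^{|V(H)|} / |Aut(H)| · H` of an isomorphism class. -/
def StabClass.term {n : ℕ} {k : ℤ} (H : StabClass k)
    (g : (Fin n → ℂ) → Matrix (Fin n) (Fin n) ℂ) (z : Fin n → ℂ) : ℂ :=
  Quotient.lift
    (fun H : StabGraph k => (-1 : ℂ) ^ H.1.nV / (H.1.autCard : ℂ) * H.1.eval g z)
    (by
      rintro H₁ H₂ ⟨f⟩
      have hV : H₁.1.nV = H₂.1.nV := by simpa using Fintype.card_congr f.onV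
      simp only [hV, FinDigraph.autCard_eq_of_iso f, FinDigraph.eval_eq_of_iso f]) H

/-- The linear combination `∑_H c(H) (-1)^{|V(H)|} / |Aut(H)| · H` over isomorphism classes of
stabilizable semistable graphs of weight `k`, in complex dimension `n`. -/
def graphCombination (n : ℕ) {k : ℤ} (c : StabClass k → ℂ)
    (g : (Fin n → ℂ) → Matrix (Fin n) (Fin n) ℂ) (z : Fin n → ℂ) : ℂ :=
  ∑ᶠ H : StabClass k, c H * H.term g z

/-- The pullback metric, `(φ^*g)_{i j̄}(x) = ∑ g_{p q̄}(φ(x)) ∂_i φ_p \overline{∂_j φ_q}`. -/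
def pullbackMetric {n : ℕ} (φ : (Fin n → ℂ) → (Fin n → ℂ))
    (g : (Fin n → ℂ) → Matrix (Fin n) (Fin n) ℂ) (x : Fin n → ℂ) : Matrix (Fin n) (Fin n) ℂ :=
  fun i j => ∑ p, ∑ q, g (φ x) p q * fderiv ℂ φ x (Pi.single i 1) p *
    (starRingEnd ℂ) (fderiv ℂ φ x (Pi.single j 1) q)

/-- Invariance of a local expression `P` in the metric, in complex dimension `n`, under
holomorphic coordinate changes: `P(φ^*g)(x) = P(g)(φ(x))` for all biholomorphic maps `φ` between
open subsets of `ℂⁿ` and all Kähler metrics `g` on the target. -/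
def IsWeylInvariant (n : ℕ)
    (P : ((Fin n → ℂ) → Matrix (Fin n) (Fin n) ℂ) → (Fin n → ℂ) → ℂ) : Prop :=
  ∀ φ : OpenPartialHomeomorph (Fin n → ℂ) (Fin n → ℂ),
    DifferentiableOn ℂ φ φ.source → DifferentiableOn ℂ φ.symm φ.target →
    ∀ g : (Fin n → ℂ) → Matrix (Fin n) (Fin n) ℂ, IsKahlerMetricOn g φ.target →
      ∀ x ∈ φ.source, P (pullbackMetric φ g) x = P g (φ x)

end

/-! Let `Y` be `c` extended by zero to all digraphs. The function `c` depends only on the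
stabilization graph exactly when `Y` is unchanged by the contraction of any single contractible edge
of a semistable digraph (`isWeylFunction_iff`). Extending by zero is harmless, because such a
contraction preserves semistability, the weight and, by `stabilizable_iff`, also stabilizability in
both directions. What has to be shown is that the combination is invariant if and only if all these
contraction defects vanish.

Consider a path of holomorphic maps with constant 1-jet at a point. Its velocity ξ, in source
coordinates, vanishes there to second order, so the pulled-back metric at the point is constant and
only the higher jets move. By the Leibniz rule the variation of a graph expression is a sum over a
vertex v and a set S of at least two outward edges at v: the edges S are taken off v and given to a
factor ξ^c_S, and v receives the index c instead. There is a mirror sum for inward edges and the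
conjugate field. Such a term is drawn by an expanded digraph with a new vertex that carries ξ, has S
as its outward edges and has a single inward edge, coming from v. The expanded digraph itself
produces the same term when its new vertex is varied with all its outward edges: the metric left at
that vertex cancels the inverse metric on the inward edge. In terms of labelled digraphs the
normalization is (-1)^p/(p! q!), so the extra vertex and edge account for the choices of labels and
for a sign, and the two contributions combine to the coefficient `Y (collapse v σ t) - Y (expand v σ
t)`. This is `labelledSum_mul_fieldSum`. Edges whose tail has out-degree one are treated by
reversing all edges.

If all defects vanish, join φ to its affine part ℓ at x by ℓ + τ(φ - ℓ). The derivative in τ is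
zero, so the values for φ and ℓ agree, and for an affine map the invariance is a matter of
contracting indices (`FinDigraph.eval_pullback_affine`).

Conversely, apply the invariance to the shears z ↦ z + τ a z_S e_i with i ∉ S, which are globally
biholomorphic. The derivative at τ = 0 vanishes for all complex a, which separates the holomorphic
from the antiholomorphic half (`IsWeylInvariant.defectSum_eq_zero`). Label the edges of a given
expanded digraph by distinct coordinates and take the potential |z|² + ∑ 2 Re(ε_u z_{A_u} z̄_{B_u}),
with one monomial for each vertex other than the new one. In the resulting polynomial in ε and its
conjugate, the coefficient of ∏ ε_u only receives contributions from digraphs isomorphic to the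
given one, so it is a non-zero multiple of the defect (`IsDigraphFunction.defect_eq_zero_of_test`).
A semistable digraph of weight k has at most 3k edges, so n ≥ 3k coordinates are enough. -/

noncomputable section

/-! ### Unstable edges, contraction and stabilizability -/

namespace FinDigraph

/-- The digraph with all edges reversed. -/
def op (G : FinDigraph) : FinDigraph := ⟨G.nV, G.nE, G.tgt, G.src⟩

def Iso.op {G H : FinDigraph} (f : Iso G H) : Iso G.op H.op :=
  ⟨f.onV, f.onE, f.map_tgt, f.map_src⟩

theorem Iso.outEdges_eq {G H : FinDigraph} (f : Iso G H) (v : Fin G.nV) :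
    H.outEdges (f.onV v) = (G.outEdges v).map f.onE.toEmbedding := by
  ext e
  obtain ⟨d, rfl⟩ := f.onE.surjective e
  simp [outEdges, f.map_src]

theorem Iso.inEdges_eq {G H : FinDigraph} (f : Iso G H) (v : Fin G.nV) :
    H.inEdges (f.onV v) = (G.inEdges v).map f.onE.toEmbedding := by
  ext e
  obtain ⟨d, rfl⟩ := f.onE.surjective e
  simp [inEdges, f.map_tgt]

theorem Iso.outDeg_eq {G H : FinDigraph} (f : Iso G H) (v : Fin G.nV) :
    H.outDeg (f.onV v) = G.outDeg v := by
  simp [outDeg, f.outEdges_eq]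

theorem Iso.inDeg_eq {G H : FinDigraph} (f : Iso G H) (v : Fin G.nV) :
    H.inDeg (f.onV v) = G.inDeg v := by
  simp [inDeg, f.inEdges_eq]

theorem Iso.nV_eq {G H : FinDigraph} (f : Iso G H) : G.nV = H.nV := by
  simpa using Fintype.card_congr f.onV

theorem Iso.nE_eq {G H : FinDigraph} (f : Iso G H) : G.nE = H.nE := by
  simpa using Fintype.card_congr f.onE

theorem Semistable.of_iso {G H : FinDigraph} (f : Iso G H) (h : G.Semistable) : H.Semistable := by
  intro v
  obtain ⟨v, rfl⟩ := f.onV.surjective v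
  rw [f.inDeg_eq, f.outDeg_eq]
  exact h v

theorem Stable.of_iso {G H : FinDigraph} (f : Iso G H) (h : G.Stable) : H.Stable := by
  intro v
  obtain ⟨v, rfl⟩ := f.onV.surjective v
  rw [f.inDeg_eq, f.outDeg_eq]
  exact h v

/-- The edges that have to be contracted in the stabilization. -/
def Unstable (G : FinDigraph) (e : Fin G.nE) : Prop :=
  G.outDeg (G.src e) = 1 ∨ G.inDeg (G.tgt e) = 1

/-- Every prescription of differences along the unstable edges comes from a function on vertices;
this says that the unstable edges form a forest. -/
def UnstableForest (G : FinDigraph) : Prop :=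
  ∀ k : Fin G.nE → ℚ, ∃ φ : Fin G.nV → ℚ, ∀ e, G.Unstable e → φ (G.src e) - φ (G.tgt e) = k e

theorem Stable.not_unstable {G : FinDigraph} (h : G.Stable) (e : Fin G.nE) : ¬ G.Unstable e := by
  rintro (h1 | h1)
  · have := (h (G.src e)).2; omega
  · have := (h (G.tgt e)).1; omega

theorem UnstableForest.of_iso {G H : FinDigraph} (f : Iso G H) (h : G.UnstableForest) :
    H.UnstableForest := by
  intro k
  obtain ⟨φ, hφ⟩ := h (k ∘ f.onE)
  refine ⟨φ ∘ f.onV.symm, fun e he => ?_⟩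
  obtain ⟨e, rfl⟩ := f.onE.surjective e
  have := hφ e (by
    unfold Unstable at he ⊢
    rwa [f.map_src, f.map_tgt, f.outDeg_eq, f.inDeg_eq] at he)
  simpa [f.map_src, f.map_tgt] using this

theorem UnstableForest.src_ne_tgt {G : FinDigraph} (h : G.UnstableForest) {e : Fin G.nE}
    (he : G.Unstable e) : G.src e ≠ G.tgt e := by
  intro h1
  obtain ⟨φ, hφ⟩ := h fun _ => 1
  have := hφ e he
  rw [h1] at this
  simp at this

theorem mem_outEdges {G : FinDigraph} {v : Fin G.nV} {e : Fin G.nE} :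
    e ∈ G.outEdges v ↔ G.src e = v := by
  simp [outEdges]

theorem mem_inEdges {G : FinDigraph} {v : Fin G.nV} {e : Fin G.nE} :
    e ∈ G.inEdges v ↔ G.tgt e = v := by
  simp [inEdges]

theorem Semistable.stable {G : FinDigraph} (h : G.Semistable) (h' : ∀ e, ¬ G.Unstable e) :
    G.Stable := by
  intro v
  obtain ⟨h1, h2, -⟩ := h v
  constructor
  · by_contra hlt
    obtain ⟨e, he⟩ := Finset.card_pos.mp h1
    exact h' e (Or.inr (by rw [mem_inEdges.mp he]; omega))
  · by_contra hlt
    obtain ⟨e, he⟩ := Finset.card_pos.mp h2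
    exact h' e (Or.inl (by rw [mem_outEdges.mp he]; omega))

section Contraction

variable {G G' : FinDigraph} {e : Fin G.nE}

theorem IsContraction.op (h : G.IsContraction e G') : G.op.IsContraction e G'.op := by
  obtain ⟨f, ψ, hf, hxy, hψ⟩ := h
  refine ⟨f, ψ, hf, fun x y => (hxy x y).trans ?_, fun d => (hψ d).symm⟩
  show _ ↔ x = y ∨ (x = G.tgt e ∧ y = G.src e) ∨ (x = G.src e ∧ y = G.tgt e)
  tauto

theorem card_outEdges_of_contraction {f : Fin G.nV → Fin G'.nV}
    {ψ : {d : Fin G.nE // d ≠ e} ≃ Fin G'.nE} (hψ : ∀ d, G'.src (ψ d) = f (G.src d))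
    (x : Fin G'.nV) :
    G'.outDeg x = ((Finset.univ.filter fun d => f (G.src d) = x).erase e).card := by
  unfold outDeg
  symm
  refine Finset.card_bij (fun d hd => ψ ⟨d, (Finset.mem_erase.mp hd).1⟩) ?_ ?_ ?_
  · intro d hd
    simp only [Finset.mem_erase, Finset.mem_filter, Finset.mem_univ, true_and] at hd
    simp [mem_outEdges, hψ, hd.2]
  · intro d hd d' hd' h
    simpa using h
  · intro d hd
    obtain ⟨d, rfl⟩ := ψ.surjective d
    rw [mem_outEdges, hψ] at hd
    exact ⟨d, by simp [d.2, hd], rfl⟩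

/-- The merged vertex collects the outward edges of both ends of `e`, and only `e` itself is lost.
The statement for in-degrees follows by reversing edges. -/
theorem outDeg_of_contraction {f : Fin G.nV → Fin G'.nV}
    {ψ : {d : Fin G.nE // d ≠ e} ≃ Fin G'.nE} (hne : G.src e ≠ G.tgt e)
    (hf : ∀ x y, f x = f y ↔
      x = y ∨ (x = G.src e ∧ y = G.tgt e) ∨ (x = G.tgt e ∧ y = G.src e))
    (hψ : ∀ d, G'.src (ψ d) = f (G.src d)) (y : Fin G.nV) :
    (y = G.src e ∨ y = G.tgt e → G'.outDeg (f y) + 1 = G.outDeg (G.src e) + G.outDeg (G.tgt e)) ∧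
    (¬ (y = G.src e ∨ y = G.tgt e) → G'.outDeg (f y) = G.outDeg y) := by
  rw [card_outEdges_of_contraction hψ]
  constructor
  · intro hy
    have : (Finset.univ.filter fun d => f (G.src d) = f y)
        = G.outEdges (G.src e) ∪ G.outEdges (G.tgt e) := by
      ext d
      simp only [hf, Finset.mem_filter, Finset.mem_univ, true_and, Finset.mem_union, mem_outEdges]
      rcases hy with rfl | rfl <;> tauto
    rw [this, Finset.card_erase_add_one (by simp [mem_outEdges]), Finset.card_union_of_disjoint]
    · rfl
    · rw [Finset.disjoint_left]
      intro d hd hd'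
      rw [mem_outEdges] at hd hd'
      exact hne (hd.symm.trans hd')
  · intro hy
    rw [Finset.erase_eq_of_notMem]
    · unfold outDeg
      congr 1
      ext d
      simp only [hf, Finset.mem_filter, Finset.mem_univ, true_and, mem_outEdges]
      tauto
    · simp only [hf, Finset.mem_filter, Finset.mem_univ, true_and]
      tauto

theorem inDeg_of_contraction {f : Fin G.nV → Fin G'.nV}
    {ψ : {d : Fin G.nE // d ≠ e} ≃ Fin G'.nE} (hne : G.src e ≠ G.tgt e)
    (hf : ∀ x y, f x = f y ↔
      x = y ∨ (x = G.src e ∧ y = G.tgt e) ∨ (x = G.tgt e ∧ y = G.src e))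
    (hψ : ∀ d, G'.tgt (ψ d) = f (G.tgt d)) (y : Fin G.nV) :
    (y = G.src e ∨ y = G.tgt e → G'.inDeg (f y) + 1 = G.inDeg (G.src e) + G.inDeg (G.tgt e)) ∧
    (¬ (y = G.src e ∨ y = G.tgt e) → G'.inDeg (f y) = G.inDeg y) := by
  have := outDeg_of_contraction (G := G.op) (G' := G'.op) (e := e) (f := f) (ψ := ψ) hne.symm
    (fun x y => (hf x y).trans (by
      show _ ↔ x = y ∨ (x = G.tgt e ∧ y = G.src e) ∨ (x = G.src e ∧ y = G.tgt e)
      tauto)) hψ y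
  change (y = G.tgt e ∨ y = G.src e → G'.inDeg (f y) + 1 = G.inDeg (G.tgt e) + G.inDeg (G.src e)) ∧
    (¬ (y = G.tgt e ∨ y = G.src e) → G'.inDeg (f y) = G.inDeg y) at this
  rw [or_comm, add_comm (G.inDeg (G.src e))]
  exact this

/-- The merged vertex loses one outward and one inward half-edge, so either degree is at least 1 + 1
- 1 and their sum at least 3 + 3 - 2. -/
theorem Semistable.of_contraction (hs : G.Semistable) (hne : G.src e ≠ G.tgt e)
    (h : G.IsContraction e G') : G'.Semistable := by
  obtain ⟨f, ψ, hf, hxy, hψ⟩ := h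
  intro x
  obtain ⟨y, rfl⟩ := hf x
  have h1 := outDeg_of_contraction hne hxy (fun d => (hψ d).1) y
  have h2 := inDeg_of_contraction hne hxy (fun d => (hψ d).2) y
  by_cases hy : y = G.src e ∨ y = G.tgt e
  · have h1 := h1.1 hy
    have h2 := h2.1 hy
    have h3 := hs (G.src e)
    have h4 := hs (G.tgt e)
    omega
  · rw [h1.2 hy, h2.2 hy]
    exact hs y

theorem IsContraction.nE_eq (h : G.IsContraction e G') : G.nE = G'.nE + 1 := by
  obtain ⟨f, ψ, -⟩ := h
  have := Fintype.card_congr ψ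
  simp at this
  have h1 := e.pos
  omega

theorem IsContraction.nV_eq (h : G.IsContraction e G') (hne : G.src e ≠ G.tgt e) :
    G.nV = G'.nV + 1 := by
  obtain ⟨f, ψ, hf, hxy, -⟩ := h
  have hinj : Function.Bijective fun x : {x : Fin G.nV // x ≠ G.tgt e} => f x := by
    constructor
    · rintro ⟨x, hx⟩ ⟨y, hy⟩ h
      have := (hxy x y).mp h
      ext1
      show x = y
      tauto
    · intro z
      obtain ⟨x, rfl⟩ := hf z
      by_cases hx : x = G.tgt e
      · exact ⟨⟨G.src e, hne⟩, (hxy _ _).mpr (by simp [hx])⟩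
      · exact ⟨⟨x, hx⟩, rfl⟩
  have := Fintype.card_congr (Equiv.ofBijective _ hinj)
  simp at this
  have h1 := (G.tgt e).pos
  omega

theorem IsContraction.weight_eq (h : G.IsContraction e G') (hne : G.src e ≠ G.tgt e) :
    G'.weight = G.weight := by
  have h1 := h.nE_eq
  have h2 := h.nV_eq hne
  unfold weight
  omega

/-- The other edges keep their status, so the unstable edges of `G'` are those of `G` with `e`
contracted, and contracting an edge neither closes nor opens a cycle. -/
theorem unstableForest_iff_of_contraction (hs : G.Semistable) (hc : G.ContractibleEdge e)
    (h : G.IsContraction e G') : G'.UnstableForest ↔ G.UnstableForest := by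
  obtain ⟨hne, hdeg⟩ := hc
  obtain ⟨f, ψ, hf, hxy, hψ⟩ := h
  -- For another edge leaving `src e` the out-degree exceeds 1 before and after. For an edge leaving
  -- `tgt e` the new out-degree is `outDeg (src e) + outDeg (tgt e) - 1`: this is unchanged if
  -- `outDeg (src e) = 1`, and otherwise `inDeg (tgt e) = 1`, so that semistability makes both
  -- out-degrees at least 2. Heads are symmetric.
  have hbad : ∀ d, G'.Unstable (ψ d) ↔ G.Unstable d := by
    rintro ⟨d, hd⟩
    have h1 := outDeg_of_contraction hne hxy (fun d => (hψ d).1) (G.src d)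
    have h2 := inDeg_of_contraction hne hxy (fun d => (hψ d).2) (G.tgt d)
    have h3 := hs (G.src e)
    have h4 := hs (G.tgt e)
    unfold Unstable
    rw [(hψ _).1, (hψ _).2]
    refine or_congr ?_ ?_
    · by_cases hy : G.src d = G.src e
      · have h5 : 2 ≤ G.outDeg (G.src e) :=
          Finset.one_lt_card.mpr ⟨d, mem_outEdges.mpr hy, e, mem_outEdges.mpr rfl, hd⟩
        have h1 := h1.1 (Or.inl hy)
        simp only [hy] at h1 ⊢
        omega
      · by_cases hy' : G.src d = G.tgt e
        · have h1 := h1.1 (Or.inr hy')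
          simp only [hy'] at h1 ⊢
          omega
        · rw [h1.2 (by tauto)]
    · by_cases hy : G.tgt d = G.tgt e
      · have h5 : 2 ≤ G.inDeg (G.tgt e) :=
          Finset.one_lt_card.mpr ⟨d, mem_inEdges.mpr hy, e, mem_inEdges.mpr rfl, hd⟩
        have h2 := h2.1 (Or.inr hy)
        simp only [hy] at h2 ⊢
        omega
      · by_cases hy' : G.tgt d = G.src e
        · have h2 := h2.1 (Or.inl hy')
          simp only [hy'] at h2 ⊢
          omega
        · rw [h2.2 (by tauto)]
  have hfe : f (G.src e) = f (G.tgt e) := (hxy _ _).mpr (by tauto)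
  constructor
  · intro h' k
    -- The solution on `G` is the pullback of `φ` plus `k e` at `src e`; the prescription on `G'` is
    -- corrected in advance for this extra term.
    obtain ⟨φ, hφ⟩ := h' fun d => k (ψ.symm d) - k e *
      ((if G.src (ψ.symm d) = G.src e then 1 else 0) -
        (if G.tgt (ψ.symm d) = G.src e then 1 else 0))
    refine ⟨fun x => φ (f x) + k e * (if x = G.src e then 1 else 0), fun d hd => ?_⟩
    by_cases hde : d = e
    · subst hde
      simp [hfe, hne.symm]
    · have := hφ (ψ ⟨d, hde⟩) ((hbad _).mpr hd)
      rw [(hψ _).1, (hψ _).2] at this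
      simp only [Equiv.symm_apply_apply] at this
      linear_combination this
  · intro h' k
    -- The value `0` on `e` makes `φ` agree at the two ends of `e`, so it descends along `f`.
    obtain ⟨φ, hφ⟩ := h' fun d => if hd : d = e then 0 else k (ψ ⟨d, hd⟩)
    have he := hφ e hdeg
    simp only [dif_pos] at he
    have hφf : ∀ x, φ (Function.surjInv hf (f x)) = φ x := by
      intro x
      have := (hxy (Function.surjInv hf (f x)) x).mp (Function.surjInv_eq hf _)
      rcases this with h1 | ⟨h1, h2⟩ | ⟨h1, h2⟩
      · rw [h1]
      · rw [h1, h2]; linarith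
      · rw [h1, h2]; linarith
    refine ⟨fun x => φ (Function.surjInv hf x), fun d hd => ?_⟩
    obtain ⟨d, rfl⟩ := ψ.surjective d
    have := hφ d ((hbad d).mp hd)
    rw [dif_neg d.2] at this
    rw [(hψ _).1, (hψ _).2]
    beta_reduce
    rw [hφf, hφf]
    exact this

theorem exists_contraction (hne : G.src e ≠ G.tgt e) : ∃ G', G.IsContraction e G' := by
  classical
  let V := {x : Fin G.nV // x ≠ G.tgt e}
  let g : Fin G.nV → V := fun x => if h : x = G.tgt e then ⟨G.src e, hne⟩ else ⟨x, h⟩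
  let εV := Fintype.equivFin V
  let εE := Fintype.equivFin {d : Fin G.nE // d ≠ e}
  refine ⟨⟨Fintype.card V, Fintype.card {d : Fin G.nE // d ≠ e},
    fun d => εV (g (G.src (εE.symm d))), fun d => εV (g (G.tgt (εE.symm d)))⟩,
    fun x => εV (g x), εE, ?_, ?_, ?_⟩
  · refine εV.surjective.comp fun x => ⟨x, ?_⟩
    simp [g, x.2]
  · intro x y
    have hg : ∀ x, (g x : Fin G.nV) = if x = G.tgt e then G.src e else x := by
      intro x
      by_cases h : x = G.tgt e <;> simp [g, h]
    rw [EmbeddingLike.apply_eq_iff_eq, Subtype.ext_iff, hg, hg]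
    split_ifs <;> grind
  · intro d
    simp

end Contraction

/-- The forest condition is insensitive to contractions and trivial for stable digraphs, which have
no unstable edges. Conversely, an unstable edge of a forest is not a loop, hence contractible, and
contracting such edges lowers the number of edges until none is unstable; a semistable digraph
without unstable edges is stable. -/
theorem stabilizable_iff {G : FinDigraph} (hs : G.Semistable) :
    G.Stabilizable ↔ G.UnstableForest := by
  constructor
  · rintro ⟨K, hK, H, hH, ⟨f⟩⟩
    have hH' : H.UnstableForest := fun k =>
      ⟨0, fun e he => ((hK.of_iso f.symm).not_unstable e he).elim⟩
    induction hH using Relation.ReflTransGen.head_induction_on with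
    | refl => exact hH'
    | head h _ ih =>
      obtain ⟨e, hc, h⟩ := h
      exact (unstableForest_iff_of_contraction hs hc h).mp (ih (hs.of_contraction hc.1 h))
  · intro h
    obtain ⟨m, hm⟩ : ∃ m, G.nE = m := ⟨_, rfl⟩
    induction m generalizing G with
    | zero =>
      refine ⟨G, hs.stable fun e => ?_, G, .refl, ⟨Iso.refl G⟩⟩
      exact (Fin.cast hm e).elim0
    | succ m ih =>
      by_cases hb : ∃ e, G.Unstable e
      · obtain ⟨e, he⟩ := hb
        have hne := h.src_ne_tgt he
        obtain ⟨G', hG'⟩ := exists_contraction hne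
        obtain ⟨K, hK, H, hH, f⟩ := ih (hs.of_contraction hne hG')
          ((unstableForest_iff_of_contraction hs ⟨hne, he⟩ hG').mpr h)
          (by have := hG'.nE_eq; omega)
        exact ⟨K, hK, H, .head ⟨e, ⟨hne, he⟩, hG'⟩ hH, f⟩
      · exact ⟨G, hs.stable fun e he => hb ⟨e, he⟩, G, .refl, ⟨Iso.refl G⟩⟩

theorem Semistable.op {G : FinDigraph} (h : G.Semistable) : G.op.Semistable := fun v =>
  ⟨(h v).2.1, (h v).1, by rw [add_comm]; exact (h v).2.2⟩

end FinDigraph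

/-! ### Coefficient functions on all digraphs -/

open FinDigraph

open Classical in
/-- A function on isomorphism classes, as a function on all digraphs, extended by zero. -/
def extendByZero {k : ℤ} (c : StabClass k → ℂ) (G : FinDigraph) : ℂ :=
  if h : G.Semistable ∧ G.weight = k ∧ G.Stabilizable then c ⟦⟨G, h⟩⟧ else 0

theorem extendByZero_of_iso {k : ℤ} (c : StabClass k → ℂ) {G H : FinDigraph} (f : Iso G H) :
    extendByZero c G = extendByZero c H := by
  have key : ∀ {G H : FinDigraph}, Iso G H → (G.Semistable ∧ G.weight = k ∧ G.Stabilizable) →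
      (H.Semistable ∧ H.weight = k ∧ H.Stabilizable) := by
    rintro G H f ⟨h1, h2, h3⟩
    have h1' := h1.of_iso f
    rw [stabilizable_iff h1] at h3
    refine ⟨h1', ?_, (stabilizable_iff h1').mpr (h3.of_iso f)⟩
    have := f.nV_eq
    have := f.nE_eq
    unfold FinDigraph.weight at h2 ⊢
    omega
  unfold extendByZero
  by_cases h : G.Semistable ∧ G.weight = k ∧ G.Stabilizable
  · rw [dif_pos h, dif_pos (key f h)]
    exact congrArg c (Quotient.sound ⟨f⟩)
  · rw [dif_neg h, dif_neg fun h' => h (key f.symm h')]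

theorem extendByZero_mem {k : ℤ} {c : StabClass k → ℂ} {G : FinDigraph}
    (h : extendByZero c G ≠ 0) : G.Semistable ∧ G.weight = k ∧ G.Stabilizable := by
  by_contra h'
  exact h (dif_neg h')

/-- Both ends of a single contraction lie in the domain of `c` or neither does, and if they do, they
have a common stabilization graph. Conversely, a chain of single contractions links every digraph to
its stabilization graph, where the values are compared. -/
theorem isWeylFunction_iff {k : ℤ} (c : StabClass k → ℂ) :
    IsWeylFunction c ↔ ∀ (G G' : FinDigraph) (e : Fin G.nE), G.Semistable → G.ContractibleEdge e →
      G.IsContraction e G' → extendByZero c G = extendByZero c G' := by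
  constructor
  · intro h G G' e hs hc hG'
    have hs' := hs.of_contraction hc.1 hG'
    have hst : G'.Stabilizable ↔ G.Stabilizable := by
      rw [stabilizable_iff hs, stabilizable_iff hs', unstableForest_iff_of_contraction hs hc hG']
    have hw := hG'.weight_eq hc.1
    unfold extendByZero
    by_cases h1 : G.Semistable ∧ G.weight = k ∧ G.Stabilizable
    · have h2 : G'.Semistable ∧ G'.weight = k ∧ G'.Stabilizable :=
        ⟨hs', hw.trans h1.2.1, hst.mpr h1.2.2⟩
      rw [dif_pos h1, dif_pos h2]
      obtain ⟨K, hK, H, hH, f⟩ := h2.2.2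
      exact h _ _ ⟨K, ⟨hK, H, .head ⟨e, hc, hG'⟩ hH, f⟩, ⟨hK, H, hH, f⟩⟩
    · rw [dif_neg h1, dif_neg]
      rintro ⟨-, h3, h4⟩
      exact h1 ⟨hs, hw ▸ h3, hst.mp h4⟩
  · intro h H₁ H₂ ⟨K, h1, h2⟩
    have key : ∀ {H : FinDigraph}, H.Semistable → H.IsStabilization K →
        extendByZero c H = extendByZero c K := by
      rintro H hs ⟨-, H', hH', ⟨f⟩⟩
      induction hH' using Relation.ReflTransGen.head_induction_on with
      | refl => exact extendByZero_of_iso c f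
      | head h3 _ ih =>
        obtain ⟨e, hc, h3⟩ := h3
        rw [h _ _ e hs hc h3, ih (hs.of_contraction hc.1 h3)]
    have e : ∀ H : StabGraph k, extendByZero c H.1 = c ⟦H⟧ := fun H => dif_pos H.2
    rw [← e, ← e, key H₁.2.1 h1, key H₂.2.1 h2]

end

noncomputable section

/-! ### From isomorphism classes to labelled digraphs -/

namespace FinDigraph

instance (G H : FinDigraph) : Finite (Iso G H) :=
  Finite.of_injective (fun f => (f.onV, f.onE)) fun f g h => by
    rw [Prod.mk.injEq] at h
    exact Iso.ext h.1 h.2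

/-- Relabelling a digraph by permutations of its vertices and edges. -/
def relabelEquiv {p q : ℕ} (s t : Fin q → Fin p) :
    (Equiv.Perm (Fin p) × Equiv.Perm (Fin q)) ≃
      Σ st : (Fin q → Fin p) × (Fin q → Fin p), Iso ⟨p, q, s, t⟩ ⟨p, q, st.1, st.2⟩ where
  toFun a := ⟨(fun e => a.1 (s (a.2.symm e)), fun e => a.1 (t (a.2.symm e))),
    ⟨a.1, a.2, fun e => by simp, fun e => by simp⟩⟩
  invFun b := (b.2.onV, b.2.onE)
  left_inv a := rfl
  right_inv := by
    have key : ∀ (a : Equiv.Perm (Fin p)) (b : Equiv.Perm (Fin q)) (s' t' : Fin q → Fin p)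
        (h1 : ∀ e, s' (b e) = a (s e)) (h2 : ∀ e, t' (b e) = a (t e)),
        (⟨(fun e => a (s (b.symm e)), fun e => a (t (b.symm e))),
          ⟨a, b, fun e => by simp, fun e => by simp⟩⟩ :
          Σ st : (Fin q → Fin p) × (Fin q → Fin p), Iso ⟨p, q, s, t⟩ ⟨p, q, st.1, st.2⟩)
          = ⟨(s', t'), ⟨a, b, h1, h2⟩⟩ := by
      intro a b s' t' h1 h2
      obtain rfl : s' = fun e => a (s (b.symm e)) := funext fun e => by simp [← h1]
      obtain rfl : t' = fun e => a (t (b.symm e)) := funext fun e => by simp [← h2]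
      rfl
    rintro ⟨⟨s', t'⟩, f⟩
    exact key f.onV f.onE s' t' f.map_src f.map_tgt

theorem autCard_pos (G : FinDigraph) : 0 < G.autCard :=
  Nat.card_pos_iff.mpr ⟨⟨Iso.refl G⟩, inferInstance⟩

-- As soon as one isomorphism exists, composition with it identifies isomorphisms with
-- automorphisms.
open Classical in
theorem card_iso (G H : FinDigraph) :
    Nat.card (Iso G H) = if Nonempty (Iso G H) then G.autCard else 0 := by
  split_ifs with h
  · obtain ⟨f⟩ := h
    refine Nat.card_congr
      { toFun := fun g => g.trans f.symm
        invFun := fun g => g.trans f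
        left_inv := fun g => by ext x <;> simp [Iso.trans, Iso.symm]
        right_inv := fun g => by ext x <;> simp [Iso.trans, Iso.symm] }
  · rw [not_nonempty_iff] at h
    exact Nat.card_of_isEmpty

open Classical in
/-- The number of labelled digraphs isomorphic to a given one. -/
theorem sum_isomorphic_mul_autCard (G : FinDigraph) :
    (∑ s : Fin G.nE → Fin G.nV, ∑ t : Fin G.nE → Fin G.nV,
      if Nonempty (Iso G ⟨G.nV, G.nE, s, t⟩) then 1 else 0) * G.autCard
      = G.nV.factorial * G.nE.factorial := by
  have h := Nat.card_congr (relabelEquiv G.src G.tgt)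
  rw [Nat.card_sigma, Nat.card_prod, Nat.card_perm, Nat.card_perm, Nat.card_fin, Nat.card_fin,
    Fintype.sum_prod_type] at h
  rw [h, Finset.sum_mul]
  refine Finset.sum_congr rfl fun s _ => ?_
  rw [Finset.sum_mul]
  refine Finset.sum_congr rfl fun t _ => ?_
  rw [card_iso, ite_mul, one_mul, zero_mul]

/-- The coefficient of a labelled digraph with `p` vertices and `K + p` edges. -/
def labelWeight (K p : ℕ) : ℂ := (-1) ^ p / (p.factorial * (K + p).factorial)

/-- The sum of `Y` over all labelled digraphs of weight `K` with fewer than `N` vertices. -/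
def labelledSum (K N : ℕ) (Y : FinDigraph → ℂ) : ℂ :=
  ∑ p ∈ Finset.range N, labelWeight K p *
    ∑ s : Fin (K + p) → Fin p, ∑ t : Fin (K + p) → Fin p, Y ⟨p, K + p, s, t⟩

theorem labelledSum_sum {ι : Type*} (K N : ℕ) (I : Finset ι) (F : ι → FinDigraph → ℂ) :
    labelledSum K N (fun G => ∑ i ∈ I, F i G) = ∑ i ∈ I, labelledSum K N (F i) := by
  unfold labelledSum
  rw [Finset.sum_comm (s := I)]
  refine Finset.sum_congr rfl fun p _ => ?_
  rw [← Finset.mul_sum, Finset.sum_comm (s := I)]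
  congr 1
  refine Finset.sum_congr rfl fun s _ => ?_
  rw [Finset.sum_comm]

theorem labelledSum_const_mul (K N : ℕ) (a : ℂ) (F : FinDigraph → ℂ) :
    labelledSum K N (fun G => a * F G) = a * labelledSum K N F := by
  unfold labelledSum
  rw [Finset.mul_sum]
  refine Finset.sum_congr rfl fun p _ => ?_
  simp only [← Finset.mul_sum]
  ring

-- Orbit counting: an isomorphism class has `p! q! / |Aut|` labelled members, all of them with `p =
-- G.nV`.
open Classical in
theorem labelledSum_isomorphic {K N : ℕ} (G : FinDigraph) (h : G.nE = K + G.nV) (hN : G.nV < N) :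
    labelledSum K N (fun H => if Nonempty (Iso G H) then 1 else 0)
      = (-1) ^ G.nV / (G.autCard : ℂ) := by
  unfold labelledSum
  rw [Finset.sum_eq_single G.nV]
  · obtain ⟨p, q, s, t⟩ := G
    dsimp only at h
    subst h
    have h1 := sum_isomorphic_mul_autCard ⟨p, K + p, s, t⟩
    have h2 := autCard_pos ⟨p, K + p, s, t⟩
    have h3 := congrArg (Nat.cast (R := ℂ)) h1
    push_cast at h3
    unfold labelWeight
    have h4 : ((⟨p, K + p, s, t⟩ : FinDigraph).autCard : ℂ) ≠ 0 := by exact_mod_cast h2.ne'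
    have h5 : (p.factorial : ℂ) ≠ 0 := by exact_mod_cast p.factorial_ne_zero
    have h6 : ((K + p).factorial : ℂ) ≠ 0 := by exact_mod_cast (K + p).factorial_ne_zero
    field_simp
    linear_combination h3
  · intro p _ hp
    rw [Finset.sum_eq_zero, mul_zero]
    intro s _
    refine Finset.sum_eq_zero fun t _ => if_neg ?_
    rintro ⟨f⟩
    exact hp f.nV_eq.symm
  · intro h
    exact (h (Finset.mem_range.mpr hN)).elim

end FinDigraph

open FinDigraph

theorem StabGraph.nE_eq {K : ℕ} (H : StabGraph (K : ℤ)) : H.1.nE = K + H.1.nV := by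
  have := H.2.2.1
  unfold FinDigraph.weight at this
  omega

theorem FinDigraph.Semistable.nV_le {K : ℕ} {G : FinDigraph} (h : G.Semistable)
    (h' : G.nE = K + G.nV) : G.nV ≤ 2 * K := by
  have := h.three_mul_nV_le
  omega

/-- Labelled digraphs need no division by symmetries when vertices and edges are added. The bound on
`N` is enough because a semistable digraph of weight `K` has at most `2 * K` vertices. -/
theorem graphCombination_eq_labelledSum {n K N : ℕ} (hN : 2 * K < N) (c : StabClass (K : ℤ) → ℂ)
    (g : (Fin n → ℂ) → Matrix (Fin n) (Fin n) ℂ) (z : Fin n → ℂ) :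
    graphCombination n c g z = labelledSum K N fun G => extendByZero c G * G.eval g z := by
  classical
  let _ : Fintype (StabClass (K : ℤ)) := Fintype.ofFinite _
  -- A digraph in the support of the extension is isomorphic to the chosen representative of exactly
  -- one class, any other digraph to none.
  have hY : ∀ G : FinDigraph, extendByZero c G * G.eval g z =
      ∑ C : StabClass (K : ℤ), c C * C.out.1.eval g z *
        if Nonempty (Iso C.out.1 G) then 1 else 0 := by
    intro G
    by_cases h : G.Semistable ∧ G.weight = K ∧ G.Stabilizable
    · have hG : extendByZero c G = c (Quotient.mk _ ⟨G, h⟩) := dif_pos h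
      rw [Finset.sum_eq_single (⟦⟨G, h⟩⟧ : StabClass (K : ℤ))]
      · obtain ⟨f⟩ : Nonempty (Iso (⟦⟨G, h⟩⟧ : StabClass (K : ℤ)).out.1 G) :=
          Quotient.exact (Quotient.out_eq (⟦⟨G, h⟩⟧ : StabClass (K : ℤ)))
        rw [if_pos ⟨f⟩, hG, eval_eq_of_iso f, mul_one]
      · intro C _ hC
        rw [if_neg, mul_zero]
        intro hf
        apply hC
        rw [← Quotient.out_eq C]
        exact Quotient.sound hf
      · simp
    · have hG : extendByZero c G = 0 := dif_neg h
      rw [hG, zero_mul, Finset.sum_eq_zero]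
      intro C _
      rw [if_neg, mul_zero]
      rintro ⟨f⟩
      have h1 : extendByZero (k := K) (fun _ => 1) C.out.1 ≠ 0 := by
        unfold extendByZero
        rw [dif_pos C.out.2]
        exact one_ne_zero
      rw [extendByZero_of_iso _ f] at h1
      exact h (extendByZero_mem h1)
  have hsum : (labelledSum K N fun G => extendByZero c G * G.eval g z) =
      ∑ C : StabClass (K : ℤ), c C * C.out.1.eval g z *
        labelledSum K N (fun H => if Nonempty (Iso C.out.1 H) then 1 else 0) := by
    simp only [hY, labelledSum_sum, labelledSum_const_mul]
  rw [hsum, graphCombination, finsum_eq_sum_of_fintype]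
  refine Finset.sum_congr rfl fun C _ => ?_
  rw [labelledSum_isomorphic _ C.out.nE_eq
    (lt_of_le_of_lt (C.out.2.1.nV_le C.out.nE_eq) hN)]
  have : C.term g z = (-1 : ℂ) ^ C.out.1.nV / (C.out.1.autCard : ℂ) * C.out.1.eval g z := by
    conv_lhs => rw [← Quotient.out_eq C]
    rfl
  rw [this]
  ring

end

noncomputable section

/-! ### The variation of graph expressions and expanded digraphs -/

namespace FinDigraph

variable {n p q : ℕ}

/-- The fiber of a map between finite index sets. -/
def fiber (s : Fin q → Fin p) (w : Fin p) : Finset (Fin q) := Finset.univ.filter fun d => s d = w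

@[simp] theorem mem_fiber {s : Fin q → Fin p} {w : Fin p} {d : Fin q} :
    d ∈ fiber s w ↔ s d = w := by
  simp [fiber]

/-- `FinDigraph.eval` for an arbitrary system of jets `J` and an arbitrary inverse metric `B`. -/
def jetEval (J : Multiset (Fin n) → Multiset (Fin n) → ℂ) (B : Matrix (Fin n) (Fin n) ℂ)
    (s t : Fin q → Fin p) : ℂ :=
  ∑ a : Fin q → Fin n, ∑ b : Fin q → Fin n,
    (∏ e, B (b e) (a e)) * ∏ v, J ((fiber s v).val.map a) ((fiber t v).val.map b)

/-- The contribution to the variation of `jetEval` under a holomorphic vector field with jets `ξ`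
that comes from the vertex `v` and the set `S` of outward edges at `v`. -/
def fieldTerm (J : Multiset (Fin n) → Multiset (Fin n) → ℂ) (B : Matrix (Fin n) (Fin n) ℂ)
    (ξ : Fin n → Multiset (Fin n) → ℂ) (s t : Fin q → Fin p) (v : Fin p) (S : Finset (Fin q)) :
    ℂ :=
  ∑ c : Fin n, ∑ a : Fin q → Fin n, ∑ b : Fin q → Fin n,
    (∏ e, B (b e) (a e)) * ξ c (S.val.map a) *
      ∏ w, J (if w = v then c ::ₘ (fiber s v \ S).val.map a else (fiber s w).val.map a)
        ((fiber t w).val.map b)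

/-- The variation of `jetEval` under a holomorphic vector field with jets `ξ`. -/
def fieldSum (J : Multiset (Fin n) → Multiset (Fin n) → ℂ) (B : Matrix (Fin n) (Fin n) ℂ)
    (ξ : Fin n → Multiset (Fin n) → ℂ) (s t : Fin q → Fin p) : ℂ :=
  ∑ v, ∑ S ∈ (fiber s v).powerset, if 2 ≤ S.card then fieldTerm J B ξ s t v S else 0

theorem fiber_perm (s : Fin q → Fin p) (π : Equiv.Perm (Fin p)) (ρ : Equiv.Perm (Fin q))
    (w : Fin p) :
    fiber (fun e => π (s (ρ e))) (π w) = (fiber s w).map ρ.symm.toEmbedding := by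
  ext e
  obtain ⟨d, rfl⟩ := ρ.symm.surjective e
  simp

theorem fieldTerm_perm (J : Multiset (Fin n) → Multiset (Fin n) → ℂ)
    (B : Matrix (Fin n) (Fin n) ℂ) (ξ : Fin n → Multiset (Fin n) → ℂ) (s t : Fin q → Fin p)
    (π : Equiv.Perm (Fin p)) (ρ : Equiv.Perm (Fin q)) (v : Fin p) (S : Finset (Fin q)) :
    fieldTerm J B ξ (fun e => π (s (ρ e))) (fun e => π (t (ρ e))) (π v)
      (S.map ρ.symm.toEmbedding) = fieldTerm J B ξ s t v S := by
  unfold fieldTerm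
  refine Finset.sum_congr rfl fun c _ => ?_
  symm
  refine Fintype.sum_equiv (ρ.symm.arrowCongr (Equiv.refl _)) _ _ fun a => ?_
  refine Fintype.sum_equiv (ρ.symm.arrowCongr (Equiv.refl _)) _ _ fun b => ?_
  congr 1
  · congr 1
    · exact Fintype.prod_equiv ρ.symm _ _ fun e => by simp
    · simp [Finset.map_val, Multiset.map_map, Function.comp_def]
  · refine Fintype.prod_equiv π _ _ fun w => ?_
    rw [fiber_perm, fiber_perm, fiber_perm, ← Finset.map_sdiff]
    simp [Finset.map_val, Multiset.map_map, Function.comp_def]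

section Expansion

/-- The map of vertices that identifies the new vertex `0` with `v`. -/
def merge (v : Fin p) : Fin (p + 1) → Fin p := Fin.cons v id

@[simp] theorem merge_zero (v : Fin p) : merge v 0 = v := rfl

@[simp] theorem merge_succ (v w : Fin p) : merge v w.succ = w := rfl

/-- The tails of the edges of a digraph in which `0` is a vertex whose only inward edge is the
edge `0`, coming from the vertex `v.succ`. -/
def expandSrc (v : Fin p) (σ : Fin q → Fin (p + 1)) : Fin (q + 1) → Fin (p + 1) :=
  Fin.cons v.succ σ

/-- The heads of the edges of a digraph in which `0` is a vertex whose only inward edge is the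
edge `0`. -/
def expandTgt (t : Fin q → Fin p) : Fin (q + 1) → Fin (p + 1) := Fin.cons 0 fun d => (t d).succ

/-- The tails of the edges after the contraction of the edge `0`. -/
def collapseSrc (v : Fin p) (σ : Fin q → Fin (p + 1)) : Fin q → Fin p := fun d => merge v (σ d)

def expand (v : Fin p) (σ : Fin q → Fin (p + 1)) (t : Fin q → Fin p) : FinDigraph :=
  ⟨p + 1, q + 1, expandSrc v σ, expandTgt t⟩

/-- The digraph obtained from `expand v σ t` by contracting the edge `0`. -/
def collapse (v : Fin p) (σ : Fin q → Fin (p + 1)) (t : Fin q → Fin p) : FinDigraph :=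
  ⟨p, q, collapseSrc v σ, t⟩

variable (v : Fin p) (σ : Fin q → Fin (p + 1)) (t : Fin q → Fin p)

theorem fiber_expandSrc_zero :
    fiber (expandSrc v σ) 0 = (fiber σ 0).map (Fin.succEmb q) := by
  ext e
  refine Fin.cases ?_ (fun d => ?_) e <;> simp [expandSrc]

theorem fiber_expandSrc_succ (w : Fin p) :
    fiber (expandSrc v σ) w.succ = if w = v then
      Finset.cons (0 : Fin (q + 1)) ((fiber σ v.succ).map (Fin.succEmb q)) (by simp)
      else (fiber σ w.succ).map (Fin.succEmb q) := by
  ext e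
  by_cases hw : w = v
  · subst hw
    refine Fin.cases ?_ (fun d => ?_) e <;> simp [expandSrc]
  · refine Fin.cases ?_ (fun d => ?_) e <;> simp [expandSrc, hw, Ne.symm hw]

theorem fiber_expandTgt_zero : fiber (expandTgt t) 0 = {0} := by
  ext e
  refine Fin.cases ?_ (fun d => ?_) e <;> simp [expandTgt]

theorem fiber_expandTgt_succ (w : Fin p) :
    fiber (expandTgt t) w.succ = (fiber t w).map (Fin.succEmb q) := by
  ext e
  refine Fin.cases ?_ (fun d => ?_) e <;> simp [expandTgt, (Fin.succ_ne_zero w).symm]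

theorem fiber_collapseSrc (w : Fin p) :
    fiber (collapseSrc v σ) w = if w = v then fiber σ 0 ∪ fiber σ v.succ
      else fiber σ w.succ := by
  ext d
  by_cases hw : w = v
  · subst hw
    rw [if_pos rfl, mem_fiber, Finset.mem_union, mem_fiber, mem_fiber, collapseSrc]
    refine Fin.cases ?_ (fun d => ?_) (σ d) <;> simp
  · rw [if_neg hw, mem_fiber, mem_fiber, collapseSrc]
    refine Fin.cases ?_ (fun d => ?_) (σ d) <;> simp [Ne.symm hw, (Fin.succ_ne_zero w).symm]

theorem disjoint_fiber {s : Fin q → Fin p} {w w' : Fin p} (h : w ≠ w') :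
    Disjoint (fiber s w) (fiber s w') := by
  rw [Finset.disjoint_left]
  intro d hd hd'
  rw [mem_fiber] at hd hd'
  exact h (hd.symm.trans hd')

theorem fiber_collapseSrc_sdiff :
    fiber (collapseSrc v σ) v \ fiber σ 0 = fiber σ v.succ := by
  rw [fiber_collapseSrc, if_pos rfl, Finset.union_sdiff_cancel_left]
  exact disjoint_fiber (Fin.succ_ne_zero v).symm

/-- The value of `fieldTerm` in terms of the expanded digraph. -/
def expandTerm (J : Multiset (Fin n) → Multiset (Fin n) → ℂ) (B : Matrix (Fin n) (Fin n) ℂ)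
    (ξ : Fin n → Multiset (Fin n) → ℂ) : ℂ :=
  ∑ c : Fin n, ∑ a : Fin q → Fin n, ∑ b : Fin q → Fin n,
    (∏ e, B (b e) (a e)) *
      ξ c ((fiber (expandSrc v σ) 0).val.map (Fin.cons c a : Fin (q + 1) → Fin n)) *
      ∏ w : Fin p, J ((fiber (expandSrc v σ) w.succ).val.map (Fin.cons c a : Fin (q + 1) → Fin n))
        ((fiber (expandTgt t) w.succ).val.map (Fin.cons c b : Fin (q + 1) → Fin n))

theorem map_cons_succEmb {α : Type*} (S : Finset (Fin q)) (c : α) (a : Fin q → α) :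
    (S.map (Fin.succEmb q)).val.map (Fin.cons c a : Fin (q + 1) → α) = S.val.map a := by
  simp [Finset.map_val, Multiset.map_map]

/-- The edges detached from `v` are the outward edges of the new vertex `0`, and the index `c` that
replaces them at `v` labels the edge `0` joining the two. -/
theorem fieldTerm_collapse (J : Multiset (Fin n) → Multiset (Fin n) → ℂ)
    (B : Matrix (Fin n) (Fin n) ℂ) (ξ : Fin n → Multiset (Fin n) → ℂ) :
    fieldTerm J B ξ (collapseSrc v σ) t v (fiber σ 0) = expandTerm v σ t J B ξ := by
  unfold fieldTerm expandTerm
  refine Finset.sum_congr rfl fun c _ => ?_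
  refine Finset.sum_congr rfl fun a _ => ?_
  refine Finset.sum_congr rfl fun b _ => ?_
  congr 1
  · rw [fiber_expandSrc_zero, map_cons_succEmb]
  · refine Finset.prod_congr rfl fun w _ => ?_
    rw [fiber_expandTgt_succ, map_cons_succEmb, fiber_expandSrc_succ, fiber_collapseSrc_sdiff,
      fiber_collapseSrc]
    by_cases hw : w = v
    · simp only [if_pos hw, Finset.cons_val, Multiset.map_cons, map_cons_succEmb, Fin.cons_zero]
    · simp only [if_neg hw, map_cons_succEmb]

theorem sum_fin_succ_arrow {α M : Type*} [Fintype α] [AddCommMonoid M]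
    (f : (Fin (q + 1) → α) → M) :
    ∑ a, f a = ∑ x : α, ∑ a : Fin q → α, f (Fin.cons x a) := by
  rw [← Fintype.sum_prod_type']
  exact (Fintype.sum_equiv (Fin.consEquiv fun _ => α) _ _ fun a => rfl).symm

/-- When the vertex `0` gives all its outward edges to the field, it is left with the factor `J {c}
{b0}`. By `hB` this cancels the inverse metric on the only inward edge and forces the label `c` at
the tail of that edge. -/
theorem fieldTerm_expand (J : Multiset (Fin n) → Multiset (Fin n) → ℂ)
    (B : Matrix (Fin n) (Fin n) ℂ) (ξ : Fin n → Multiset (Fin n) → ℂ)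
    (hB : ∀ c a, ∑ b, J {c} {b} * B b a = if c = a then 1 else 0) :
    fieldTerm J B ξ (expandSrc v σ) (expandTgt t) 0 (fiber (expandSrc v σ) 0)
      = expandTerm v σ t J B ξ := by
  unfold fieldTerm expandTerm
  refine Finset.sum_congr rfl fun c _ => ?_
  have h : ∀ (a0 : Fin n) (a : Fin q → Fin n) (b0 : Fin n) (b : Fin q → Fin n),
      (∏ e : Fin (q + 1), B ((Fin.cons b0 b : Fin (q + 1) → Fin n) e)
        ((Fin.cons a0 a : Fin (q + 1) → Fin n) e)) *
        ξ c ((fiber (expandSrc v σ) 0).val.map (Fin.cons a0 a : Fin (q + 1) → Fin n)) *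
        ∏ w : Fin (p + 1), J (if w = 0 then c ::ₘ (fiber (expandSrc v σ) 0 \
            fiber (expandSrc v σ) 0).val.map (Fin.cons a0 a : Fin (q + 1) → Fin n) else
            (fiber (expandSrc v σ) w).val.map (Fin.cons a0 a : Fin (q + 1) → Fin n))
          ((fiber (expandTgt t) w).val.map (Fin.cons b0 b : Fin (q + 1) → Fin n)) =
      (J {c} {b0} * B b0 a0) * ((∏ e, B (b e) (a e)) *
        ξ c ((fiber (expandSrc v σ) 0).val.map (Fin.cons c a : Fin (q + 1) → Fin n)) *
        ∏ w : Fin p, J ((fiber (expandSrc v σ) w.succ).val.map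
            (Fin.cons a0 a : Fin (q + 1) → Fin n))
          ((fiber (expandTgt t) w.succ).val.map (Fin.cons c b : Fin (q + 1) → Fin n))) := by
    intro a0 a b0 b
    rw [Fin.prod_univ_succ, Fin.prod_univ_succ, if_pos rfl, sdiff_self, fiber_expandTgt_zero,
      fiber_expandSrc_zero, map_cons_succEmb, map_cons_succEmb]
    simp only [Fin.succ_ne_zero, if_false, fiber_expandTgt_succ, map_cons_succEmb]
    simp
    ring
  calc _ = ∑ a0, ∑ a : Fin q → Fin n, ∑ b0, ∑ b : Fin q → Fin n,
        (J {c} {b0} * B b0 a0) * ((∏ e, B (b e) (a e)) *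
        ξ c ((fiber (expandSrc v σ) 0).val.map (Fin.cons c a : Fin (q + 1) → Fin n)) *
        ∏ w : Fin p, J ((fiber (expandSrc v σ) w.succ).val.map
            (Fin.cons a0 a : Fin (q + 1) → Fin n))
          ((fiber (expandTgt t) w.succ).val.map (Fin.cons c b : Fin (q + 1) → Fin n))) := by
        rw [sum_fin_succ_arrow]
        refine Finset.sum_congr rfl fun a0 _ => ?_
        refine Finset.sum_congr rfl fun a _ => ?_
        rw [sum_fin_succ_arrow]
        refine Finset.sum_congr rfl fun b0 _ => ?_
        refine Finset.sum_congr rfl fun b _ => ?_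
        exact h a0 a b0 b
    _ = _ := by
        simp only [← Finset.mul_sum, ← Finset.sum_mul, hB, ite_mul, one_mul, zero_mul]
        rw [Finset.sum_comm]
        simp

end Expansion

/-- Maps to `Fin (p + 1)` correspond to maps to `Fin p` with a distinguished subset of the fiber
over `v`. -/
theorem sum_powerset_fiber {M : Type*} [AddCommMonoid M] (v : Fin p)
    (f : (Fin q → Fin p) → Finset (Fin q) → M) :
    ∑ s : Fin q → Fin p, ∑ S ∈ (fiber s v).powerset, f s S =
      ∑ σ : Fin q → Fin (p + 1), f (collapseSrc v σ) (fiber σ 0) := by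
  rw [Finset.sum_sigma']
  refine Finset.sum_bij' (fun x _ d => if d ∈ x.2 then 0 else (x.1 d).succ)
    (fun σ _ => ⟨collapseSrc v σ, fiber σ 0⟩) ?_ ?_ ?_ ?_ ?_
  · intros; simp
  · intro σ _
    simp only [Finset.mem_sigma, Finset.mem_univ, true_and, Finset.mem_powerset]
    rw [fiber_collapseSrc, if_pos rfl]
    exact Finset.subset_union_left
  · rintro ⟨s, S⟩ h
    simp only [Finset.mem_sigma, Finset.mem_univ, true_and, Finset.mem_powerset] at h
    have h1 : collapseSrc v (fun d => if d ∈ S then 0 else (s d).succ) = s := by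
      funext d
      by_cases hd : d ∈ S
      · simp [collapseSrc, hd, mem_fiber.mp (h hd)]
      · simp [collapseSrc, hd]
    have h2 : fiber (fun d => if d ∈ S then 0 else (s d).succ) 0 = S := by
      ext d
      by_cases hd : d ∈ S <;> simp [hd]
    simp only [h1, h2]
  · intro σ _
    funext d
    simp only [mem_fiber, collapseSrc]
    refine Fin.cases ?_ (fun d => ?_) (σ d) <;> simp
  · rintro ⟨s, S⟩ h
    simp only [Finset.mem_sigma, Finset.mem_univ, true_and, Finset.mem_powerset] at h
    have h1 : collapseSrc v (fun d => if d ∈ S then 0 else (s d).succ) = s := by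
      funext d
      by_cases hd : d ∈ S
      · simp [collapseSrc, hd, mem_fiber.mp (h hd)]
      · simp [collapseSrc, hd]
    have h2 : fiber (fun d => if d ∈ S then 0 else (s d).succ) 0 = S := by
      ext d
      by_cases hd : d ∈ S <;> simp [hd]
    rw [h1, h2]

/-- A relabelling moves any vertex and any edge to `0`, so all pairs `(w, e)` contribute equally. -/
theorem sum_labellings_eq (F : (Fin (q + 1) → Fin (p + 1)) → (Fin (q + 1) → Fin (p + 1)) →
    Fin (p + 1) → Fin (q + 1) → ℂ)
    (hF : ∀ (π : Equiv.Perm (Fin (p + 1))) (ρ : Equiv.Perm (Fin (q + 1))) s t w e,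
      F (fun d => π (s (ρ d))) (fun d => π (t (ρ d))) (π w) (ρ.symm e) = F s t w e) :
    ∑ s, ∑ t, ∑ w, ∑ e, F s t w e = (p + 1) * (q + 1) * ∑ s, ∑ t, F s t 0 0 := by
  have h : ∀ w e, ∑ s, ∑ t, F s t w e = ∑ s, ∑ t, F s t 0 0 := by
    intro w e
    let π := Equiv.swap w 0
    let ρ := Equiv.swap e 0
    let E : (Fin (q + 1) → Fin (p + 1)) ≃ (Fin (q + 1) → Fin (p + 1)) :=
      ρ.symm.arrowCongr π
    refine Fintype.sum_equiv E _ _ fun s => ?_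
    refine Fintype.sum_equiv E _ _ fun t => ?_
    rw [← hF π ρ s t w e]
    have h1 : π w = 0 := Equiv.swap_apply_left w 0
    have h2 : ρ.symm e = 0 := by simp [ρ]
    rw [h1, h2]
    rfl
  calc _ = ∑ w, ∑ e, ∑ s, ∑ t, F s t w e := by
        calc _ = ∑ s, ∑ w, ∑ t, ∑ e, F s t w e :=
              Finset.sum_congr rfl fun s _ => Finset.sum_comm
          _ = ∑ w, ∑ s, ∑ t, ∑ e, F s t w e := Finset.sum_comm
          _ = ∑ w, ∑ s, ∑ e, ∑ t, F s t w e :=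
              Finset.sum_congr rfl fun w _ => Finset.sum_congr rfl fun s _ => Finset.sum_comm
          _ = _ := Finset.sum_congr rfl fun w _ => Finset.sum_comm
    _ = _ := by
        simp only [h]
        simp
        ring


/-- The part of the variation that comes from the vertices with a single inward edge, varied with
all their outward edges. -/
def totalFieldSum (J : Multiset (Fin n) → Multiset (Fin n) → ℂ) (B : Matrix (Fin n) (Fin n) ℂ)
    (ξ : Fin n → Multiset (Fin n) → ℂ) (s t : Fin q → Fin p) : ℂ :=
  ∑ v, if (fiber t v).card = 1 ∧ 2 ≤ (fiber s v).card then fieldTerm J B ξ s t v (fiber s v) else 0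

/-- The vertex `v.succ` of `expand v σ t` has at least three half-edges. -/
def Proper (v : Fin p) (σ : Fin q → Fin (p + 1)) (t : Fin q → Fin p) : Prop :=
  ¬ (fiber (collapseSrc v σ) v = fiber σ 0 ∧ (fiber t v).card = 1)

-- The terms in which a vertex of in-degree one gives up all its outward edges are set apart:
-- expanding them would create a vertex with one inward and one outward edge. In the others, a tail
-- map together with a subset of the fiber over `v` is encoded by a map to `Fin (p + 1)`.
open Classical in
theorem sum_mul_fieldSum (J : Multiset (Fin n) → Multiset (Fin n) → ℂ)
    (B : Matrix (Fin n) (Fin n) ℂ) (ξ : Fin n → Multiset (Fin n) → ℂ)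
    (Y : FinDigraph → ℂ) :
    ∑ s : Fin q → Fin p, ∑ t : Fin q → Fin p, Y ⟨p, q, s, t⟩ * fieldSum J B ξ s t =
      (∑ s : Fin q → Fin p, ∑ t : Fin q → Fin p, Y ⟨p, q, s, t⟩ * totalFieldSum J B ξ s t) +
      ∑ v : Fin p, ∑ σ : Fin q → Fin (p + 1), ∑ t : Fin q → Fin p,
        if 2 ≤ (fiber σ 0).card ∧ Proper v σ t then
          Y (collapse v σ t) * expandTerm v σ t J B ξ else 0 := by
  have h1 : ∀ s t : Fin q → Fin p, fieldSum J B ξ s t = totalFieldSum J B ξ s t +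
      ∑ v, ∑ S ∈ (fiber s v).powerset,
        if 2 ≤ S.card ∧ ¬ (fiber s v = S ∧ (fiber t v).card = 1) then
          fieldTerm J B ξ s t v S else 0 := by
    intro s t
    unfold fieldSum totalFieldSum
    rw [← Finset.sum_add_distrib]
    refine Finset.sum_congr rfl fun v _ => ?_
    have h2 : (if (fiber t v).card = 1 ∧ 2 ≤ (fiber s v).card then
        fieldTerm J B ξ s t v (fiber s v) else 0) = ∑ S ∈ (fiber s v).powerset,
          if 2 ≤ S.card ∧ (fiber s v = S ∧ (fiber t v).card = 1) then
            fieldTerm J B ξ s t v S else 0 := by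
      rw [Finset.sum_eq_single (fiber s v)]
      · congr 1
        simp only [true_and, and_comm]
      · intro S _ hS
        exact if_neg fun h => hS h.2.1.symm
      · simp
    rw [h2, ← Finset.sum_add_distrib]
    refine Finset.sum_congr rfl fun S _ => ?_
    by_cases h3 : 2 ≤ S.card <;> by_cases h4 : fiber s v = S ∧ (fiber t v).card = 1 <;>
      simp [h3, h4]
  simp only [h1, mul_add, Finset.sum_add_distrib]
  congr 1
  calc _ = ∑ t : Fin q → Fin p, ∑ v, ∑ s : Fin q → Fin p, ∑ S ∈ (fiber s v).powerset,
        if 2 ≤ S.card ∧ ¬ (fiber s v = S ∧ (fiber t v).card = 1) then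
          Y ⟨p, q, s, t⟩ * fieldTerm J B ξ s t v S else 0 := by
        rw [Finset.sum_comm]
        refine Finset.sum_congr rfl fun t _ => ?_
        rw [Finset.sum_comm]
        simp only [Finset.mul_sum, mul_ite, mul_zero]
    _ = ∑ t : Fin q → Fin p, ∑ v : Fin p, ∑ σ : Fin q → Fin (p + 1),
        if 2 ≤ (fiber σ 0).card ∧ Proper v σ t then
          Y (collapse v σ t) * expandTerm v σ t J B ξ else 0 := by
        refine Finset.sum_congr rfl fun t _ => ?_
        refine Finset.sum_congr rfl fun v _ => ?_
        rw [sum_powerset_fiber v fun s S =>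
          if 2 ≤ S.card ∧ ¬ (fiber s v = S ∧ (fiber t v).card = 1) then
          Y ⟨p, q, s, t⟩ * fieldTerm J B ξ s t v S else 0]
        simp only [fieldTerm_collapse]
        refine Finset.sum_congr rfl fun σ _ => ?_
        by_cases h : 2 ≤ (fiber σ 0).card ∧ Proper v σ t
        · rw [if_pos h]
          exact if_pos h
        · rw [if_neg h]
          exact if_neg h
    _ = _ := by
        rw [Finset.sum_comm]
        refine Finset.sum_congr rfl fun v _ => ?_
        rw [Finset.sum_comm]

-- The terms set apart are exactly those that an expanded digraph produces at its new vertex, once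
-- this vertex and its only inward edge have been labelled `0`.
open Classical in
theorem sum_mul_totalFieldSum (J : Multiset (Fin n) → Multiset (Fin n) → ℂ)
    (B : Matrix (Fin n) (Fin n) ℂ) (ξ : Fin n → Multiset (Fin n) → ℂ)
    (hB : ∀ c a, ∑ b, J {c} {b} * B b a = if c = a then 1 else 0)
    (Y : FinDigraph → ℂ) (hY : ∀ G H, Iso G H → Y G = Y H)
    (hloop : ∀ G e, G.src e = G.tgt e → G.inDeg (G.tgt e) = 1 → Y G = 0) :
    ∑ s : Fin (q + 1) → Fin (p + 1), ∑ t : Fin (q + 1) → Fin (p + 1),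
      Y ⟨p + 1, q + 1, s, t⟩ * totalFieldSum J B ξ s t =
      (p + 1) * (q + 1) * ∑ v : Fin p, ∑ σ : Fin q → Fin (p + 1), ∑ t : Fin q → Fin p,
        if 2 ≤ (fiber σ 0).card then Y (expand v σ t) * expandTerm v σ t J B ξ else 0 := by
  let F : (Fin (q + 1) → Fin (p + 1)) → (Fin (q + 1) → Fin (p + 1)) →
    Fin (p + 1) → Fin (q + 1) → ℂ := fun s t w e =>
      if fiber t w = {e} ∧ 2 ≤ (fiber s w).card then
        Y ⟨p + 1, q + 1, s, t⟩ * fieldTerm J B ξ s t w (fiber s w) else 0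
  have hF : ∀ (π : Equiv.Perm (Fin (p + 1))) (ρ : Equiv.Perm (Fin (q + 1))) s t w e,
      F (fun d => π (s (ρ d))) (fun d => π (t (ρ d))) (π w) (ρ.symm e) = F s t w e := by
    intro π ρ s t w e
    simp only [F]
    rw [fiber_perm, fiber_perm, fieldTerm_perm, Finset.card_map]
    have h1 : (fiber t w).map ρ.symm.toEmbedding = {ρ.symm e} ↔ fiber t w = {e} := by
      rw [← Finset.map_inj (f := ρ.symm.toEmbedding) (s₁ := fiber t w), Finset.map_singleton]
      rfl
    have h2 : Y ⟨p + 1, q + 1, fun d => π (s (ρ d)), fun d => π (t (ρ d))⟩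
        = Y ⟨p + 1, q + 1, s, t⟩ :=
      (hY _ _ ⟨π, ρ.symm, fun e => by simp, fun e => by simp⟩).symm
    simp only [h1, h2]
  have h1 : ∀ s t : Fin (q + 1) → Fin (p + 1),
      Y ⟨p + 1, q + 1, s, t⟩ * totalFieldSum J B ξ s t = ∑ w, ∑ e, F s t w e := by
    intro s t
    unfold totalFieldSum
    rw [Finset.mul_sum]
    refine Finset.sum_congr rfl fun w _ => ?_
    by_cases hw : (fiber t w).card = 1
    · obtain ⟨e, he⟩ := Finset.card_eq_one.mp hw
      rw [Finset.sum_eq_single e]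
      · simp [F, he]
      · intro e' _ hne
        simp only [F]
        rw [if_neg]
        rintro ⟨h2, -⟩
        rw [he, Finset.singleton_inj] at h2
        exact hne h2.symm
      · simp
    · rw [if_neg (fun h => hw h.1), mul_zero, Finset.sum_eq_zero]
      intro e _
      simp only [F]
      rw [if_neg]
      rintro ⟨h2, -⟩
      rw [h2] at hw
      simp at hw
  simp only [h1]
  rw [sum_labellings_eq F hF]
  congr 1
  have h2 : ∀ s : Fin (q + 1) → Fin (p + 1),
      ∑ t, F s t 0 0 = ∑ t : Fin q → Fin p, F s (expandTgt t) 0 0 := by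
    intro s
    symm
    refine Fintype.sum_of_injective expandTgt ?_ _ _ ?_ fun _ => rfl
    · intro t t' h
      funext d
      have := congrFun h d.succ
      simpa [expandTgt] using this
    · intro t ht
      simp only [F]
      rw [if_neg]
      rintro ⟨h3, -⟩
      apply ht
      have h4 : ∀ d : Fin q, t d.succ ≠ 0 := by
        intro d hd
        have : d.succ ∈ fiber t 0 := mem_fiber.mpr hd
        rw [h3, Finset.mem_singleton] at this
        exact Fin.succ_ne_zero d this
      have h5 : t 0 = 0 := by
        rw [← mem_fiber, h3, Finset.mem_singleton]
      refine ⟨fun d => (t d.succ).pred (h4 d), ?_⟩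
      funext e
      refine Fin.cases ?_ (fun d => ?_) e
      · simp [expandTgt, h5]
      · simp [expandTgt]
  simp only [h2]
  -- The edge `0` starts either at the vertex `0`, in which case it is a loop and `hloop` applies,
  -- or at some `v.succ`.
  rw [sum_fin_succ_arrow, Fin.sum_univ_succ, Finset.sum_eq_zero, zero_add]
  · refine Finset.sum_congr rfl fun v _ => ?_
    refine Finset.sum_congr rfl fun σ _ => ?_
    refine Finset.sum_congr rfl fun t _ => ?_
    have h3 : fieldTerm J B ξ (Fin.cons v.succ σ) (expandTgt t) 0
        (fiber (Fin.cons v.succ σ : Fin (q + 1) → Fin (p + 1)) 0) = expandTerm v σ t J B ξ :=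
      fieldTerm_expand v σ t J B ξ hB
    have h4 : (fiber (Fin.cons v.succ σ : Fin (q + 1) → Fin (p + 1)) 0).card = (fiber σ 0).card := by
      have := fiber_expandSrc_zero v σ
      rw [expandSrc] at this
      rw [this, Finset.card_map]
    simp only [F]
    rw [h3, h4, fiber_expandTgt_zero]
    simp only [true_and]
    rfl
  · intro σ _
    refine Finset.sum_eq_zero fun t _ => ?_
    simp only [F]
    rw [hloop ⟨p + 1, q + 1, Fin.cons 0 σ, expandTgt t⟩ (0 : Fin (q + 1)) rfl, zero_mul, ite_self]
    show (fiber (expandTgt t) 0).card = 1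
    rw [fiber_expandTgt_zero, Finset.card_singleton]

/-- One more vertex and one more edge cost a factor for the choice of labels and a sign; the sign is
what turns the sum of the two contributions into a difference. -/
theorem labelWeight_succ (K p : ℕ) :
    labelWeight K (p + 1) * ((p + 1) * ((K + p : ℕ) + 1)) = - labelWeight K p := by
  unfold labelWeight
  rw [← add_assoc, Nat.factorial_succ, Nat.factorial_succ, pow_succ]
  have h5 : (p.factorial : ℂ) ≠ 0 := by exact_mod_cast p.factorial_ne_zero
  have h6 : ((K + p).factorial : ℂ) ≠ 0 := by exact_mod_cast (K + p).factorial_ne_zero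
  have h7 : ((p + 1 : ℕ) : ℂ) ≠ 0 := by exact_mod_cast p.succ_ne_zero
  have h8 : ((K + p + 1 : ℕ) : ℂ) ≠ 0 := by exact_mod_cast (K + p).succ_ne_zero
  push_cast at h7 h8 ⊢
  field_simp

open Classical in
/-- The variation of a combination of digraphs, as a sum over expanded digraphs. -/
theorem labelledSum_mul_fieldSum (J : Multiset (Fin n) → Multiset (Fin n) → ℂ)
    (B : Matrix (Fin n) (Fin n) ℂ) (ξ : Fin n → Multiset (Fin n) → ℂ)
    (hB : ∀ c a, ∑ b, J {c} {b} * B b a = if c = a then 1 else 0)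
    (Y : FinDigraph → ℂ) (hY : ∀ G H, Iso G H → Y G = Y H)
    (hloop : ∀ G e, G.src e = G.tgt e → G.inDeg (G.tgt e) = 1 → Y G = 0) (K N : ℕ)
    (hN : ∀ s t, Y ⟨N, K + N, s, t⟩ = 0) :
    labelledSum K N (fun G => Y G * fieldSum J B ξ G.src G.tgt) =
      ∑ p ∈ Finset.range N, labelWeight K p *
        ∑ v : Fin p, ∑ σ : Fin (K + p) → Fin (p + 1), ∑ t : Fin (K + p) → Fin p,
          if 2 ≤ (fiber σ 0).card then
            ((if Proper v σ t then Y (collapse v σ t) else 0) - Y (expand v σ t)) *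
              expandTerm v σ t J B ξ else 0 := by
  let T : ℕ → ℂ := fun p => ∑ s : Fin (K + p) → Fin p, ∑ t : Fin (K + p) → Fin p,
    Y ⟨p, K + p, s, t⟩ * totalFieldSum J B ξ s t
  have hT0 : T 0 = 0 := by
    refine Finset.sum_eq_zero fun s _ => Finset.sum_eq_zero fun t _ => ?_
    simp [totalFieldSum]
  have hTN : T N = 0 := by
    refine Finset.sum_eq_zero fun s _ => Finset.sum_eq_zero fun t _ => ?_
    rw [hN, zero_mul]
  -- Both boundary terms vanish, so the terms set apart for `p + 1` vertices can be paired with the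
  -- remaining ones for `p` vertices.
  have hsum : ∑ p ∈ Finset.range N, labelWeight K p * T p =
      ∑ p ∈ Finset.range N, labelWeight K (p + 1) * T (p + 1) := by
    have h := Finset.sum_range_succ (fun p => labelWeight K p * T p) N
    rw [Finset.sum_range_succ', hT0, hTN, mul_zero, add_zero, mul_zero, add_zero] at h
    exact h.symm
  unfold labelledSum
  calc _ = ∑ p ∈ Finset.range N, (labelWeight K p * T p + labelWeight K p *
        ∑ v : Fin p, ∑ σ : Fin (K + p) → Fin (p + 1), ∑ t : Fin (K + p) → Fin p,
        if 2 ≤ (fiber σ 0).card ∧ Proper v σ t then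
          Y (collapse v σ t) * expandTerm v σ t J B ξ else 0) := by
        refine Finset.sum_congr rfl fun p _ => ?_
        rw [← mul_add, sum_mul_fieldSum J B ξ Y]
    _ = _ := by
        rw [Finset.sum_add_distrib, hsum, ← Finset.sum_add_distrib]
        refine Finset.sum_congr rfl fun p _ => ?_
        have h1 : T (p + 1) = (p + 1) * ((K + p : ℕ) + 1) * _ :=
          sum_mul_totalFieldSum (p := p) (q := K + p) J B ξ hB Y hY hloop
        rw [h1, ← mul_assoc, labelWeight_succ, neg_mul, ← mul_neg, ← mul_add]
        congr 1
        simp only [← Finset.sum_neg_distrib, ← Finset.sum_add_distrib]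
        refine Finset.sum_congr rfl fun v _ => ?_
        refine Finset.sum_congr rfl fun σ _ => ?_
        refine Finset.sum_congr rfl fun t _ => ?_
        by_cases h2 : 2 ≤ (fiber σ 0).card <;> by_cases h3 : Proper v σ t <;> simp [h2, h3]
        ring

end FinDigraph

end

noncomputable section

/-! ### Contraction defects -/

namespace FinDigraph

/-- `IsContraction` leaves the labelling of the result open; this shows that it does not matter. -/
theorem exists_iso_of_contraction {G H G' H' : FinDigraph} (F : Iso G H) {e : Fin G.nE}
    (hG : G.IsContraction e G') (hH : H.IsContraction (F.onE e) H') : Nonempty (Iso G' H') := by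
  obtain ⟨f, ψ, hf, hxy, hψ⟩ := hG
  obtain ⟨f', ψ', hf', hxy', hψ'⟩ := hH
  have key : ∀ x y, f x = f y ↔ f' (F.onV x) = f' (F.onV y) := by
    intro x y
    rw [hxy, hxy']
    simp only [F.map_src, F.map_tgt, EmbeddingLike.apply_eq_iff_eq]
  have hb : Function.Bijective fun x => f' (F.onV (Function.surjInv hf x)) := by
    constructor
    · intro x y hxy
      have := (key _ _).mpr hxy
      rwa [Function.surjInv_eq hf, Function.surjInv_eq hf] at this
    · intro z
      obtain ⟨w, rfl⟩ := hf' z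
      obtain ⟨w, rfl⟩ := F.onV.surjective w
      exact ⟨f w, (key _ _).mp (Function.surjInv_eq hf _)⟩
  have hv : ∀ x, f' (F.onV (Function.surjInv hf (f x))) = f' (F.onV x) := fun x =>
    (key _ _).mp (Function.surjInv_eq hf _)
  let E : {d // d ≠ e} ≃ {d // d ≠ F.onE e} :=
    F.onE.subtypeEquiv fun d => by simp
  refine ⟨⟨Equiv.ofBijective _ hb, (ψ.symm.trans E).trans ψ', fun d => ?_, fun d => ?_⟩⟩
  · obtain ⟨d, rfl⟩ := ψ.surjective d
    rw [(hψ d).1]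
    simp only [Equiv.trans_apply, Equiv.symm_apply_apply, Equiv.ofBijective_apply]
    rw [(hψ' _).1, hv, ← F.map_src]
    rfl
  · obtain ⟨d, rfl⟩ := ψ.surjective d
    rw [(hψ d).2]
    simp only [Equiv.trans_apply, Equiv.symm_apply_apply, Equiv.ofBijective_apply]
    rw [(hψ' _).2, hv, ← F.map_tgt]
    rfl

section

variable {p q : ℕ} (v : Fin p) (σ : Fin q → Fin (p + 1)) (t : Fin q → Fin p)

theorem isContraction_expand :
    (expand v σ t).IsContraction (0 : Fin (q + 1)) (collapse v σ t) := by
  refine ⟨merge v, (finSuccAboveEquiv (0 : Fin (q + 1))).symm, ?_, ?_, ?_⟩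
  · exact fun w => ⟨w.succ, rfl⟩
  · intro x y
    have key : ∀ x y : Fin (p + 1),
        merge v x = merge v y ↔ x = y ∨ (x = v.succ ∧ y = 0) ∨ (x = 0 ∧ y = v.succ) := by
      intro x y
      refine Fin.cases ?_ (fun x => ?_) x <;> refine Fin.cases ?_ (fun y => ?_) y <;>
        simp [(Fin.succ_ne_zero _).symm, eq_comm]
    exact key x y
  · intro d
    obtain ⟨d, rfl⟩ := (finSuccAboveEquiv (0 : Fin (q + 1))).surjective d
    have h1 := (finSuccAboveEquiv (0 : Fin (q + 1))).symm_apply_apply d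
    exact ⟨congrArg (collapseSrc v σ) h1, congrArg t h1⟩

theorem inDeg_expand_zero : (expand v σ t).inDeg (0 : Fin (p + 1)) = 1 :=
  (congrArg Finset.card (fiber_expandTgt_zero t)).trans (Finset.card_singleton _)

theorem contractibleEdge_expand : (expand v σ t).ContractibleEdge (0 : Fin (q + 1)) :=
  ⟨Fin.succ_ne_zero v, Or.inr (inDeg_expand_zero v σ t)⟩

variable {v σ t}

theorem card_fiber_expandSrc_self :
    (fiber (expandSrc v σ) v.succ).card = (fiber σ v.succ).card + 1 := by
  rw [fiber_expandSrc_succ, if_pos rfl, Finset.card_cons, Finset.card_map]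

theorem fiber_collapseSrc_eq_iff :
    fiber (collapseSrc v σ) v = fiber σ 0 ↔ fiber σ v.succ = ∅ := by
  rw [fiber_collapseSrc, if_pos rfl, Finset.union_eq_left]
  constructor
  · intro h
    exact (disjoint_fiber (Fin.succ_ne_zero v)).eq_bot_of_le h
  · intro h
    rw [h]
    exact Finset.empty_subset _

theorem Semistable.proper (h : (expand v σ t).Semistable) : Proper v σ t := by
  rintro ⟨h1, h2⟩
  have h3 := (h (v.succ : Fin (p + 1))).2.2
  change 3 ≤ (fiber (expandTgt t) v.succ).card + (fiber (expandSrc v σ) v.succ).card at h3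
  rw [fiber_collapseSrc_eq_iff] at h1
  rw [card_fiber_expandSrc_self, h1, fiber_expandTgt_succ, Finset.card_map, h2] at h3
  simp at h3

/-- The new vertex has one inward and at least two outward edges. At `v.succ` the detached edges are
replaced by the edge `0`, so the total degree is at least 2, and properness excludes equality. -/
theorem semistable_expand (hσ : 2 ≤ (fiber σ 0).card) (hp : Proper v σ t)
    (h : (collapse v σ t).Semistable) : (expand v σ t).Semistable := by
  intro w
  change Fin (p + 1) at w
  show 1 ≤ (fiber (expandTgt t) w).card ∧ 1 ≤ (fiber (expandSrc v σ) w).card ∧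
    3 ≤ (fiber (expandTgt t) w).card + (fiber (expandSrc v σ) w).card
  refine Fin.cases ?_ (fun w => ?_) w
  · rw [fiber_expandTgt_zero, fiber_expandSrc_zero, Finset.card_map, Finset.card_singleton]
    omega
  · have h1 : 1 ≤ (fiber t w).card ∧ 1 ≤ (fiber (collapseSrc v σ) w).card ∧
      3 ≤ (fiber t w).card + (fiber (collapseSrc v σ) w).card := h w
    rw [fiber_expandTgt_succ, Finset.card_map]
    by_cases hw : w = v
    · subst hw
      rw [card_fiber_expandSrc_self]
      have h2 : ¬ (fiber σ w.succ = ∅ ∧ (fiber t w).card = 1) := by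
        rw [← fiber_collapseSrc_eq_iff]
        exact hp
      rw [← Finset.card_eq_zero] at h2
      omega
    · rw [fiber_collapseSrc, if_neg hw] at h1
      rw [fiber_expandSrc_succ, if_neg hw, Finset.card_map]
      exact h1

/-- Every contraction of a non-loop whose head has no other inward edge is one of the contractions
from `expand v σ t` to `collapse v σ t`. -/
theorem exists_iso_expand {G G' : FinDigraph} {e : Fin G.nE} (hne : G.src e ≠ G.tgt e)
    (hin : G.inDeg (G.tgt e) = 1) (hG : G.IsContraction e G') :
    ∃ (p q : ℕ) (v : Fin p) (σ : Fin q → Fin (p + 1)) (t : Fin q → Fin p),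
      Nonempty (Iso G (expand v σ t)) ∧ Nonempty (Iso G' (collapse v σ t)) ∧
      (fiber σ 0).card = G.outDeg (G.tgt e) := by
  obtain ⟨nV, nE, s, τ⟩ := G
  dsimp only at e hne
  obtain ⟨p, rfl⟩ : ∃ p, nV = p + 1 := ⟨nV - 1, by have := (s e).pos; omega⟩
  obtain ⟨q, rfl⟩ : ∃ q, nE = q + 1 := ⟨nE - 1, by have := e.pos; omega⟩
  -- These two swaps give `e` and its head the label `0`; no other edge ends at that vertex, so the
  -- remaining heads are successors.
  let π := Equiv.swap (τ e) 0
  let ρ := Equiv.swap e 0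
  have hπ : π (τ e) = 0 := Equiv.swap_apply_left _ _
  have hρ : ρ 0 = e := Equiv.swap_apply_right _ _
  have hv : π (s e) ≠ 0 := by
    rw [← hπ]
    exact fun h => hne (π.injective h)
  have hin' : ∀ d, τ d = τ e → d = e := by
    intro d hd
    obtain ⟨d0, hd0⟩ := Finset.card_eq_one.mp hin
    have h1 := Finset.mem_singleton.mp (hd0 ▸ mem_inEdges.mpr hd)
    have h2 : e = d0 := Finset.mem_singleton.mp (hd0 ▸ mem_inEdges.mpr rfl)
    rw [h1, h2]
  have ht : ∀ d : Fin q, π (τ (ρ d.succ)) ≠ 0 := by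
    intro d hd
    rw [← hπ] at hd
    have := hin' _ (π.injective hd)
    rw [← hρ] at this
    exact Fin.succ_ne_zero d (ρ.injective this)
  let v : Fin p := (π (s e)).pred hv
  let σ : Fin q → Fin (p + 1) := fun d => π (s (ρ d.succ))
  let t : Fin q → Fin p := fun d => (π (τ (ρ d.succ))).pred (ht d)
  have hs' : ∀ d, expandSrc v σ d = π (s (ρ d)) := by
    intro d
    refine Fin.cases ?_ (fun d => ?_) d
    · simp [expandSrc, v, hρ]
    · simp [expandSrc, σ]
  have ht' : ∀ d, expandTgt t d = π (τ (ρ d)) := by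
    intro d
    refine Fin.cases ?_ (fun d => ?_) d
    · simp [expandTgt, hρ, hπ]
    · simp [expandTgt, t]
  let F : Iso ⟨p + 1, q + 1, s, τ⟩ (expand v σ t) :=
    ⟨π, ρ.symm, fun d => (hs' _).trans (by simp; rfl), fun d => (ht' _).trans (by simp; rfl)⟩
  have hF : F.onE e = (0 : Fin (q + 1)) := by
    show ρ.symm e = 0
    rw [← hρ, Equiv.symm_apply_apply]
  refine ⟨p, q, v, σ, t, ⟨F⟩, exists_iso_of_contraction F hG ?_, ?_⟩
  · rw [hF]
    exact isContraction_expand v σ t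
  · have h1 := F.outDeg_eq (τ e)
    have h2 : F.onV (τ e) = (0 : Fin (p + 1)) := hπ
    rw [h2] at h1
    rw [← h1]
    have h3 := congrArg Finset.card (fiber_expandSrc_zero v σ)
    rw [Finset.card_map] at h3
    exact h3.symm

end

theorem ContractibleEdge.op {G : FinDigraph} {e : Fin G.nE} (h : G.ContractibleEdge e) :
    G.op.ContractibleEdge e :=
  ⟨h.1.symm, h.2.symm⟩

end FinDigraph

open FinDigraph

/-- A function on digraphs of weight `K` that is supported on semistable digraphs in which no
vertex has a loop as its only inward edge. -/
structure IsDigraphFunction (K : ℕ) (Y : FinDigraph → ℂ) : Prop where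
  iso : ∀ G H, Iso G H → Y G = Y H
  semistable : ∀ G, Y G ≠ 0 → G.Semistable
  nE_eq : ∀ G, Y G ≠ 0 → G.nE = K + G.nV
  loop : ∀ (G : FinDigraph) (e : Fin G.nE), G.src e = G.tgt e → G.inDeg (G.tgt e) = 1 → Y G = 0

/-- The loop condition holds because a loop that is the only inward edge of its vertex is unstable,
and no forest contains a loop. -/
theorem isDigraphFunction_extendByZero {K : ℕ} (c : StabClass (K : ℤ) → ℂ) :
    IsDigraphFunction K (extendByZero c) where
  iso G H f := extendByZero_of_iso c f
  semistable G h := (extendByZero_mem h).1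
  nE_eq G h := StabGraph.nE_eq ⟨G, extendByZero_mem h⟩
  loop G e he hin := by
    by_contra h
    obtain ⟨h1, -, h2⟩ := extendByZero_mem h
    exact ((stabilizable_iff h1).mp h2).src_ne_tgt (Or.inr hin) he

theorem isDigraphFunction_extendByZero_op {K : ℕ} (c : StabClass (K : ℤ) → ℂ) :
    IsDigraphFunction K (fun G => extendByZero c G.op) where
  iso G H f := extendByZero_of_iso c f.op
  semistable G h := (extendByZero_mem h).1.op
  nE_eq G h := StabGraph.nE_eq ⟨G.op, extendByZero_mem h⟩
  loop G e he hin := by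
    by_contra h
    obtain ⟨h1, -, h2⟩ := extendByZero_mem h
    exact ((stabilizable_iff h1).mp h2).src_ne_tgt (e := e) (Or.inl hin) he.symm

/-- The change of a function on digraphs under the contraction from `expand v σ t` to
`collapse v σ t`. -/
def contractionDefect (Y : FinDigraph → ℂ) {p q : ℕ} (v : Fin p) (σ : Fin q → Fin (p + 1))
    (t : Fin q → Fin p) : ℂ :=
  open Classical in (if Proper v σ t then Y (collapse v σ t) else 0) - Y (expand v σ t)

namespace IsDigraphFunction

variable {K : ℕ} {Y : FinDigraph → ℂ}

/-- One of the two values is non-zero, and a proper expansion of a semistable digraph is semistable.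
-/
theorem semistable_of_defect (hY : IsDigraphFunction K Y) {p q : ℕ} {v : Fin p}
    {σ : Fin q → Fin (p + 1)} {t : Fin q → Fin p}
    (hσ : 2 ≤ (fiber σ 0).card) (h : contractionDefect Y v σ t ≠ 0) :
    (expand v σ t).Semistable := by
  by_contra h'
  apply h
  unfold contractionDefect
  have h1 : Y (expand v σ t) = 0 := by
    by_contra h2
    exact h' (hY.semistable _ h2)
  rw [h1, sub_zero]
  split_ifs with hp
  swap
  · rfl
  by_contra h2
  exact h' (semistable_expand hσ hp (hY.semistable _ h2))

open Classical in
theorem defect_eq_zero (hY : IsDigraphFunction K Y)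
    (h : ∀ G G' e, G.Semistable → G.ContractibleEdge e → G.IsContraction e G' → Y G = Y G') {p q : ℕ} {v : Fin p} {σ : Fin q → Fin (p + 1)}
    {t : Fin q → Fin p} (hσ : 2 ≤ (fiber σ 0).card) : contractionDefect Y v σ t = 0 := by
  by_contra h'
  have hs := hY.semistable_of_defect hσ h'
  apply h'
  unfold contractionDefect
  rw [if_pos hs.proper, h _ _ _ hs (contractibleEdge_expand v σ t) (isContraction_expand v σ t),
    sub_self]

-- Up to isomorphism, a contraction onto a head of in-degree one is an expansion read backwards. If
-- the two values differ, one of them is non-zero, which fixes the weight to be `K`.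
open Classical in
theorem eq_of_defect_eq_zero (hY : IsDigraphFunction K Y)
    (h : ∀ (p : ℕ) (v : Fin p) (σ : Fin (K + p) → Fin (p + 1)) (t : Fin (K + p) → Fin p), 2 ≤ (fiber σ 0).card → (expand v σ t).Semistable →
    contractionDefect Y v σ t = 0) {G G' : FinDigraph} {e : Fin G.nE} (hs : G.Semistable)
    (hne : G.src e ≠ G.tgt e) (hin : G.inDeg (G.tgt e) = 1) (hG : G.IsContraction e G') :
    Y G = Y G' := by
  by_contra hYG
  obtain ⟨p, q, v, σ, t, ⟨f⟩, ⟨f'⟩, hcard⟩ := exists_iso_expand hne hin hG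
  have hq : q = K + p := by
    have h1 := hG.nE_eq
    have h2 := hG.nV_eq hne
    have h3 : G'.nV = p := f'.nV_eq
    have h4 : G'.nE = q := f'.nE_eq
    by_cases h5 : Y G = 0
    · have := hY.nE_eq G' fun h6 => hYG (h5.trans h6.symm)
      omega
    · have := hY.nE_eq G h5
      omega
  subst hq
  have h1 : 2 ≤ (fiber σ 0).card := by
    have := (hs (G.tgt e)).2.2
    omega
  have h2 := hs.of_iso f
  have h3 := h p v σ t h1 h2
  unfold contractionDefect at h3
  rw [if_pos h2.proper, ← hY.iso _ _ f, ← hY.iso _ _ f', sub_eq_zero] at h3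
  exact hYG h3.symm

end IsDigraphFunction

/-- Expansions only reach contractible edges whose head has in-degree one. Those whose tail has
out-degree one appear in the reversed digraph, hence the two choices of `Y`. -/
theorem isWeylFunction_of_defect {K : ℕ} {c : StabClass (K : ℤ) → ℂ}
    (h : ∀ Y : FinDigraph → ℂ, Y = extendByZero c ∨ (Y = fun G => extendByZero c G.op) →
      ∀ (p : ℕ) (v : Fin p) (σ : Fin (K + p) → Fin (p + 1)) (t : Fin (K + p) → Fin p),
        2 ≤ (fiber σ 0).card → (expand v σ t).Semistable → contractionDefect Y v σ t = 0) :
    IsWeylFunction c := by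
  rw [isWeylFunction_iff]
  rintro G G' e hs ⟨hne, hdeg⟩ hG
  rcases hdeg with hdeg | hdeg
  · exact (isDigraphFunction_extendByZero_op c).eq_of_defect_eq_zero (h _ (Or.inr rfl))
      (G := G.op) (G' := G'.op) (e := e) hs.op hne.symm hdeg hG.op
  · exact (isDigraphFunction_extendByZero c).eq_of_defect_eq_zero (h _ (Or.inl rfl))
      hs hne hdeg hG

theorem IsWeylFunction.defect_eq_zero {K : ℕ} {c : StabClass (K : ℤ) → ℂ} (hc : IsWeylFunction c)
    {p q : ℕ} {v : Fin p} {σ : Fin q → Fin (p + 1)} {t : Fin q → Fin p}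
    (hσ : 2 ≤ (fiber σ 0).card) :
    contractionDefect (extendByZero c) v σ t = 0 ∧
      contractionDefect (fun G => extendByZero c G.op) v σ t = 0 := by
  rw [isWeylFunction_iff] at hc
  exact ⟨(isDigraphFunction_extendByZero c).defect_eq_zero hc hσ,
    (isDigraphFunction_extendByZero_op c).defect_eq_zero
      (fun G G' e hs he hG => hc _ _ e hs.op he.op hG.op) hσ⟩

end

noncomputable section

/-! ### Polynomials in a parameter and its conjugate -/

section Polynomials

open MvPolynomial

/-- A polynomial in `ε` and `conj ε` that vanishes identically is zero. -/
theorem eq_zero_of_aeval_conj {σ : Type*} [Finite σ] (P : MvPolynomial (σ ⊕ σ) ℂ)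
    (h : ∀ ε : σ → ℂ, aeval (Sum.elim ε fun i => (starRingEnd ℂ) (ε i)) P = 0) : P = 0 := by
  -- The invertible substitution ε = x + i y, ε̄ = x - i y. For real x and y the hypothesis applies,
  -- and a polynomial that vanishes at all real points is zero.
  let θ : MvPolynomial (σ ⊕ σ) ℂ →ₐ[ℂ] MvPolynomial (σ ⊕ σ) ℂ :=
    aeval (Sum.elim (fun i => X (Sum.inl i) + C Complex.I * X (Sum.inr i))
      (fun i => X (Sum.inl i) - C Complex.I * X (Sum.inr i)))
  let θ' : MvPolynomial (σ ⊕ σ) ℂ →ₐ[ℂ] MvPolynomial (σ ⊕ σ) ℂ :=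
    aeval (Sum.elim (fun i => C (1 / 2) * (X (Sum.inl i) + X (Sum.inr i)))
      (fun i => C (- Complex.I / 2) * (X (Sum.inl i) - X (Sum.inr i))))
  have hI : (C Complex.I * C Complex.I : MvPolynomial (σ ⊕ σ) ℂ) = -1 := by
    rw [← C_mul, Complex.I_mul_I]
    simp
  have hIC : (C Complex.I * C (-Complex.I / 2) : MvPolynomial (σ ⊕ σ) ℂ) = C (1 / 2) := by
    rw [← C_mul]
    congr 1
    linear_combination (-1 / 2 : ℂ) * Complex.I_mul_I
  have h2 : (2 * C (1 / 2) : MvPolynomial (σ ⊕ σ) ℂ) = 1 := by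
    rw [show (2 : MvPolynomial (σ ⊕ σ) ℂ) = C 2 from (map_ofNat C 2).symm, ← C_mul]
    norm_num
  have hθ : θ'.comp θ = AlgHom.id ℂ _ := by
    ext1 i
    rcases i with i | i
    · simp only [θ, θ', AlgHom.comp_apply, aeval_X, Sum.elim_inl, map_add, map_mul, Sum.elim_inr,
        algHom_C, AlgHom.id_apply, algebraMap_eq]
      linear_combination (X (Sum.inl i) - X (Sum.inr i)) * hIC + X (Sum.inl i) * h2
    · simp only [θ, θ', AlgHom.comp_apply, aeval_X, Sum.elim_inl, map_mul, map_sub,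
        Sum.elim_inr, algHom_C, AlgHom.id_apply, algebraMap_eq]
      linear_combination - (X (Sum.inl i) - X (Sum.inr i)) * hIC + X (Sum.inr i) * h2
  have h0 : θ P = 0 := by
    refine funext_set (fun _ => Set.range Complex.ofReal)
      (fun _ => Set.infinite_range_of_injective Complex.ofReal_injective) fun x hx => ?_
    rw [map_zero]
    have hx' : ∀ i, (starRingEnd ℂ) (x i) = x i := by
      intro i
      obtain ⟨r, hr⟩ := hx i (Set.mem_univ i)
      rw [← hr, Complex.conj_ofReal]
    have h1 := h fun i => x (Sum.inl i) + Complex.I * x (Sum.inr i)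
    rw [← h1]
    have : (aeval x).comp θ = aeval (R := ℂ)
        (Sum.elim (fun i => x (Sum.inl i) + Complex.I * x (Sum.inr i)) fun i =>
          (starRingEnd ℂ) (x (Sum.inl i) + Complex.I * x (Sum.inr i))) := by
      ext i
      rcases i with i | i
      · simp [θ, aeval_X]
      · simp [θ, aeval_X, hx', sub_eq_add_neg]
    exact DFunLike.congr_fun this P
  have := DFunLike.congr_fun hθ P
  rw [AlgHom.comp_apply, h0, map_zero] at this
  exact this.symm

open Classical in
/-- The coefficient of the product of all variables in a product of linear forms. -/
theorem coeff_prod_linear {p r : ℕ} (f : Fin p → Fin r → ℂ) :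
    coeff (∑ u : Fin r, Finsupp.single u 1) (∏ w : Fin p, ∑ u : Fin r, X u * C (f w u)) =
      ∑ m : Fin p → Fin r, if Function.Bijective m then ∏ w, f w (m w) else 0 := by
  rw [Finset.prod_univ_sum, Fintype.piFinset_univ, coeff_sum]
  refine Finset.sum_congr rfl fun m _ => ?_
  have h1 : ∏ w, (X (m w) * C (f w (m w)) : MvPolynomial (Fin r) ℂ) =
      monomial (∑ w, Finsupp.single (m w) 1) (∏ w, f w (m w)) := by
    rw [Finset.prod_mul_distrib, ← map_prod, mul_comm, monomial_sum_index]
    rfl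
  rw [h1, coeff_monomial]
  congr 1
  rw [eq_iff_iff, Finsupp.ext_iff]
  -- The exponent of `X u` is the number of factors that choose `u`, so the monomial is the required
  -- one exactly when `m` is bijective.
  have h2 : ∀ u, (∑ w, Finsupp.single (m w) 1 : Fin r →₀ ℕ) u =
      (Finset.univ.filter fun w => m w = u).card := by
    intro u
    simp [Finsupp.finsetSum_apply, Finsupp.single_apply, Finset.sum_boole]
  have h3 : ∀ u, (∑ u : Fin r, Finsupp.single u 1 : Fin r →₀ ℕ) u = 1 := by
    intro u
    simp [Finsupp.finsetSum_apply, Finsupp.single_apply]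
  simp only [h2, h3, Finset.card_eq_one, Function.bijective_iff_existsUnique]
  refine forall_congr' fun u => ?_
  constructor
  · rintro ⟨w, hw⟩
    refine ⟨w, ?_, fun y hy => ?_⟩
    · simpa using (Finset.ext_iff.mp hw w)
    · simpa [hy] using (Finset.ext_iff.mp hw y)
  · rintro ⟨w, hw, hw'⟩
    refine ⟨w, ?_⟩
    ext y
    simp only [Finset.mem_filter, Finset.mem_univ, true_and, Finset.mem_singleton]
    exact ⟨hw' y, fun h => h ▸ hw⟩

end Polynomials


/-! ### Test jets and the extraction of a single defect -/

namespace FinDigraph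

variable {n : ℕ}

/-- Jets at the origin of a potential that is a combination of monomials with the indices `A u`,
`B u` and their conjugates. -/
def testJet {R : Type*} [CommRing R] {r : ℕ} (A B : Fin r → Multiset (Fin n)) (x y : Fin r → R)
    (P Q : Multiset (Fin n)) : R :=
  open Classical in
  ∑ u, (x u * (if P = A u ∧ Q = B u then 1 else 0) + y u * (if P = B u ∧ Q = A u then 1 else 0))

/-- Jets of a monomial vector field. -/
def testField (i : Fin n) (S : Multiset (Fin n)) (c : Fin n) (P : Multiset (Fin n)) : ℂ :=
  open Classical in if c = i ∧ P = S then 1 else 0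

section

variable {p q : ℕ} (v : Fin p) (σ : Fin q → Fin (p + 1)) (t : Fin q → Fin p)

-- The identity as inverse metric makes the two labels of every edge equal, and a monomial field
-- fixes the label of the edge `0` and the labels around the new vertex.
open Classical in
theorem expandTerm_one (J : Multiset (Fin n) → Multiset (Fin n) → ℂ) (i : Fin n)
    (S : Multiset (Fin n)) :
    expandTerm v σ t J 1 (testField i S) = ∑ a : Fin q → Fin n,
      if (fiber (expandSrc v σ) 0).val.map (Fin.cons i a : Fin (q + 1) → Fin n) = S then
        ∏ w : Fin p, J ((fiber (expandSrc v σ) w.succ).val.map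
          (Fin.cons i a : Fin (q + 1) → Fin n))
          ((fiber (expandTgt t) w.succ).val.map (Fin.cons i a : Fin (q + 1) → Fin n)) else 0 := by
  unfold expandTerm testField
  have h1 : ∀ a b : Fin q → Fin n, ∏ e, (1 : Matrix (Fin n) (Fin n) ℂ) (b e) (a e) =
      if b = a then 1 else 0 := by
    intro a b
    simp only [Matrix.one_apply, Finset.prod_ite_zero, Finset.mem_univ, true_implies,
      Finset.prod_const_one, funext_iff]
  simp only [h1, ite_mul, one_mul, zero_mul, Finset.sum_ite_eq', Finset.mem_univ, if_true]
  rw [Finset.sum_eq_single i]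
  · simp
  · intro c _ hc
    simp [hc]
  · simp

variable {p' q' : ℕ} {v : Fin p} {σ : Fin q → Fin (p + 1)} {t : Fin q → Fin p}
  {v' : Fin p'} {σ' : Fin q' → Fin (p' + 1)} {t' : Fin q' → Fin p'}

/-- A labelling of the edges of `expand v σ t` that matches vertex by vertex the injective
labelling `ι` of `expand v' σ' t'` comes from an isomorphism. -/
theorem exists_iso_of_labelling {ι : Fin (q' + 1) → Fin n} (hι : Function.Injective ι)
    {a : Fin (q + 1) → Fin n} (ha0 : a 0 = ι 0) (hq : q = q') {m : Fin p → Fin p'}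
    (hm : Function.Bijective m)
    (h0 : (fiber (expandSrc v σ) 0).val.map a = (fiber (expandSrc v' σ') 0).val.map ι)
    (hA : ∀ w, (fiber (expandSrc v σ) w.succ).val.map a =
      (fiber (expandSrc v' σ') (m w).succ).val.map ι)
    (hB : ∀ w, (fiber (expandTgt t) w.succ).val.map a =
      (fiber (expandTgt t') (m w).succ).val.map ι) :
    ∃ F : Iso (expand v σ t) (expand v' σ' t'), F.onE (0 : Fin (q + 1)) = (0 : Fin (q' + 1)) := by
  let M : Fin (p + 1) → Fin (p' + 1) := Fin.cons 0 fun w => (m w).succ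
  have hM : Function.Bijective M := by
    constructor
    · intro x y
      refine Fin.cases ?_ (fun x => ?_) x <;> refine Fin.cases ?_ (fun y => ?_) y <;>
        simp [M, hm.1.eq_iff, (Fin.succ_ne_zero _).symm]
    · intro z
      refine Fin.cases ⟨0, rfl⟩ (fun z => ?_) z
      obtain ⟨x, rfl⟩ := hm.2 z
      exact ⟨x.succ, by simp [M]⟩
  have hS : ∀ x, (fiber (expandSrc v σ) x).val.map a =
      (fiber (expandSrc v' σ') (M x)).val.map ι := by
    intro x
    refine Fin.cases ?_ (fun w => ?_) x
    · simpa [M] using h0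
    · simpa [M] using hA w
  have hT : ∀ x, (fiber (expandTgt t) x).val.map a =
      (fiber (expandTgt t') (M x)).val.map ι := by
    intro x
    refine Fin.cases ?_ (fun w => ?_) x
    · simp [M, fiber_expandTgt_zero, ha0]
    · simpa [M] using hB w
  -- The corresponding edge is found among those leaving the corresponding tail. Looking among those
  -- entering the corresponding head gives the same edge, since `ι` is injective.
  have h1 : ∀ e, ∃ d, expandSrc v' σ' d = M (expandSrc v σ e) ∧ ι d = a e := by
    intro e
    have : a e ∈ (fiber (expandSrc v σ) (expandSrc v σ e)).val.map a :=
      Multiset.mem_map_of_mem a (mem_fiber.mpr rfl)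
    rw [hS, Multiset.mem_map] at this
    obtain ⟨d, hd, hd'⟩ := this
    exact ⟨d, mem_fiber.mp hd, hd'⟩
  choose ψ hψ1 hψ2 using h1
  have hψ3 : ∀ e, expandTgt t' (ψ e) = M (expandTgt t e) := by
    intro e
    have : a e ∈ (fiber (expandTgt t) (expandTgt t e)).val.map a :=
      Multiset.mem_map_of_mem a (mem_fiber.mpr rfl)
    rw [hT, Multiset.mem_map] at this
    obtain ⟨d, hd, hd'⟩ := this
    rw [← hψ2] at hd'
    rw [← hι hd']
    exact mem_fiber.mp hd
  have hψinj : Function.Injective ψ := by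
    intro e e' he
    have h2 : expandSrc v σ e = expandSrc v σ e' := hM.1 (by rw [← hψ1, ← hψ1, he])
    have h3 : a e = a e' := by rw [← hψ2, ← hψ2, he]
    have h4 : ((fiber (expandSrc v σ) (expandSrc v σ e)).val.map a).Nodup := by
      rw [hS]
      exact (Finset.nodup _).map hι
    exact Multiset.inj_on_of_nodup_map h4 e (mem_fiber.mpr rfl) e' (mem_fiber.mpr h2.symm) h3
  have hψ : Function.Bijective ψ :=
    (Fintype.bijective_iff_injective_and_card _).mpr ⟨hψinj, by simp [hq]⟩
  refine ⟨⟨Equiv.ofBijective M hM, Equiv.ofBijective ψ hψ, hψ1, hψ3⟩, ?_⟩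
  apply hι
  show ι (ψ 0) = ι 0
  rw [hψ2, ha0]

end

end FinDigraph

open FinDigraph

theorem IsDigraphFunction.contractionDefect_eq {K : ℕ} {Y : FinDigraph → ℂ}
    (hY : IsDigraphFunction K Y) {p q p' q' : ℕ} {v : Fin p} {σ : Fin q → Fin (p + 1)}
    {t : Fin q → Fin p} {v' : Fin p'} {σ' : Fin q' → Fin (p' + 1)} {t' : Fin q' → Fin p'}
    (hs : (expand v' σ' t').Semistable)
    (h : ∃ F : Iso (expand v σ t) (expand v' σ' t'), F.onE (0 : Fin (q + 1)) = (0 : Fin (q' + 1))) :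
    contractionDefect Y v σ t = contractionDefect Y v' σ' t' := by
  classical
  obtain ⟨F, hF⟩ := h
  obtain ⟨F'⟩ := exists_iso_of_contraction F (isContraction_expand v σ t)
    (H' := collapse v' σ' t') (by rw [hF]; exact isContraction_expand v' σ' t')
  unfold contractionDefect
  rw [if_pos hs.proper, if_pos (hs.of_iso F.symm).proper, hY.iso _ _ F, hY.iso _ _ F']


section Extraction

variable {n K r : ℕ}

open Classical in
/-- The variation of a combination of digraphs for the jets `testJet A B x y`, with values in an
arbitrary algebra. -/
def testVariation (Y : FinDigraph → ℂ) (K N : ℕ) (i : Fin n) (S₀ : Multiset (Fin n))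
    (A B : Fin r → Multiset (Fin n)) {R : Type} [CommRing R] [Algebra ℂ R] (x y : Fin r → R) : R :=
  ∑ p ∈ Finset.range N, algebraMap ℂ R (labelWeight K p) *
    ∑ v : Fin p, ∑ σ : Fin (K + p) → Fin (p + 1), ∑ t : Fin (K + p) → Fin p,
      if 2 ≤ (fiber σ 0).card then algebraMap ℂ R (contractionDefect Y v σ t) *
        ∑ a : Fin (K + p) → Fin n, if (fiber (expandSrc v σ) 0).val.map
            (Fin.cons i a : Fin (K + p + 1) → Fin n) = S₀ then
          ∏ w : Fin p, testJet A B x y ((fiber (expandSrc v σ) w.succ).val.map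
            (Fin.cons i a : Fin (K + p + 1) → Fin n))
            ((fiber (expandTgt t) w.succ).val.map
              (Fin.cons i a : Fin (K + p + 1) → Fin n)) else 0 else 0

/-- Naturality in the algebra allows the parameters and their conjugates to be replaced by
independent variables and specialised afterwards. -/
theorem map_testVariation (Y : FinDigraph → ℂ) (N : ℕ) (i : Fin n) (S₀ : Multiset (Fin n))
    (A B : Fin r → Multiset (Fin n)) {R R' : Type} [CommRing R] [Algebra ℂ R] [CommRing R']
    [Algebra ℂ R'] (φ : R →ₐ[ℂ] R') (x y : Fin r → R) :
    φ (testVariation Y K N i S₀ A B x y) = testVariation Y K N i S₀ A B (φ ∘ x) (φ ∘ y) := by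
  simp only [testVariation, testJet, map_sum, map_mul, map_prod, map_add, apply_ite φ, map_zero,
    map_one, AlgHom.commutes, Function.comp_apply]

/-- The labelling `a` of the edges other than `0` and the map `m` of vertices match the
monomials `A`, `B`. -/
def IsMatching (i : Fin n) (S₀ : Multiset (Fin n)) (A B : Fin r → Multiset (Fin n)) {p q : ℕ}
    (v : Fin p) (σ : Fin q → Fin (p + 1)) (t : Fin q → Fin p) (a : Fin q → Fin n)
    (m : Fin p → Fin r) : Prop :=
  2 ≤ (fiber σ 0).card ∧ ((fiber (expandSrc v σ) 0).val.map
      (Fin.cons i a : Fin (q + 1) → Fin n) = S₀ ∧ (Function.Bijective m ∧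
    ∀ w, (fiber (expandSrc v σ) w.succ).val.map
            (Fin.cons i a : Fin (q + 1) → Fin n) = A (m w) ∧
      (fiber (expandTgt t) w.succ).val.map
              (Fin.cons i a : Fin (q + 1) → Fin n) = B (m w)))

-- With the conjugate monomials switched off, every vertex other than the new one contributes a
-- linear form in the variables, so `coeff_prod_linear` leaves the bijections between these vertices
-- and the monomials.
open Classical in
theorem coeff_testVariation (Y : FinDigraph → ℂ) (N : ℕ) (i : Fin n) (S₀ : Multiset (Fin n))
    (A B : Fin r → Multiset (Fin n)) :
    MvPolynomial.coeff (∑ u : Fin r, Finsupp.single u 1) (testVariation Y K N i S₀ A B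
      (fun u : Fin r => (MvPolynomial.X u : MvPolynomial (Fin r) ℂ)) 0) =
    ∑ p ∈ Finset.range N, ∑ v : Fin p, ∑ σ : Fin (K + p) → Fin (p + 1),
      ∑ t : Fin (K + p) → Fin p, ∑ a : Fin (K + p) → Fin n, ∑ m : Fin p → Fin r,
        labelWeight K p * (contractionDefect Y v σ t *
          if IsMatching i S₀ A B v σ t a m then 1 else 0) := by
  simp only [testVariation, MvPolynomial.coeff_sum, MvPolynomial.algebraMap_eq,
    MvPolynomial.coeff_C_mul, Finset.mul_sum]
  refine Finset.sum_congr rfl fun p _ => ?_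
  refine Finset.sum_congr rfl fun v _ => ?_
  refine Finset.sum_congr rfl fun σ _ => ?_
  refine Finset.sum_congr rfl fun t _ => ?_
  by_cases g1 : 2 ≤ (fiber σ 0).card
  · rw [if_pos g1]
    simp only [MvPolynomial.coeff_sum, MvPolynomial.coeff_C_mul, Finset.mul_sum]
    refine Finset.sum_congr rfl fun a _ => ?_
    rw [← Finset.mul_sum, ← Finset.mul_sum]
    congr 2
    by_cases g2 : (fiber (expandSrc v σ) 0).val.map
      (Fin.cons i a : Fin (K + p + 1) → Fin n) = S₀
    · rw [if_pos g2]
      have h2 : ∀ P Q, testJet A B (fun u : Fin r => (MvPolynomial.X u : MvPolynomial (Fin r) ℂ))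
          0 P Q = ∑ u, MvPolynomial.X u *
            MvPolynomial.C (if P = A u ∧ Q = B u then (1 : ℂ) else 0) := by
        intro P Q
        unfold testJet
        refine Finset.sum_congr rfl fun u _ => ?_
        simp [apply_ite MvPolynomial.C]
      simp only [h2]
      rw [coeff_prod_linear fun w u => if (fiber (expandSrc v σ) w.succ).val.map
            (Fin.cons i a : Fin (K + p + 1) → Fin n) = A u ∧
            (fiber (expandTgt t) w.succ).val.map
              (Fin.cons i a : Fin (K + p + 1) → Fin n) = B u then (1 : ℂ) else 0]
      refine Finset.sum_congr rfl fun m _ => ?_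
      simp only [Finset.prod_ite_zero, Finset.mem_univ, true_implies, Finset.prod_const_one]
      by_cases g3 : Function.Bijective m
      · simp only [IsMatching, g1, g2, g3, true_and, if_true]
      · simp only [IsMatching, g3, false_and, and_false, if_false]
    · rw [if_neg g2, MvPolynomial.coeff_zero]
      symm
      refine Finset.sum_eq_zero fun m _ => ?_
      exact if_neg fun g => g2 g.2.1
  · rw [if_neg g1, MvPolynomial.coeff_zero, mul_zero]
    symm
    refine Finset.sum_eq_zero fun a _ => Finset.sum_eq_zero fun m _ => ?_
    rw [if_neg fun g => g1 g.1, mul_zero, mul_zero]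

variable {Y : FinDigraph → ℂ}

/-- Agreement with `testJet` for at least three indices, some of each kind, is enough: a non-zero
defect makes the expanded digraph semistable, and its new vertex carries the field instead of a jet.
-/
theorem testVariation_eq_zero (hY : IsDigraphFunction K Y) {N : ℕ} {i : Fin n}
    {S₀ : Multiset (Fin n)} {A B : Fin r → Multiset (Fin n)}
    (J : (Fin r → ℂ) → Multiset (Fin n) → Multiset (Fin n) → ℂ)
    (hJ : ∀ ε P Q, P ≠ 0 → Q ≠ 0 → 3 ≤ P.card + Q.card →
      J ε P Q = testJet A B ε (fun u => (starRingEnd ℂ) (ε u)) P Q)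
    (h : ∀ ε, ∑ p ∈ Finset.range N, labelWeight K p *
        ∑ v : Fin p, ∑ σ : Fin (K + p) → Fin (p + 1), ∑ t : Fin (K + p) → Fin p,
          (if 2 ≤ (fiber σ 0).card then
            contractionDefect Y v σ t * expandTerm v σ t (J ε) 1 (testField i S₀) else 0)
        = 0) (ε : Fin r → ℂ) :
    testVariation Y K N i S₀ A B ε (fun u => (starRingEnd ℂ) (ε u)) = 0 := by
  refine Eq.trans ?_ (h ε)
  unfold testVariation
  refine Finset.sum_congr rfl fun p _ => ?_
  rw [Algebra.algebraMap_self, RingHom.id_apply]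
  refine congrArg (labelWeight K p * ·) ?_
  refine Finset.sum_congr rfl fun v _ => ?_
  refine Finset.sum_congr rfl fun σ _ => ?_
  refine Finset.sum_congr rfl fun t _ => ?_
  by_cases hσ : 2 ≤ (fiber σ 0).card
  · rw [if_pos hσ, if_pos hσ, RingHom.id_apply]
    by_cases hD : contractionDefect Y v σ t = 0
    · rw [hD, zero_mul, zero_mul]
    · have hs := hY.semistable_of_defect hσ hD
      rw [expandTerm_one]
      refine congrArg (contractionDefect Y v σ t * ·) ?_
      refine Finset.sum_congr rfl fun a _ => ?_
      refine if_congr Iff.rfl ?_ rfl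
      refine Finset.prod_congr rfl fun w _ => ?_
      have h1 : 1 ≤ (fiber (expandTgt t) w.succ).card ∧
          1 ≤ (fiber (expandSrc v σ) w.succ).card ∧
          3 ≤ (fiber (expandTgt t) w.succ).card + (fiber (expandSrc v σ) w.succ).card :=
        hs (w.succ : Fin (p + 1))
      rw [hJ]
      · rw [← Multiset.card_pos, Multiset.card_map]
        exact h1.2.1
      · rw [← Multiset.card_pos, Multiset.card_map]
        exact h1.1
      · rw [Multiset.card_map, Multiset.card_map, add_comm]
        exact h1.2.2
  · rw [if_neg hσ, if_neg hσ]

/-- By `eq_zero_of_aeval_conj` the identity holds for independent variables in place of `ε` and its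
conjugate; then the second family is set to zero. -/
theorem coeff_testVariation_eq_zero {N : ℕ} {i : Fin n} {S₀ : Multiset (Fin n)}
    {A B : Fin r → Multiset (Fin n)}
    (h : ∀ ε : Fin r → ℂ,
      testVariation Y K N i S₀ A B ε (fun u => (starRingEnd ℂ) (ε u)) = 0) :
    testVariation Y K N i S₀ A B
      (fun u : Fin r => (MvPolynomial.X u : MvPolynomial (Fin r) ℂ)) 0 = 0 := by
  let XL : Fin r → MvPolynomial (Fin r ⊕ Fin r) ℂ := fun u => MvPolynomial.X (Sum.inl u)
  let XR : Fin r → MvPolynomial (Fin r ⊕ Fin r) ℂ := fun u => MvPolynomial.X (Sum.inr u)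
  have hzero : testVariation Y K N i S₀ A B XL XR = 0 := by
    refine eq_zero_of_aeval_conj _ fun ε => ?_
    rw [map_testVariation]
    refine Eq.trans ?_ (h ε)
    congr 1
    · funext u
      simp [XL]
    · funext u
      simp [XR]
  have := congrArg (MvPolynomial.aeval (R := ℂ)
    (Sum.elim (fun u : Fin r => (MvPolynomial.X u : MvPolynomial (Fin r) ℂ)) 0)) hzero
  rw [map_zero, map_testVariation] at this
  refine Eq.trans ?_ this
  congr 1
  · funext u
    simp [XL]
  · funext u
    simp [XR]

/-- If the variation of a combination of digraphs vanishes for all potentials that are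
combinations of the monomials of the vertices of `expand v₀ σ₀ t₀` and their conjugates, the
coefficients agree for `expand v₀ σ₀ t₀` and its contraction. -/
theorem IsDigraphFunction.defect_eq_zero_of_test {N : ℕ}
    (hY : IsDigraphFunction K Y) {v₀ : Fin r} {σ₀ : Fin (K + r) → Fin (r + 1)}
    {t₀ : Fin (K + r) → Fin r} (hr : r < N) (hσ₀ : 2 ≤ (fiber σ₀ 0).card)
    (hs₀ : (expand v₀ σ₀ t₀).Semistable) {ι : Fin (K + r + 1) → Fin n}
    (hι : Function.Injective ι) {A B : Fin r → Multiset (Fin n)}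
    (hA : ∀ u, A u = (fiber (expandSrc v₀ σ₀) u.succ).val.map ι)
    (hB : ∀ u, B u = (fiber (expandTgt t₀) u.succ).val.map ι)
    {S₀ : Multiset (Fin n)} (hS₀ : S₀ = (fiber (expandSrc v₀ σ₀) 0).val.map ι)
    (J : (Fin r → ℂ) → Multiset (Fin n) → Multiset (Fin n) → ℂ)
    (hJ : ∀ ε P Q, P ≠ 0 → Q ≠ 0 → 3 ≤ P.card + Q.card →
      J ε P Q = testJet A B ε (fun u => (starRingEnd ℂ) (ε u)) P Q)
    (h : ∀ ε, ∑ p ∈ Finset.range N, labelWeight K p *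
        ∑ v : Fin p, ∑ σ : Fin (K + p) → Fin (p + 1), ∑ t : Fin (K + p) → Fin p,
          (if 2 ≤ (fiber σ 0).card then
            contractionDefect Y v σ t * expandTerm v σ t (J ε) 1 (testField (ι 0) S₀) else 0)
        = 0) :
    contractionDefect Y v₀ σ₀ t₀ = 0 := by
  classical
  -- A matching yields an isomorphism with the given expanded digraph that respects the edge `0`, so
  -- all matchings enter with the same coefficient and are merely counted.
  have hgood : ∀ (p : ℕ) (v : Fin p) (σ : Fin (K + p) → Fin (p + 1)) (t : Fin (K + p) → Fin p) a m,
      IsMatching (ι 0) S₀ A B v σ t a m → labelWeight K p = labelWeight K r ∧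
      contractionDefect Y v σ t = contractionDefect Y v₀ σ₀ t₀ := by
    rintro p v σ t a m ⟨-, h2, h3, h4⟩
    have hp : p = r := by simpa using Fintype.card_of_bijective h3
    refine ⟨by rw [hp], hY.contractionDefect_eq hs₀ ?_⟩
    refine exists_iso_of_labelling hι rfl (by rw [hp]) h3 (h2.trans hS₀) ?_ ?_
    · exact fun w => (h4 w).1.trans (hA _)
    · exact fun w => (h4 w).2.trans (hB _)
  have hcoeff := coeff_testVariation (K := K) Y N (ι 0) S₀ A B
  rw [coeff_testVariation_eq_zero (testVariation_eq_zero hY J hJ h),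
    MvPolynomial.coeff_zero] at hcoeff
  let count : ℕ := ∑ p ∈ Finset.range N, ∑ v : Fin p, ∑ σ : Fin (K + p) → Fin (p + 1),
      ∑ t : Fin (K + p) → Fin p, ∑ a : Fin (K + p) → Fin n, ∑ m : Fin p → Fin r,
        if IsMatching (ι 0) S₀ A B v σ t a m then 1 else 0
  have hcount : count ≠ 0 := by
    intro h0
    simp only [count, Finset.sum_eq_zero_iff, Finset.mem_range, Finset.mem_univ, true_implies] at h0
    -- The given digraph with its own labels is a matching, so the count is not zero.
    have h1 := h0 r hr v₀ σ₀ t₀ (fun d => ι d.succ) id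
    have h2 : (Fin.cons (ι 0) fun d => ι d.succ : Fin (K + r + 1) → Fin n) = ι := by
      funext e
      refine Fin.cases ?_ (fun d => ?_) e <;> simp
    rw [if_pos] at h1
    · exact one_ne_zero h1
    · refine ⟨hσ₀, ?_, Function.bijective_id, fun w => ⟨?_, ?_⟩⟩
      · rw [h2, hS₀]
      · rw [h2, id, hA]
      · rw [h2, id, hB]
  have hfinal : labelWeight K r * contractionDefect Y v₀ σ₀ t₀ * (count : ℂ) = 0 := by
    refine Eq.trans ?_ hcoeff.symm
    simp only [count, Nat.cast_sum, Finset.mul_sum]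
    refine Finset.sum_congr rfl fun p _ => ?_
    refine Finset.sum_congr rfl fun v _ => ?_
    refine Finset.sum_congr rfl fun σ _ => ?_
    refine Finset.sum_congr rfl fun t _ => ?_
    refine Finset.sum_congr rfl fun a _ => ?_
    refine Finset.sum_congr rfl fun m _ => ?_
    by_cases g : IsMatching (ι 0) S₀ A B v σ t a m
    · obtain ⟨h1, h2⟩ := hgood p v σ t a m g
      rw [h2, h1, if_pos g, if_pos g]
      simp
    · rw [if_neg g, if_neg g]
      simp
  have hw : labelWeight K r ≠ 0 := by
    unfold labelWeight
    refine div_ne_zero (pow_ne_zero _ (neg_ne_zero.mpr one_ne_zero)) (mul_ne_zero ?_ ?_)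
    · exact_mod_cast r.factorial_ne_zero
    · exact_mod_cast (K + r).factorial_ne_zero
  have hc : (count : ℂ) ≠ 0 := by exact_mod_cast hcount
  exact (mul_eq_zero.mp ((mul_eq_zero.mp hfinal).resolve_right hc)).resolve_left hw

end Extraction

end

noncomputable section

/-! ### Smoothness of holomorphic functions of several variables -/

section Holomorphic

open MeasureTheory Metric Set

variable {n : ℕ} {F : Type*} [NormedAddCommGroup F] [NormedSpace ℂ F] [FiniteDimensional ℂ F]

/-- The directional derivatives of a holomorphic function are holomorphic. -/
theorem DifferentiableOn.fderiv_apply_of_isOpen {f : (Fin n → ℂ) → F} {U : Set (Fin n → ℂ)}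
    (hf : DifferentiableOn ℂ f U) (hU : IsOpen U) (v : Fin n → ℂ) :
    DifferentiableOn ℂ (fun z => fderiv ℂ f z v) U := by
  intro z₀ hz₀
  have : CompleteSpace F := FiniteDimensional.complete ℂ F
  have : SecondCountableTopology F := by
    have : ProperSpace F := FiniteDimensional.proper ℂ F
    infer_instance
  obtain ⟨R, hR, hRU⟩ := Metric.isOpen_iff.mp hU z₀ hz₀
  have hcont : ContinuousAt f z₀ := (hf z₀ hz₀).continuousWithinAt.continuousAt (hU.mem_nhds hz₀)
  obtain ⟨R', hR', hR1⟩ := Metric.continuousAt_iff.mp hcont 1 one_pos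
  -- The point moves in radius `r`, the circles of Cauchy's formula stay within `2 * r`, and the
  -- derivative is bounded there by Cauchy's estimate on balls of radius `r` inside `3 * r`, where
  -- two values of `f` differ by at most 2.
  obtain ⟨r, hr, hrR, hrR'⟩ : ∃ r, 0 < r ∧ 3 * r ≤ R ∧ 3 * r ≤ R' :=
    ⟨min R R' / 3, by positivity, by linarith [min_le_left R R'], by linarith [min_le_right R R']⟩
  obtain ⟨ρ, hρ, hρv⟩ : ∃ ρ : ℝ, 0 < ρ ∧ ρ * ‖v‖ < r := by
    refine ⟨r / (‖v‖ + 1), by positivity, ?_⟩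
    rw [div_mul_eq_mul_div, div_lt_iff₀ (by positivity)]
    nlinarith [norm_nonneg v]
  have hin : ∀ w ∈ ball z₀ (2 * r), ball w r ⊆ ball z₀ (3 * r) := fun w hw =>
    ball_subset_ball' (by rw [mem_ball] at hw; linarith)
  have hU3 : ball z₀ (3 * r) ⊆ U := (ball_subset_ball hrR).trans hRU
  have hbd : ∀ w ∈ ball z₀ (2 * r), ‖fderiv ℂ f w‖ ≤ 2 / r := by
    intro w hw
    refine Complex.norm_fderiv_le_div_of_mapsTo_ball (hf.mono ((hin w hw).trans hU3)) ?_ hr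
    intro y hy
    have h1 := hR1 (lt_of_lt_of_le (mem_ball.mp (hin w hw hy)) hrR')
    have h2 := hR1 (lt_of_lt_of_le (mem_ball.mp (hin w hw (mem_ball_self hr))) hrR')
    rw [mem_closedBall]
    linarith [dist_triangle_right (f y) (f w) (f z₀)]
  have hmem : ∀ z ∈ ball z₀ r, ∀ ζ ∈ closedBall (0 : ℂ) ρ, z + ζ • v ∈ ball z₀ (2 * r) := by
    intro z hz ζ hζ
    rw [mem_ball, dist_eq_norm] at hz ⊢
    rw [mem_closedBall_zero_iff] at hζ
    calc ‖z + ζ • v - z₀‖ = ‖(z - z₀) + ζ • v‖ := by congr 1; abel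
      _ ≤ ‖z - z₀‖ + ‖ζ‖ * ‖v‖ := (norm_add_le _ _).trans (by rw [norm_smul])
      _ < 2 * r := by nlinarith [mul_le_mul_of_nonneg_right hζ (norm_nonneg v)]
  have hU2 : ball z₀ (2 * r) ⊆ U := (ball_subset_ball (by linarith)).trans hU3
  have hda : ∀ w ∈ ball z₀ (2 * r), HasFDerivAt f (fderiv ℂ f w) w := fun w hw =>
    ((hf w (hU2 hw)).differentiableAt (hU.mem_nhds (hU2 hw))).hasFDerivAt
  have hcirc : ∀ θ : ℝ, circleMap 0 ρ θ ∈ closedBall (0 : ℂ) ρ := fun θ =>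
    sphere_subset_closedBall (circleMap_mem_sphere 0 hρ.le θ)
  let κ : ℝ → ℂ := fun θ => _root_.deriv (circleMap 0 ρ) θ * (1 / (circleMap 0 ρ θ - 0) ^ 2)
  have hκ : Continuous κ := by
    have h1 : Continuous (circleMap 0 ρ) := continuous_circleMap 0 ρ
    refine Continuous.mul ?_ (Continuous.div continuous_const ((h1.sub continuous_const).pow 2) ?_)
    · rw [show _root_.deriv (circleMap 0 ρ) = fun θ => circleMap 0 ρ θ * Complex.I from
        funext fun θ => by simp]
      exact h1.mul continuous_const
    · intro θ
      rw [sub_zero]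
      exact pow_ne_zero _ (circleMap_ne_center hρ.ne')
  -- Cauchy's formula for the derivative along the complex line through `z` in direction `v`. On the
  -- right `z` is only a parameter of `f` under the integral, so `f` need only be differentiated
  -- once.
  have hform : ∀ z ∈ ball z₀ r, fderiv ℂ f z v = (2 * (Real.pi : ℂ) * Complex.I)⁻¹ •
      ∫ θ in (0 : ℝ)..2 * Real.pi, κ θ • f (z + circleMap 0 ρ θ • v) := by
    intro z hz
    have hline : ∀ ζ ∈ closedBall (0 : ℂ) ρ,
        HasDerivAt (fun ζ : ℂ => f (z + ζ • v)) (fderiv ℂ f (z + ζ • v) v) ζ := by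
      intro ζ hζ
      have h1 : HasDerivAt (fun ζ : ℂ => z + ζ • v) v ζ := by
        simpa using ((hasDerivAt_id ζ).smul_const v).const_add z
      exact (hda _ (hmem z hz ζ hζ)).comp_hasDerivAt ζ h1
    have h1 := DifferentiableOn.deriv_eq_smul_circleIntegral (f := fun ζ : ℂ => f (z + ζ • v))
      (c := 0) hρ fun ζ hζ => (hline ζ hζ).differentiableAt.differentiableWithinAt
    rw [(hline 0 (mem_closedBall_self hρ.le)).deriv, zero_smul, add_zero, circleIntegral] at h1
    have h2 : (2 * (Real.pi : ℂ) * Complex.I) ≠ 0 := by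
      simp [Real.pi_ne_zero]
    rw [eq_inv_smul_iff₀ h2, ← h1]
    refine intervalIntegral.integral_congr fun θ _ => ?_
    simp only [κ, mul_smul]
  have hcf : ∀ z ∈ ball z₀ r, Continuous fun θ : ℝ => κ θ • f (z + circleMap 0 ρ θ • v) := by
    intro z hz
    refine hκ.smul ?_
    rw [continuous_iff_continuousAt]
    intro θ
    refine ContinuousAt.comp (f := fun θ : ℝ => z + circleMap 0 ρ θ • v) (g := f)
      (hda _ (hmem z hz _ (hcirc θ))).continuousAt ?_
    exact (continuous_const.add ((continuous_circleMap 0 ρ).smul continuous_const)).continuousAt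
  have hint : HasFDerivAt
      (fun z => ∫ θ in (0 : ℝ)..2 * Real.pi, κ θ • f (z + circleMap 0 ρ θ • v))
      (∫ θ in (0 : ℝ)..2 * Real.pi, κ θ • fderiv ℂ f (z₀ + circleMap 0 ρ θ • v)) z₀ := by
    refine intervalIntegral.hasFDerivAt_integral_of_dominated_of_fderiv_le
      (F' := fun z θ => κ θ • fderiv ℂ f (z + circleMap 0 ρ θ • v)) (s := ball z₀ r)
      (bound := fun θ => ‖κ θ‖ * (2 / r)) (ball_mem_nhds z₀ hr) ?_ ?_ ?_ ?_ ?_ ?_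
    · filter_upwards [ball_mem_nhds z₀ hr] with z hz
      exact (hcf z hz).aestronglyMeasurable
    · exact (hcf z₀ (mem_ball_self hr)).intervalIntegrable _ _
    · refine (hκ.aestronglyMeasurable).smul ?_
      refine Measurable.aestronglyMeasurable ?_
      exact (measurable_fderiv ℂ f).comp (Continuous.measurable
        (continuous_const.add ((continuous_circleMap 0 ρ).smul continuous_const)))
    · refine Filter.Eventually.of_forall fun θ _ z hz => ?_
      rw [norm_smul]
      exact mul_le_mul_of_nonneg_left (hbd _ (hmem z hz _ (hcirc θ))) (norm_nonneg _)
    · exact (hκ.norm.mul continuous_const).intervalIntegrable _ _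
    · refine Filter.Eventually.of_forall fun θ _ z hz => ?_
      refine HasFDerivAt.const_smul ?_ (κ θ)
      exact (hda _ (hmem z hz _ (hcirc θ))).comp z ((hasFDerivAt_id z).add_const _)
  refine DifferentiableAt.differentiableWithinAt ?_
  refine ((hint.const_smul (2 * (Real.pi : ℂ) * Complex.I)⁻¹).differentiableAt).congr_of_eventuallyEq
    ?_
  filter_upwards [ball_mem_nhds z₀ hr] with z hz
  exact hform z hz

/-- Holomorphic functions of several variables are smooth. -/
theorem DifferentiableOn.contDiffOn_of_isOpen {f : (Fin n → ℂ) → F} {U : Set (Fin n → ℂ)}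
    (hf : DifferentiableOn ℂ f U) (hU : IsOpen U) : ContDiffOn ℂ ∞ f U := by
  rw [contDiffOn_infty]
  intro m
  induction m generalizing f with
  | zero => exact contDiffOn_zero.mpr hf.continuousOn
  | succ m ih =>
    rw [Nat.cast_succ]
    refine contDiffOn_succ_of_fderiv_apply hf (fun h => absurd h (by exact_mod_cast WithTop.coe_ne_top)) fun v => ?_
    refine (ih (hf.fderiv_apply_of_isOpen hU v)).congr fun z hz => ?_
    rw [fderivWithin_of_isOpen hU hz]

end Holomorphic

end

/-! ### Differential algebra of metric jets -/

noncomputable section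

/-- Commuting derivations `∂_i` and `∂̄_i` of a commutative algebra. -/
structure WirtingerStructure (n : ℕ) (A : Type*) [CommRing A] [Algebra ℂ A] where
  hol : Fin n → Derivation ℂ A A
  anti : Fin n → Derivation ℂ A A
  hol_hol : ∀ i j x, hol i (hol j x) = hol j (hol i x)
  anti_anti : ∀ i j x, anti i (anti j x) = anti j (anti i x)
  hol_anti : ∀ i j x, hol i (anti j x) = anti j (hol i x)

namespace WirtingerStructure

variable {n : ℕ} {A : Type*} [CommRing A] [Algebra ℂ A] (W : WirtingerStructure n A)

/-- Exchange of `∂` and `∂̄`. -/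
def swap : WirtingerStructure n A where
  hol := W.anti
  anti := W.hol
  hol_hol := W.anti_anti
  anti_anti := W.hol_hol
  hol_anti i j x := (W.hol_anti j i x).symm

theorem leftCommutative : LeftCommutative fun i (x : A) => W.hol i x := ⟨W.hol_hol⟩

/-- The iterated derivative `∂_S`. -/
def holMulti (S : Multiset (Fin n)) (x : A) : A :=
  have := W.leftCommutative
  S.foldr (fun i x => W.hol i x) x

/-- The iterated derivative `∂̄_S`. -/
def antiMulti (S : Multiset (Fin n)) (x : A) : A := W.swap.holMulti S x

@[simp]
theorem holMulti_zero (x : A) : W.holMulti 0 x = x := rfl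

@[simp]
theorem holMulti_cons (i : Fin n) (S : Multiset (Fin n)) (x : A) :
    W.holMulti (i ::ₘ S) x = W.hol i (W.holMulti S x) := by
  have := W.leftCommutative
  exact Multiset.foldr_cons _ _ _ _

@[simp]
theorem antiMulti_zero (x : A) : W.antiMulti 0 x = x := rfl

@[simp]
theorem antiMulti_cons (i : Fin n) (S : Multiset (Fin n)) (x : A) :
    W.antiMulti (i ::ₘ S) x = W.anti i (W.antiMulti S x) :=
  W.swap.holMulti_cons i S x

theorem holMulti_comm (T : Derivation ℂ A A) (hT : ∀ i x, T (W.hol i x) = W.hol i (T x))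
    (S : Multiset (Fin n)) (x : A) : T (W.holMulti S x) = W.holMulti S (T x) := by
  induction S using Multiset.induction with
  | empty => rfl
  | cons i S ih => rw [holMulti_cons, holMulti_cons, hT, ih]

theorem antiMulti_comm (T : Derivation ℂ A A) (hT : ∀ i x, T (W.anti i x) = W.anti i (T x))
    (S : Multiset (Fin n)) (x : A) : T (W.antiMulti S x) = W.antiMulti S (T x) :=
  W.swap.holMulti_comm T hT S x

theorem holMulti_antiMulti (S S' : Multiset (Fin n)) (x : A) :
    W.holMulti S (W.antiMulti S' x) = W.antiMulti S' (W.holMulti S x) := by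
  induction S using Multiset.induction with
  | empty => rfl
  | cons i S ih =>
    rw [holMulti_cons, holMulti_cons, ih, W.antiMulti_comm (W.hol i) (W.hol_anti i)]

theorem holMulti_add (S : Multiset (Fin n)) (x y : A) :
    W.holMulti S (x + y) = W.holMulti S x + W.holMulti S y := by
  induction S using Multiset.induction with
  | empty => rfl
  | cons i S ih => simp only [holMulti_cons, ih, map_add]

theorem antiMulti_add (S : Multiset (Fin n)) (x y : A) :
    W.antiMulti S (x + y) = W.antiMulti S x + W.antiMulti S y := W.swap.holMulti_add S x y

theorem holMulti_sum {ι : Type*} (I : Finset ι) (S : Multiset (Fin n)) (f : ι → A) :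
    W.holMulti S (∑ i ∈ I, f i) = ∑ i ∈ I, W.holMulti S (f i) := by
  induction S using Multiset.induction with
  | empty => rfl
  | cons i S ih => simp only [holMulti_cons, ih, map_sum]

theorem antiMulti_sum {ι : Type*} (I : Finset ι) (S : Multiset (Fin n)) (f : ι → A) :
    W.antiMulti S (∑ i ∈ I, f i) = ∑ i ∈ I, W.antiMulti S (f i) := W.swap.holMulti_sum I S f

theorem antiMulti_mul_of_anti_eq_zero {x : A} (hx : ∀ i, W.anti i x = 0) (S : Multiset (Fin n))
    (y : A) : W.antiMulti S (x * y) = x * W.antiMulti S y := by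
  induction S using Multiset.induction with
  | empty => rfl
  | cons i S ih =>
    simp only [antiMulti_cons, ih, Derivation.leibniz, hx, smul_eq_mul, mul_zero, add_zero]

/-- The Leibniz rule for iterated derivatives. -/
theorem holMulti_mul {α : Type*} [DecidableEq α] (S : Finset α) (a : α → Fin n) (x y : A) :
    W.holMulti (S.val.map a) (x * y) = ∑ S' ∈ S.powerset,
      W.holMulti (S'.val.map a) x * W.holMulti ((S \ S').val.map a) y := by
  induction S using Finset.induction_on with
  | empty => simp
  | insert e S he ih =>
    rw [Finset.sum_powerset_insert he, Finset.insert_val_of_notMem he, Multiset.map_cons,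
      holMulti_cons, ih, map_sum, ← Finset.sum_add_distrib]
    refine Finset.sum_congr rfl fun S' hS' => ?_
    rw [Finset.mem_powerset] at hS'
    have h1 : insert e S \ S' = insert e (S \ S') :=
      Finset.insert_sdiff_of_notMem _ fun h => he (hS' h)
    have h2 : insert e S \ insert e S' = S \ S' := by
      ext d
      simp only [Finset.mem_sdiff, Finset.mem_insert]
      constructor
      · rintro ⟨rfl | h, h'⟩
        · exact absurd (Or.inl rfl) h'
        · exact ⟨h, fun h'' => h' (Or.inr h'')⟩
      · rintro ⟨h, h'⟩
        exact ⟨Or.inr h, fun h'' => h''.elim (fun h3 => he (h3 ▸ h)) h'⟩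
    rw [h1, h2, Finset.insert_val_of_notMem (fun h => he (hS' h)),
      Finset.insert_val_of_notMem (fun h => he (Finset.mem_sdiff.mp h).1), Multiset.map_cons,
      Multiset.map_cons, holMulti_cons, holMulti_cons, Derivation.leibniz]
    simp only [smul_eq_mul]
    ring

/-- The derivatives of a matrix of elements, as in `metricDerivList`. -/
def jetList (h : Matrix (Fin n) (Fin n) A) : List (Fin n) → List (Fin n) → A
  | a :: as, b :: bs => as.foldr (fun i x => W.hol i x) (bs.foldr (fun i x => W.anti i x) (h a b))
  | _, _ => 0

/-- The derivatives of a matrix of elements, as in `metricDeriv`. -/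
def jet (h : Matrix (Fin n) (Fin n) A) (P Q : Multiset (Fin n)) : A :=
  W.jetList h (P.sort (· ≤ ·)) (Q.sort (· ≤ ·))

/-- The closedness equations of a Kähler metric. -/
structure IsClosed (h : Matrix (Fin n) (Fin n) A) : Prop where
  hol : ∀ i a b, W.hol i (h a b) = W.hol a (h i b)
  anti : ∀ j a b, W.anti j (h a b) = W.anti b (h a j)

variable {W} in
theorem IsClosed.swap {h : Matrix (Fin n) (Fin n) A} (hh : W.IsClosed h) :
    W.swap.IsClosed h.transpose :=
  ⟨fun i a b => hh.anti i b a, fun j a b => hh.hol j b a⟩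

theorem jetList_cons_cons (h : Matrix (Fin n) (Fin n) A) (a b : Fin n) (as bs : List (Fin n)) :
    W.jetList h (a :: as) (b :: bs) =
      W.holMulti (as : Multiset (Fin n)) (W.antiMulti (bs : Multiset (Fin n)) (h a b)) := rfl

theorem jetList_swap (h : Matrix (Fin n) (Fin n) A) (P Q : List (Fin n)) :
    W.swap.jetList h.transpose Q P = W.jetList h P Q := by
  match P, Q with
  | [], [] => rfl
  | [], _ :: _ => rfl
  | _ :: _, [] => rfl
  | a :: as, b :: bs =>
    rw [jetList_cons_cons, jetList_cons_cons, holMulti_antiMulti]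
    rfl

theorem jet_swap (h : Matrix (Fin n) (Fin n) A) (P Q : Multiset (Fin n)) :
    W.swap.jet h.transpose Q P = W.jet h P Q := W.jetList_swap h _ _

theorem jet_zero_left (h : Matrix (Fin n) (Fin n) A) (Q : Multiset (Fin n)) : W.jet h 0 Q = 0 := by
  simp [jet, jetList]

theorem jet_zero_right (h : Matrix (Fin n) (Fin n) A) (P : Multiset (Fin n)) : W.jet h P 0 = 0 := by
  rw [← jet_swap, jet_zero_left]

/-- Exchanging the index of the matrix entry with that of a derivative is closedness; derivatives
among themselves commute. -/
theorem IsClosed.jetList_perm {W : WirtingerStructure n A} {h : Matrix (Fin n) (Fin n) A}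
    (hh : W.IsClosed h) {P P' : List (Fin n)} (hP : P.Perm P') (Q : List (Fin n)) :
    W.jetList h P Q = W.jetList h P' Q := by
  match Q with
  | [] => cases P <;> cases P' <;> rfl
  | b :: bs =>
    induction hP with
    | nil => rfl
    | cons x h' _ =>
      rw [jetList_cons_cons, jetList_cons_cons, Multiset.coe_eq_coe.mpr h']
    | swap x y l =>
      rw [jetList_cons_cons, jetList_cons_cons, ← Multiset.cons_coe, ← Multiset.cons_coe,
        holMulti_cons, holMulti_cons, W.holMulti_comm _ (W.hol_hol _),
        W.holMulti_comm _ (W.hol_hol _), W.antiMulti_comm _ (W.hol_anti _),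
        W.antiMulti_comm _ (W.hol_anti _), hh.hol]
    | trans _ _ h1 h2 => rw [h1, h2]

variable {W} {h : Matrix (Fin n) (Fin n) A}

theorem IsClosed.jet_cons_cons (hh : W.IsClosed h) (a b : Fin n) (P Q : Multiset (Fin n)) :
    W.jet h (a ::ₘ P) (b ::ₘ Q) = W.holMulti P (W.antiMulti Q (h a b)) := by
  have h1 : ((a ::ₘ P).sort (· ≤ ·)).Perm (a :: P.sort (· ≤ ·)) := by
    rw [← Multiset.coe_eq_coe, ← Multiset.cons_coe, Multiset.sort_eq, Multiset.sort_eq]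
  have h2 : ((b ::ₘ Q).sort (· ≤ ·)).Perm (b :: Q.sort (· ≤ ·)) := by
    rw [← Multiset.coe_eq_coe, ← Multiset.cons_coe, Multiset.sort_eq, Multiset.sort_eq]
  rw [jet, hh.jetList_perm h1, ← jetList_swap, hh.swap.jetList_perm h2, jetList_swap,
    jetList_cons_cons, Multiset.sort_eq, Multiset.sort_eq]

theorem IsClosed.jet_cons_left (hh : W.IsClosed h) (c : Fin n) {P Q : Multiset (Fin n)}
    (hP : P ≠ 0) : W.jet h (c ::ₘ P) Q = W.hol c (W.jet h P Q) := by
  obtain rfl | ⟨b, hb⟩ := Q.empty_or_exists_mem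
  · rw [jet_zero_right, jet_zero_right, map_zero]
  obtain ⟨Q, rfl⟩ := Multiset.exists_cons_of_mem hb
  obtain ⟨a, ha⟩ := Multiset.exists_mem_of_ne_zero hP
  obtain ⟨P, rfl⟩ := Multiset.exists_cons_of_mem ha
  rw [Multiset.cons_swap, hh.jet_cons_cons, hh.jet_cons_cons, holMulti_cons]

theorem IsClosed.jet_cons_right (hh : W.IsClosed h) (c : Fin n) {P Q : Multiset (Fin n)}
    (hQ : Q ≠ 0) : W.jet h P (c ::ₘ Q) = W.anti c (W.jet h P Q) := by
  rw [← jet_swap, hh.swap.jet_cons_left c hQ, jet_swap]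
  rfl

theorem IsClosed.jet_singleton (hh : W.IsClosed h) (a b : Fin n) : W.jet h {a} {b} = h a b :=
  hh.jet_cons_cons a b 0 0

/-- A first variation of a closed matrix along the vector field `η + η̄`. -/
structure IsVariation (W : WirtingerStructure n A) (h : Matrix (Fin n) (Fin n) A)
    (T : Derivation ℂ A A) (η ηbar : Fin n → A) : Prop where
  closed : W.IsClosed h
  hol_comm : ∀ i x, T (W.hol i x) = W.hol i (T x)
  anti_comm : ∀ i x, T (W.anti i x) = W.anti i (T x)
  anti_eq_zero : ∀ i j, W.anti i (η j) = 0
  hol_eq_zero : ∀ i j, W.hol i (ηbar j) = 0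
  apply_eq : ∀ a b, T (h a b) =
    W.hol a (∑ i, η i * h i b) + W.anti b (∑ j, ηbar j * h a j)

variable {T : Derivation ℂ A A} {η ηbar : Fin n → A} {α : Type*}

/-- Since `η` is holomorphic, the barred derivatives fall on the matrix entry alone, and the
unbarred ones are distributed by the Leibniz rule over subsets. -/
theorem IsClosed.holMulti_antiMulti_mul [DecidableEq α] (hh : W.IsClosed h) (hη : ∀ i j, W.anti i (η j) = 0)
    (S : Finset α) (a : α → Fin n) (b : Fin n) (Q : Multiset (Fin n)) :
    W.holMulti (S.val.map a) (W.antiMulti Q (∑ i, η i * h i b)) =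
      ∑ i, ∑ S' ∈ S.powerset, W.holMulti (S'.val.map a) (η i) *
        W.jet h (i ::ₘ (S \ S').val.map a) (b ::ₘ Q) := by
  rw [antiMulti_sum, holMulti_sum]
  refine Finset.sum_congr rfl fun i _ => ?_
  rw [W.antiMulti_mul_of_anti_eq_zero (fun j => hη j i), holMulti_mul]
  refine Finset.sum_congr rfl fun S' _ => ?_
  rw [hh.jet_cons_cons]

/-- The outer derivative in each half of `apply_eq` restores the index held by the matrix entry, so
the Leibniz rule runs over the whole of `S` or of `U`. The second half is the first one for the
swapped structure and the transposed matrix. -/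
theorem IsVariation.apply_jet [DecidableEq α] (hv : W.IsVariation h T η ηbar) {S U : Finset α}
    (hS : S.Nonempty) (hU : U.Nonempty) (a b : α → Fin n) :
    T (W.jet h (S.val.map a) (U.val.map b)) =
      (∑ i, ∑ S' ∈ S.powerset, W.holMulti (S'.val.map a) (η i) *
        W.jet h (i ::ₘ (S \ S').val.map a) (U.val.map b)) +
      ∑ j, ∑ U' ∈ U.powerset, W.antiMulti (U'.val.map b) (ηbar j) *
        W.jet h (S.val.map a) (j ::ₘ (U \ U').val.map b) := by
  obtain ⟨e, he⟩ := hS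
  obtain ⟨d, hd⟩ := hU
  have hS' : S.val.map a = a e ::ₘ (S.erase e).val.map a := by
    rw [← Multiset.map_cons, Finset.erase_val, Multiset.cons_erase he]
  have hU' : U.val.map b = b d ::ₘ (U.erase d).val.map b := by
    rw [← Multiset.map_cons, Finset.erase_val, Multiset.cons_erase hd]
  have h1 : T (W.jet h (S.val.map a) (U.val.map b)) =
      W.holMulti (S.val.map a) (W.antiMulti ((U.erase d).val.map b) (∑ i, η i * h i (b d))) +
      W.swap.holMulti (U.val.map b) (W.swap.antiMulti ((S.erase e).val.map a)
        (∑ j, ηbar j * h.transpose j (a e))) := by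
    rw [hS', hU', hv.closed.jet_cons_cons, W.holMulti_comm T hv.hol_comm,
      W.antiMulti_comm T hv.anti_comm, hv.apply_eq, antiMulti_add, holMulti_add]
    congr 1
    · rw [holMulti_cons, ← W.antiMulti_comm _ (W.hol_anti _), W.holMulti_comm _ (W.hol_hol _)]
    · rw [← W.antiMulti_comm _ (W.anti_anti _),
        ← W.holMulti_comm _ (fun i x => (W.hol_anti i _ x).symm), holMulti_antiMulti,
        ← antiMulti_cons]
      rfl
  rw [h1, hv.closed.holMulti_antiMulti_mul hv.anti_eq_zero,
    hv.closed.swap.holMulti_antiMulti_mul hv.hol_eq_zero, ← hS', ← hU']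
  simp only [jet_swap]
  rfl

/-- Subsets with fewer than two elements carry the value or a first derivative of the field, which
vanish at the point. -/
theorem sum_powerset_two_le {R : Type*} [CommRing R] (φ : A →+* R) {x : A} (h0 : φ x = 0)
    (h1 : ∀ i, φ (W.hol i x) = 0) (S : Finset α) (a : α → Fin n) (f : Finset α → R) :
    ∑ S' ∈ S.powerset, φ (W.holMulti (S'.val.map a) x) * f S' =
      ∑ S' ∈ S.powerset, if 2 ≤ S'.card then φ (W.holMulti (S'.val.map a) x) * f S' else 0 := by
  refine Finset.sum_congr rfl fun S' _ => ?_
  split_ifs with h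
  · rfl
  obtain h | h : S'.card = 0 ∨ S'.card = 1 := by omega
  · rw [Finset.card_eq_zero.mp h]
    simp [h0]
  · obtain ⟨e, rfl⟩ := Finset.card_eq_one.mp h
    have : W.holMulti (({e} : Finset α).val.map a) x = W.hol (a e) x :=
      W.holMulti_cons (a e) 0 x
    rw [this, h1, zero_mul]

/-- The variation of the jets at a point where the vector field vanishes to second order. -/
theorem IsVariation.map_apply_jet [DecidableEq α] {R : Type*} [CommRing R] (φ : A →+* R)
    (hv : W.IsVariation h T η ηbar) (h0 : ∀ i, φ (η i) = 0) (h1 : ∀ i j, φ (W.hol i (η j)) = 0)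
    (h0' : ∀ i, φ (ηbar i) = 0) (h1' : ∀ i j, φ (W.anti i (ηbar j)) = 0)
    (S U : Finset α) (a b : α → Fin n) :
    φ (T (W.jet h (S.val.map a) (U.val.map b))) =
      (∑ i, ∑ S' ∈ S.powerset, if 2 ≤ S'.card then φ (W.holMulti (S'.val.map a) (η i)) *
        φ (W.jet h (i ::ₘ (S \ S').val.map a) (U.val.map b)) else 0) +
      ∑ j, ∑ U' ∈ U.powerset, if 2 ≤ U'.card then φ (W.antiMulti (U'.val.map b) (ηbar j)) *
        φ (W.jet h (S.val.map a) (j ::ₘ (U \ U').val.map b)) else 0 := by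
  rcases S.eq_empty_or_nonempty with rfl | hS
  · simp [jet_zero_left]
  rcases U.eq_empty_or_nonempty with rfl | hU
  · simp [jet_zero_right]
  rw [hv.apply_jet hS hU, map_add, map_sum, map_sum]
  congr 1
  · refine Finset.sum_congr rfl fun i _ => ?_
    rw [map_sum, ← sum_powerset_two_le φ (h0 i) (fun j => h1 j i)]
    exact Finset.sum_congr rfl fun S' _ => map_mul _ _ _
  · refine Finset.sum_congr rfl fun i _ => ?_
    rw [map_sum]
    refine Eq.trans ?_ (sum_powerset_two_le (W := W.swap) φ (h0' i) (fun j => h1' j i) U b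
      fun U' => φ (W.jet h (S.val.map a) (i ::ₘ (U \ U').val.map b)))
    exact Finset.sum_congr rfl fun S' _ => map_mul _ _ _

end WirtingerStructure

end

noncomputable section

/-! ### The derivative of a graph expression along a path of jets -/

namespace FinDigraph

variable {n p q : ℕ}

theorem sum_mul_prod_erase_eq_fieldSum (J : Multiset (Fin n) → Multiset (Fin n) → ℂ)
    (B : Matrix (Fin n) (Fin n) ℂ) (ξ : Fin n → Multiset (Fin n) → ℂ) (s t : Fin q → Fin p) :
    ∑ a : Fin q → Fin n, ∑ b : Fin q → Fin n, (∏ e, B (b e) (a e)) *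
      ∑ v, (∏ w ∈ Finset.univ.erase v, J ((fiber s w).val.map a) ((fiber t w).val.map b)) *
        ∑ c, ∑ S ∈ (fiber s v).powerset, (if 2 ≤ S.card then
          ξ c (S.val.map a) * J (c ::ₘ (fiber s v \ S).val.map a) ((fiber t v).val.map b) else 0) =
      fieldSum J B ξ s t := by
  unfold fieldSum
  simp only [Finset.mul_sum]
  calc _ = ∑ a : Fin q → Fin n, ∑ b : Fin q → Fin n, ∑ v, ∑ S ∈ (fiber s v).powerset, ∑ c,
        if 2 ≤ S.card then (∏ e, B (b e) (a e)) * ξ c (S.val.map a) *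
          ∏ w, J (if w = v then c ::ₘ (fiber s v \ S).val.map a else (fiber s w).val.map a)
            ((fiber t w).val.map b) else 0 := by
        refine Finset.sum_congr rfl fun a _ => Finset.sum_congr rfl fun b _ =>
          Finset.sum_congr rfl fun v _ => ?_
        rw [Finset.sum_comm]
        refine Finset.sum_congr rfl fun S _ => Finset.sum_congr rfl fun c _ => ?_
        split_ifs with h
        swap
        · simp
        rw [← Finset.mul_prod_erase _ _ (Finset.mem_univ v), if_pos rfl]
        have : ∏ w ∈ Finset.univ.erase v,
            J (if w = v then c ::ₘ (fiber s v \ S).val.map a else (fiber s w).val.map a)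
              ((fiber t w).val.map b) =
            ∏ w ∈ Finset.univ.erase v, J ((fiber s w).val.map a) ((fiber t w).val.map b) :=
          Finset.prod_congr rfl fun w hw => by rw [if_neg (Finset.ne_of_mem_erase hw)]
        rw [this]
        ring
    _ = ∑ a : Fin q → Fin n, ∑ v, ∑ S ∈ (fiber s v).powerset, ∑ c, ∑ b : Fin q → Fin n,
        if 2 ≤ S.card then (∏ e, B (b e) (a e)) * ξ c (S.val.map a) *
          ∏ w, J (if w = v then c ::ₘ (fiber s v \ S).val.map a else (fiber s w).val.map a)
            ((fiber t w).val.map b) else 0 := by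
        refine Finset.sum_congr rfl fun a _ => ?_
        rw [Finset.sum_comm]
        refine Finset.sum_congr rfl fun v _ => ?_
        rw [Finset.sum_comm]
        refine Finset.sum_congr rfl fun S _ => ?_
        rw [Finset.sum_comm]
    _ = _ := by
        rw [Finset.sum_comm]
        refine Finset.sum_congr rfl fun v _ => ?_
        rw [Finset.sum_comm]
        refine Finset.sum_congr rfl fun S _ => ?_
        rw [Finset.sum_comm]
        split_ifs with h
        · rfl
        · simp

/-- The derivative of `jetEval` along a path of jets that follows a holomorphic vector field. -/
theorem hasDerivAt_jetEval {J : ℝ → Multiset (Fin n) → Multiset (Fin n) → ℂ} {τ : ℝ}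
    (B : Matrix (Fin n) (Fin n) ℂ) {ξ ξbar : Fin n → Multiset (Fin n) → ℂ}
    (hJ : ∀ (S U : Finset (Fin q)) (a b : Fin q → Fin n),
      HasDerivAt (fun τ => J τ (S.val.map a) (U.val.map b))
        ((∑ c, ∑ S' ∈ S.powerset, if 2 ≤ S'.card then ξ c (S'.val.map a) *
          J τ (c ::ₘ (S \ S').val.map a) (U.val.map b) else 0) +
        ∑ c, ∑ U' ∈ U.powerset, if 2 ≤ U'.card then ξbar c (U'.val.map b) *
          J τ (S.val.map a) (c ::ₘ (U \ U').val.map b) else 0) τ)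
    (s t : Fin q → Fin p) :
    HasDerivAt (fun τ => jetEval (J τ) B s t)
      (fieldSum (J τ) B ξ s t +
        fieldSum (fun P Q => J τ Q P) B.transpose ξbar t s) τ := by
  have h1 : HasDerivAt (fun τ => jetEval (J τ) B s t)
      (∑ a : Fin q → Fin n, ∑ b : Fin q → Fin n, (∏ e, B (b e) (a e)) *
        ∑ v, (∏ w ∈ Finset.univ.erase v, J τ ((fiber s w).val.map a) ((fiber t w).val.map b)) *
        ((∑ c, ∑ S' ∈ (fiber s v).powerset, if 2 ≤ S'.card then ξ c (S'.val.map a) *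
          J τ (c ::ₘ (fiber s v \ S').val.map a) ((fiber t v).val.map b) else 0) +
        ∑ c, ∑ U' ∈ (fiber t v).powerset, if 2 ≤ U'.card then ξbar c (U'.val.map b) *
          J τ ((fiber s v).val.map a) (c ::ₘ (fiber t v \ U').val.map b) else 0)) τ := by
    unfold jetEval
    refine HasDerivAt.fun_sum fun a _ => HasDerivAt.fun_sum fun b _ => HasDerivAt.const_mul _ ?_
    have := HasDerivAt.fun_finsetProd (u := Finset.univ) (fun v _ => hJ (fiber s v) (fiber t v) a b)
    simpa only [smul_eq_mul] using this
  convert h1 using 1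
  rw [← sum_mul_prod_erase_eq_fieldSum, ← sum_mul_prod_erase_eq_fieldSum]
  simp only [mul_add, Finset.sum_add_distrib, Matrix.transpose_apply]
  congr 1
  rw [Finset.sum_comm]

end FinDigraph

end

/-! ### Germs of smooth functions -/

noncomputable section

open Filter in
open scoped Topology in
/-- Germs of smooth complex-valued functions at a point of a real normed space. -/
def smoothGerm {E : Type*} [NormedAddCommGroup E] [NormedSpace ℝ E] (p : E) :
    Subring (Germ (𝓝 p) ℂ) where
  carrier := {γ | ∃ f : E → ℂ, ContDiffAt ℝ ∞ f p ∧ (f : Germ (𝓝 p) ℂ) = γ}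
  mul_mem' := by
    rintro _ _ ⟨f, hf, rfl⟩ ⟨g, hg, rfl⟩
    exact ⟨f * g, hf.mul hg, rfl⟩
  one_mem' := ⟨fun _ => 1, contDiffAt_const, rfl⟩
  add_mem' := by
    rintro _ _ ⟨f, hf, rfl⟩ ⟨g, hg, rfl⟩
    exact ⟨f + g, hf.add hg, rfl⟩
  zero_mem' := ⟨fun _ => 0, contDiffAt_const, rfl⟩
  neg_mem' := by
    rintro _ ⟨f, hf, rfl⟩
    exact ⟨-f, hf.neg, rfl⟩

namespace smoothGerm

open Filter Topology

variable {E : Type*} [NormedAddCommGroup E] [NormedSpace ℝ E] {p : E}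

/-- The germ of a smooth function. -/
def mk (f : E → ℂ) (hf : ContDiffAt ℝ ∞ f p) : smoothGerm p := ⟨(f : Germ (𝓝 p) ℂ), f, hf, rfl⟩

theorem exists_mk (x : smoothGerm p) : ∃ f, ∃ hf : ContDiffAt ℝ ∞ f p, mk f hf = x := by
  obtain ⟨_, f, hf, rfl⟩ := x
  exact ⟨f, hf, rfl⟩

theorem mk_eq_mk {f g : E → ℂ} {hf : ContDiffAt ℝ ∞ f p} {hg : ContDiffAt ℝ ∞ g p} :
    mk f hf = mk g hg ↔ f =ᶠ[𝓝 p] g := by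
  rw [Subtype.ext_iff]
  exact Germ.coe_eq

theorem mk_add {f g : E → ℂ} (hf : ContDiffAt ℝ ∞ f p) (hg : ContDiffAt ℝ ∞ g p) :
    mk f hf + mk g hg = mk (fun z => f z + g z) (hf.add hg) := rfl

theorem mk_mul {f g : E → ℂ} (hf : ContDiffAt ℝ ∞ f p) (hg : ContDiffAt ℝ ∞ g p) :
    mk f hf * mk g hg = mk (fun z => f z * g z) (hf.mul hg) := rfl

instance : Algebra ℂ (smoothGerm p) :=
  RingHom.toAlgebra
    { toFun := fun c => mk (fun _ => c) contDiffAt_const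
      map_one' := rfl
      map_mul' := fun _ _ => rfl
      map_zero' := rfl
      map_add' := fun _ _ => rfl }

theorem smul_mk (c : ℂ) {f : E → ℂ} (hf : ContDiffAt ℝ ∞ f p) :
    c • mk f hf = mk (fun z => c * f z) (contDiffAt_const.mul hf) := rfl

theorem mk_sum {ι : Type*} (I : Finset ι) (f : ι → E → ℂ) (hf : ∀ i, ContDiffAt ℝ ∞ (f i) p) :
    ∑ i ∈ I, mk (f i) (hf i) = mk (fun z => ∑ i ∈ I, f i z) (ContDiffAt.sum fun i _ => hf i) := by
  induction I using Finset.cons_induction with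
  | empty => rfl
  | cons i I hi ih =>
    rw [Finset.sum_cons, ih, mk_add]
    congr 1
    funext z
    rw [Finset.sum_cons]

/-- A smooth function with a given germ. -/
def rep (x : smoothGerm p) : E → ℂ := (exists_mk x).choose

theorem contDiffAt_rep (x : smoothGerm p) : ContDiffAt ℝ ∞ (rep x) p :=
  (exists_mk x).choose_spec.choose

theorem mk_rep (x : smoothGerm p) : mk (rep x) (contDiffAt_rep x) = x :=
  (exists_mk x).choose_spec.choose_spec

/-- Evaluation at the base point. -/
def eval (p : E) : smoothGerm p →+* ℂ := Germ.valueRingHom.comp (smoothGerm p).subtype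

@[simp]
theorem eval_mk (f : E → ℂ) (hf : ContDiffAt ℝ ∞ f p) : eval p (mk f hf) = f p := rfl

theorem _root_.ContDiffAt.fderiv_apply_const {f : E → ℂ} (hf : ContDiffAt ℝ ∞ f p) (v : E) :
    ContDiffAt ℝ ∞ (fun z => fderiv ℝ f z v) p :=
  (hf.fderiv_right (m := ∞) (by simp)).clm_apply contDiffAt_const

theorem _root_.ContDiffAt.eventually_differentiableAt {f : E → ℂ} (hf : ContDiffAt ℝ ∞ f p) :
    ∀ᶠ z in 𝓝 p, DifferentiableAt ℝ f z := by
  have h1 : ContDiffAt ℝ 1 f p := hf.of_le (by exact_mod_cast le_top)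
  filter_upwards [h1.eventually (by simp)] with z hz
  exact hz.differentiableAt (by simp)

/-- The derivative of a germ in the direction `v`, as a map. -/
def derivFun (p v : E) (x : smoothGerm p) : smoothGerm p :=
  mk (fun z => fderiv ℝ (rep x) z v) ((contDiffAt_rep x).fderiv_apply_const v)

theorem derivFun_mk (v : E) (f : E → ℂ) (hf : ContDiffAt ℝ ∞ f p) :
    derivFun p v (mk f hf) = mk _ (hf.fderiv_apply_const v) := by
  unfold derivFun
  rw [mk_eq_mk]
  have h1 : rep (mk f hf) =ᶠ[𝓝 p] f := mk_eq_mk.mp (mk_rep (mk f hf))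
  filter_upwards [h1.fderiv (𝕜 := ℝ)] with z hz
  rw [hz]

/-- The derivative of a germ in the direction `v`. -/
def deriv (p v : E) : Derivation ℂ (smoothGerm p) (smoothGerm p) := by
  refine Derivation.mk' { toFun := derivFun p v, map_add' := ?_, map_smul' := ?_ } ?_
  · intro x y
    obtain ⟨f, hf, rfl⟩ := exists_mk x
    obtain ⟨g, hg, rfl⟩ := exists_mk y
    rw [mk_add, derivFun_mk, derivFun_mk, derivFun_mk, mk_add, mk_eq_mk]
    filter_upwards [hf.eventually_differentiableAt, hg.eventually_differentiableAt] with z h1 h2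
    rw [fderiv_fun_add h1 h2]
    rfl
  · intro c x
    obtain ⟨f, hf, rfl⟩ := exists_mk x
    rw [smul_mk, derivFun_mk, derivFun_mk, RingHom.id_apply, smul_mk, mk_eq_mk]
    filter_upwards [hf.eventually_differentiableAt] with z h1
    rw [fderiv_const_mul h1]
    rfl
  · intro x y
    obtain ⟨f, hf, rfl⟩ := exists_mk x
    obtain ⟨g, hg, rfl⟩ := exists_mk y
    change derivFun p v _ = mk f hf * derivFun p v _ + mk g hg * derivFun p v _
    rw [mk_mul, derivFun_mk, derivFun_mk, derivFun_mk, mk_mul, mk_mul, mk_add, mk_eq_mk]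
    filter_upwards [hf.eventually_differentiableAt, hg.eventually_differentiableAt] with z h1 h2
    rw [fderiv_fun_mul h1 h2]
    rfl

@[simp]
theorem deriv_mk (v : E) (f : E → ℂ) (hf : ContDiffAt ℝ ∞ f p) :
    deriv p v (mk f hf) = mk _ (hf.fderiv_apply_const v) := derivFun_mk v f hf

theorem deriv_comm (v w : E) (x : smoothGerm p) :
    deriv p v (deriv p w x) = deriv p w (deriv p v x) := by
  obtain ⟨f, hf, rfl⟩ := exists_mk x
  rw [deriv_mk, deriv_mk, deriv_mk, deriv_mk, mk_eq_mk]
  have h2 : ContDiffAt ℝ 2 f p :=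
    hf.of_le (WithTop.coe_le_coe.mpr (le_top : (2 : ℕ∞) ≤ ⊤))
  filter_upwards [h2.eventually (by simp)] with z hz
  have h3 : DifferentiableAt ℝ (fderiv ℝ f) z :=
    (hz.fderiv_right (m := 1) (by norm_num)).differentiableAt (by simp)
  have h4 := hz.isSymmSndFDerivAt (by simp)
  rw [fderiv_clm_apply h3 (differentiableAt_const _), fderiv_clm_apply h3 (differentiableAt_const _)]
  simpa using h4 v w

end smoothGerm

end

noncomputable section

/-! ### Wirtinger derivatives in the presence of a real parameter -/

section SpaceTime

open Filter Topology smoothGerm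

variable {n : ℕ} {p : ℝ × (Fin n → ℂ)}

/-- `∂/∂z_i` for functions of a real parameter and `n` complex variables. -/
def sliceHol (i : Fin n) (f : ℝ × (Fin n → ℂ) → ℂ) (w : ℝ × (Fin n → ℂ)) : ℂ :=
  (fderiv ℝ f w (0, Pi.single i 1) - Complex.I * fderiv ℝ f w (0, Pi.single i Complex.I)) / 2

/-- `∂/∂z̄_i` for functions of a real parameter and `n` complex variables. -/
def sliceAnti (i : Fin n) (f : ℝ × (Fin n → ℂ) → ℂ) (w : ℝ × (Fin n → ℂ)) : ℂ :=
  (fderiv ℝ f w (0, Pi.single i 1) + Complex.I * fderiv ℝ f w (0, Pi.single i Complex.I)) / 2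

theorem ContDiffAt.sliceHol {f : ℝ × (Fin n → ℂ) → ℂ} (hf : ContDiffAt ℝ ∞ f p) (i : Fin n) :
    ContDiffAt ℝ ∞ (sliceHol i f) p :=
  ((hf.fderiv_apply_const _).sub (contDiffAt_const.mul (hf.fderiv_apply_const _))).div_const 2

theorem ContDiffAt.sliceAnti {f : ℝ × (Fin n → ℂ) → ℂ} (hf : ContDiffAt ℝ ∞ f p) (i : Fin n) :
    ContDiffAt ℝ ∞ (sliceAnti i f) p :=
  ((hf.fderiv_apply_const _).add (contDiffAt_const.mul (hf.fderiv_apply_const _))).div_const 2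

/-- All `∂` and `∂̄` have this form with `c` and `d` equal to ±i, so one computation gives all three
commutation laws. -/
theorem half_smul_add_smul_comm (c d : ℂ) (u u' v v' : ℝ × (Fin n → ℂ)) (x : smoothGerm p) :
    ((1 / 2 : ℂ) • (deriv p u + c • deriv p u')) (((1 / 2 : ℂ) • (deriv p v + d • deriv p v')) x) =
    ((1 / 2 : ℂ) • (deriv p v + d • deriv p v'))
      (((1 / 2 : ℂ) • (deriv p u + c • deriv p u')) x) := by
  simp only [Derivation.smul_apply, Derivation.add_apply, Derivation.map_smul, map_add]
  rw [deriv_comm v u, deriv_comm v u', deriv_comm v' u, deriv_comm v' u']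
  module

/-- The Wirtinger derivatives of germs of functions of a real parameter and `n` complex
variables. -/
def germWirtinger (p : ℝ × (Fin n → ℂ)) : WirtingerStructure n (smoothGerm p) where
  hol i := (1 / 2 : ℂ) • (deriv p (0, Pi.single i 1) +
    (-Complex.I) • deriv p (0, Pi.single i Complex.I))
  anti i := (1 / 2 : ℂ) • (deriv p (0, Pi.single i 1) +
    Complex.I • deriv p (0, Pi.single i Complex.I))
  hol_hol _ _ _ := half_smul_add_smul_comm ..
  anti_anti _ _ _ := half_smul_add_smul_comm ..
  hol_anti _ _ _ := half_smul_add_smul_comm ..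

theorem germWirtinger_hol_mk (i : Fin n) {f : ℝ × (Fin n → ℂ) → ℂ} (hf : ContDiffAt ℝ ∞ f p) :
    (germWirtinger p).hol i (mk f hf) = mk (sliceHol i f) (hf.sliceHol i) := by
  simp only [germWirtinger, Derivation.smul_apply, Derivation.add_apply, deriv_mk, smul_mk, mk_add]
  congr 1
  funext w
  simp only [sliceHol]
  ring

theorem germWirtinger_anti_mk (i : Fin n) {f : ℝ × (Fin n → ℂ) → ℂ} (hf : ContDiffAt ℝ ∞ f p) :
    (germWirtinger p).anti i (mk f hf) = mk (sliceAnti i f) (hf.sliceAnti i) := by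
  simp only [germWirtinger, Derivation.smul_apply, Derivation.add_apply, deriv_mk, smul_mk, mk_add]
  congr 1
  funext w
  simp only [sliceAnti]
  ring

theorem eventually_fderiv_slice {f : ℝ × (Fin n → ℂ) → ℂ} (hf : ContDiffAt ℝ ∞ f p)
    {g : ℝ → (Fin n → ℂ) → ℂ} (hfg : ∀ᶠ w in 𝓝 p, g w.1 w.2 = f w) :
    ∀ᶠ w in 𝓝 p, ∀ v, fderiv ℝ (g w.1) w.2 v = fderiv ℝ f w (0, v) := by
  filter_upwards [hfg.eventually_nhds, hf.eventually_differentiableAt] with w h1 h2 v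
  have h3 : Tendsto (fun z : Fin n → ℂ => (w.1, z)) (𝓝 w.2) (𝓝 w) :=
    (Continuous.prodMk_right w.1).tendsto w.2
  have h4 : g w.1 =ᶠ[𝓝 w.2] fun z => f (w.1, z) := h3.eventually h1
  have h5 : HasFDerivAt (fun z => f (w.1, z)) _ w.2 :=
    HasFDerivAt.comp w.2 (f := fun z : Fin n → ℂ => (w.1, z)) (g := f) h2.hasFDerivAt
      (hasFDerivAt_prodMk_right w.1 w.2)
  rw [h4.fderiv_eq, h5.fderiv]
  rfl

theorem eventually_dHol_slice {f : ℝ × (Fin n → ℂ) → ℂ} (hf : ContDiffAt ℝ ∞ f p)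
    {g : ℝ → (Fin n → ℂ) → ℂ} (hfg : ∀ᶠ w in 𝓝 p, g w.1 w.2 = f w) (i : Fin n) :
    ∀ᶠ w in 𝓝 p, dHol i (g w.1) w.2 = sliceHol i f w := by
  filter_upwards [eventually_fderiv_slice hf hfg] with w hw
  rw [dHol, hw, hw, sliceHol]

theorem eventually_dAnti_slice {f : ℝ × (Fin n → ℂ) → ℂ} (hf : ContDiffAt ℝ ∞ f p)
    {g : ℝ → (Fin n → ℂ) → ℂ} (hfg : ∀ᶠ w in 𝓝 p, g w.1 w.2 = f w) (i : Fin n) :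
    ∀ᶠ w in 𝓝 p, dAnti i (g w.1) w.2 = sliceAnti i f w := by
  filter_upwards [eventually_fderiv_slice hf hfg] with w hw
  rw [dAnti, hw, hw, sliceAnti]

/-- `g` is a family of functions whose germ in space and time is `x`. -/
def HasGerm (g : ℝ → (Fin n → ℂ) → ℂ) (x : smoothGerm p) : Prop :=
  ∃ f, ∃ hf : ContDiffAt ℝ ∞ f p, mk f hf = x ∧ ∀ᶠ w in 𝓝 p, g w.1 w.2 = f w

theorem HasGerm.dHol {g : ℝ → (Fin n → ℂ) → ℂ} {x : smoothGerm p} (h : HasGerm g x) (i : Fin n) :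
    HasGerm (fun τ => dHol i (g τ)) ((germWirtinger p).hol i x) := by
  obtain ⟨f, hf, rfl, hg⟩ := h
  exact ⟨_, hf.sliceHol i, (germWirtinger_hol_mk i hf).symm, eventually_dHol_slice hf hg i⟩

theorem HasGerm.dAnti {g : ℝ → (Fin n → ℂ) → ℂ} {x : smoothGerm p} (h : HasGerm g x) (i : Fin n) :
    HasGerm (fun τ => dAnti i (g τ)) ((germWirtinger p).anti i x) := by
  obtain ⟨f, hf, rfl, hg⟩ := h
  exact ⟨_, hf.sliceAnti i, (germWirtinger_anti_mk i hf).symm, eventually_dAnti_slice hf hg i⟩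

theorem HasGerm.eval_eq {g : ℝ → (Fin n → ℂ) → ℂ} {x : smoothGerm p} (h : HasGerm g x) :
    g p.1 p.2 = eval p x := by
  obtain ⟨f, hf, rfl, hg⟩ := h
  exact hg.self_of_nhds

/-- The bridge from differential algebra to calculus: the time derivative at a fixed point is the
derivation in the direction `(1, 0)`. -/
theorem HasGerm.hasDerivAt {g : ℝ → (Fin n → ℂ) → ℂ} {x : smoothGerm p} (h : HasGerm g x) :
    HasDerivAt (fun τ => g τ p.2) (eval p (deriv p (1, 0) x)) p.1 := by
  obtain ⟨f, hf, rfl, hg⟩ := h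
  have h1 : HasDerivAt (fun τ => f (τ, p.2)) (fderiv ℝ f p (1, 0)) p.1 := by
    have h2 : HasDerivAt (fun τ : ℝ => (τ, p.2)) ((1 : ℝ), (0 : Fin n → ℂ)) p.1 :=
      (hasDerivAt_id p.1).prodMk (hasDerivAt_const p.1 p.2)
    exact (hf.eventually_differentiableAt.self_of_nhds.hasFDerivAt (x := p)).comp_hasDerivAt p.1 h2
  rw [deriv_mk, eval_mk]
  refine h1.congr_of_eventuallyEq ?_
  have h3 : Tendsto (fun τ : ℝ => (τ, p.2)) (𝓝 p.1) (𝓝 p) :=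
    (Continuous.prodMk_left p.2).tendsto p.1
  exact h3.eventually hg

theorem HasGerm.metricDerivList {F : ℝ → (Fin n → ℂ) → Matrix (Fin n) (Fin n) ℂ}
    {h : Matrix (Fin n) (Fin n) (smoothGerm p)} (hF : ∀ a b, HasGerm (fun τ z => F τ z a b) (h a b))
    (P Q : List (Fin n)) :
    HasGerm (fun τ => _root_.metricDerivList (F τ) P Q) ((germWirtinger p).jetList h P Q) := by
  have h0 : HasGerm (fun _ _ => 0) (0 : smoothGerm p) :=
    ⟨fun _ => 0, contDiffAt_const, rfl, Eventually.of_forall fun _ => rfl⟩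
  match P, Q with
  | [], [] => exact h0
  | [], _ :: _ => exact h0
  | _ :: _, [] => exact h0
  | a :: as, b :: bs =>
    have h1 : HasGerm (fun τ => bs.foldr _root_.dAnti fun z => F τ z a b)
        (bs.foldr (fun i x => (germWirtinger p).anti i x) (h a b)) := by
      induction bs with
      | nil => exact hF a b
      | cons c bs ih => exact ih.dAnti c
    change HasGerm (fun τ => as.foldr _root_.dHol (bs.foldr _root_.dAnti fun z => F τ z a b))
      (as.foldr (fun i x => (germWirtinger p).hol i x) _)
    induction as with
    | nil => exact h1
    | cons c as ih => exact ih.dHol c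

theorem HasGerm.metricDeriv {F : ℝ → (Fin n → ℂ) → Matrix (Fin n) (Fin n) ℂ}
    {h : Matrix (Fin n) (Fin n) (smoothGerm p)} (hF : ∀ a b, HasGerm (fun τ z => F τ z a b) (h a b))
    (P Q : Multiset (Fin n)) :
    HasGerm (fun τ => _root_.metricDeriv (F τ) P Q) ((germWirtinger p).jet h P Q) :=
  HasGerm.metricDerivList hF _ _

end SpaceTime

end

noncomputable section

/-! ### Pullback of a Kähler metric in differential algebra -/

namespace WirtingerStructure

variable {n : ℕ} {A : Type*} [CommRing A] [Algebra ℂ A]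

/-- The pullback of the matrix `G` under the map with coordinates `φ` and their conjugates
`φbar`. -/
def pullback (W : WirtingerStructure n A) (φ φbar : Fin n → A) (G : Matrix (Fin n) (Fin n) A) :
    Matrix (Fin n) (Fin n) A :=
  fun a b => ∑ p, ∑ q, G p q * W.hol a (φ p) * W.anti b (φbar q)

/-- `G` is the composition of a Kähler metric with the holomorphic map with coordinates `φ` and
their conjugates `φbar`; the derivatives of the metric are `G₁` and `G₂`. -/
structure IsKahlerAlong (W : WirtingerStructure n A) (φ φbar : Fin n → A)
    (G : Matrix (Fin n) (Fin n) A) (G₁ G₂ : Fin n → Fin n → Fin n → A) : Prop where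
  anti_map : ∀ i j, W.anti i (φ j) = 0
  hol_map : ∀ i j, W.hol i (φbar j) = 0
  symm_left : ∀ r p q, G₁ r p q = G₁ p r q
  symm_right : ∀ r p q, G₂ r p q = G₂ q p r
  hol_apply : ∀ i p q, W.hol i (G p q) = ∑ r, G₁ r p q * W.hol i (φ r)
  anti_apply : ∀ i p q, W.anti i (G p q) = ∑ r, G₂ r p q * W.anti i (φbar r)

variable {W : WirtingerStructure n A} {φ φbar : Fin n → A} {G : Matrix (Fin n) (Fin n) A}
  {G₁ G₂ : Fin n → Fin n → Fin n → A}

theorem IsKahlerAlong.swap (hG : W.IsKahlerAlong φ φbar G G₁ G₂) :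
    W.swap.IsKahlerAlong φbar φ G.transpose (fun r p q => G₂ r q p) (fun r p q => G₁ r q p) where
  anti_map := hG.hol_map
  hol_map := hG.anti_map
  symm_left r p q := hG.symm_right r q p
  symm_right r p q := hG.symm_left r q p
  hol_apply i p q := hG.anti_apply i q p
  anti_apply i p q := hG.hol_apply i q p

theorem pullback_swap (W : WirtingerStructure n A) (φ φbar : Fin n → A)
    (G : Matrix (Fin n) (Fin n) A) :
    W.swap.pullback φbar φ G.transpose = (W.pullback φ φbar G).transpose := by
  ext a b
  simp only [pullback, Matrix.transpose_apply]
  rw [Finset.sum_comm]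
  exact Finset.sum_congr rfl fun p _ => Finset.sum_congr rfl fun q _ => by
    simp only [WirtingerStructure.swap]
    ring

theorem IsKahlerAlong.hol_anti_map (hG : W.IsKahlerAlong φ φbar G G₁ G₂) (i b q : Fin n) :
    W.hol i (W.anti b (φbar q)) = 0 := by
  rw [W.hol_anti, hG.hol_map, map_zero]

/-- The derivative of a contraction of the metric with holomorphic components `ψ`. -/
theorem IsKahlerAlong.hol_contraction (hG : W.IsKahlerAlong φ φbar G G₁ G₂) (a b : Fin n)
    (ψ : Fin n → A) :
    W.hol a (∑ p, ∑ q, G p q * ψ p * W.anti b (φbar q)) =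
      ∑ p, ∑ q, ((∑ r, G₁ r p q * ψ r) * W.hol a (φ p) + G p q * W.hol a (ψ p)) *
        W.anti b (φbar q) := by
  simp only [map_sum, Derivation.leibniz, hG.hol_anti_map, mul_zero, zero_add, smul_eq_mul,
    hG.hol_apply, add_mul, mul_add, Finset.sum_add_distrib]
  rw [add_comm]
  congr 1
  · simp only [Finset.mul_sum, Finset.sum_mul]
    calc _ = ∑ p, ∑ r, ∑ q, W.anti b (φbar q) * (ψ p * (G₁ r p q * W.hol a (φ r))) :=
          Finset.sum_congr rfl fun p _ => Finset.sum_comm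
      _ = ∑ r, ∑ p, ∑ q, W.anti b (φbar q) * (ψ p * (G₁ r p q * W.hol a (φ r))) := Finset.sum_comm
      _ = ∑ r, ∑ q, ∑ p, W.anti b (φbar q) * (ψ p * (G₁ r p q * W.hol a (φ r))) :=
          Finset.sum_congr rfl fun p _ => Finset.sum_comm
      _ = _ := Finset.sum_congr rfl fun p _ => Finset.sum_congr rfl fun q _ =>
          Finset.sum_congr rfl fun r _ => by
            rw [hG.symm_left]
            ring
  · exact Finset.sum_congr rfl fun p _ => Finset.sum_congr rfl fun q _ => by ring

/-- Derivatives that fall on the metric are symmetric by closedness of the metric on the target,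
those that fall on the Jacobian by commutation of derivatives. -/
theorem IsKahlerAlong.hol_pullback (hG : W.IsKahlerAlong φ φbar G G₁ G₂) (i a b : Fin n) :
    W.hol i (W.pullback φ φbar G a b) = W.hol a (W.pullback φ φbar G i b) := by
  unfold pullback
  rw [hG.hol_contraction i b (fun p => W.hol a (φ p)),
    hG.hol_contraction a b (fun p => W.hol i (φ p))]
  simp only [add_mul, Finset.sum_add_distrib, Finset.sum_mul]
  congr 1
  · calc _ = ∑ p, ∑ r, ∑ q, G₁ r p q * W.hol a (φ r) * W.hol i (φ p) * W.anti b (φbar q) :=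
          Finset.sum_congr rfl fun p _ => Finset.sum_comm
      _ = ∑ r, ∑ p, ∑ q, G₁ r p q * W.hol a (φ r) * W.hol i (φ p) * W.anti b (φbar q) :=
          Finset.sum_comm
      _ = ∑ r, ∑ q, ∑ p, G₁ r p q * W.hol a (φ r) * W.hol i (φ p) * W.anti b (φbar q) :=
          Finset.sum_congr rfl fun p _ => Finset.sum_comm
      _ = _ := Finset.sum_congr rfl fun p _ => Finset.sum_congr rfl fun q _ =>
          Finset.sum_congr rfl fun r _ => by
            rw [hG.symm_left]
            ring
  · exact Finset.sum_congr rfl fun p _ => Finset.sum_congr rfl fun q _ => by rw [W.hol_hol]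

theorem IsKahlerAlong.isClosed (hG : W.IsKahlerAlong φ φbar G G₁ G₂) :
    W.IsClosed (W.pullback φ φbar G) where
  hol := hG.hol_pullback
  anti j a b := by
    have h := hG.swap.hol_pullback j b a
    rwa [pullback_swap] at h

/-- The Jacobian in the pullback turns a velocity in source coordinates into the velocity of the map
in target coordinates. -/
theorem sum_mul_pullback {η ψ : Fin n → A} (hη : ∀ p, ∑ i, η i * W.hol i (φ p) = ψ p) (b : Fin n) :
    ∑ i, η i * W.pullback φ φbar G i b = ∑ p, ∑ q, G p q * ψ p * W.anti b (φbar q) := by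
  simp only [pullback, ← hη, Finset.mul_sum, Finset.sum_mul]
  rw [Finset.sum_comm]
  refine Finset.sum_congr rfl fun p _ => ?_
  rw [Finset.sum_comm]
  exact Finset.sum_congr rfl fun q _ => Finset.sum_congr rfl fun i _ => by ring

/-- The variation of the pullback of a metric along a path of holomorphic maps. -/
theorem IsKahlerAlong.isVariation (hG : W.IsKahlerAlong φ φbar G G₁ G₂) {T : Derivation ℂ A A}
    (hT : ∀ i x, T (W.hol i x) = W.hol i (T x)) (hT' : ∀ i x, T (W.anti i x) = W.anti i (T x))
    (hTG : ∀ p q, T (G p q) = (∑ r, G₁ r p q * T (φ r)) + ∑ r, G₂ r p q * T (φbar r))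
    {η ηbar : Fin n → A}
    (hη : ∀ p, ∑ i, η i * W.hol i (φ p) = T (φ p))
    (hη' : ∀ p, ∑ i, ηbar i * W.anti i (φbar p) = T (φbar p))
    (h0 : ∀ i j, W.anti i (η j) = 0) (h0' : ∀ i j, W.hol i (ηbar j) = 0) :
    W.IsVariation (W.pullback φ φbar G) T η ηbar where
  closed := hG.isClosed
  hol_comm := hT
  anti_comm := hT'
  anti_eq_zero := h0
  hol_eq_zero := h0'
  apply_eq a b := by
    have h1 := hG.hol_contraction a b fun p => T (φ p)
    have h2 := hG.swap.hol_contraction b a fun p => T (φbar p)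
    have h3 := sum_mul_pullback (W := W.swap) (φ := φbar) (φbar := φ) (G := G.transpose) hη' a
    rw [pullback_swap] at h3
    simp only [Matrix.transpose_apply] at h3
    rw [sum_mul_pullback hη, h3, h1]
    refine Eq.trans ?_ (congrArg _ h2.symm)
    rw [Finset.sum_comm (f := fun p q => _ * W.swap.anti a (φ q)), ← Finset.sum_add_distrib]
    simp only [← Finset.sum_add_distrib, pullback, map_sum]
    refine Finset.sum_congr rfl fun p _ => Finset.sum_congr rfl fun q _ => ?_
    simp only [Derivation.leibniz, smul_eq_mul, hTG, hT, hT', WirtingerStructure.swap,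
      Matrix.transpose_apply]
    ring

end WirtingerStructure

end

noncomputable section

/-! ### Families of holomorphic maps and their germs -/

section HolomorphicFamily

open Filter Topology smoothGerm

variable {n : ℕ}

/-- A real-linear form on `ℂⁿ` in terms of its Wirtinger derivatives. -/
theorem apply_eq_sum_wirtinger (L : (Fin n → ℂ) →L[ℝ] ℂ) (ζ : Fin n → ℂ) :
    L ζ = ∑ r, ((L (Pi.single r 1) - Complex.I * L (Pi.single r Complex.I)) / 2 * ζ r +
      (L (Pi.single r 1) + Complex.I * L (Pi.single r Complex.I)) / 2 *
        (starRingEnd ℂ) (ζ r)) := by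
  have h1 : ζ = ∑ r, ((ζ r).re • (Pi.single r 1 : Fin n → ℂ) +
      (ζ r).im • (Pi.single r Complex.I : Fin n → ℂ)) := by
    funext i
    rw [Finset.sum_apply, Finset.sum_eq_single i]
    · simp [Complex.re_add_im]
    · intro r _ hr
      simp [hr.symm]
    · simp
  conv_lhs => rw [h1]
  rw [map_sum]
  refine Finset.sum_congr rfl fun r _ => ?_
  rw [map_add, map_smul, map_smul, Complex.real_smul, Complex.real_smul]
  have h2 := Complex.re_add_im (ζ r)
  have h3 : (starRingEnd ℂ) (ζ r) = (ζ r).re - (ζ r).im * Complex.I := by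
    apply Complex.ext <;> simp
  rw [h3]
  nth_rewrite 3 [← h2]
  linear_combination ((ζ r).im * L (Pi.single r Complex.I)) * Complex.I_mul_I

theorem fderiv_conj_apply {E : Type*} [NormedAddCommGroup E] [NormedSpace ℝ E] {f : E → ℂ} {w : E}
    (hf : DifferentiableAt ℝ f w) (v : E) :
    fderiv ℝ (fun z => (starRingEnd ℂ) (f z)) w v = (starRingEnd ℂ) (fderiv ℝ f w v) := by
  have h : HasFDerivAt (fun z => (starRingEnd ℂ) (f z)) _ w :=
    (Complex.conjCLE.toContinuousLinearMap.hasFDerivAt (x := f w)).comp w hf.hasFDerivAt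
  rw [h.fderiv]
  rfl

theorem dAnti_conj {f : (Fin n → ℂ) → ℂ} {z : Fin n → ℂ} (hf : DifferentiableAt ℝ f z)
    (i : Fin n) : dAnti i (fun z => (starRingEnd ℂ) (f z)) z = (starRingEnd ℂ) (dHol i f z) := by
  rw [dAnti, dHol, fderiv_conj_apply hf, fderiv_conj_apply hf]
  simp [Complex.conj_ofNat]

theorem sliceAnti_conj {f : ℝ × (Fin n → ℂ) → ℂ} {w : ℝ × (Fin n → ℂ)}
    (hf : DifferentiableAt ℝ f w) (i : Fin n) :
    sliceAnti i (fun z => (starRingEnd ℂ) (f z)) w = (starRingEnd ℂ) (sliceHol i f w) := by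
  rw [sliceAnti, sliceHol, fderiv_conj_apply hf, fderiv_conj_apply hf]
  simp [Complex.conj_ofNat]

theorem sliceHol_conj {f : ℝ × (Fin n → ℂ) → ℂ} {w : ℝ × (Fin n → ℂ)}
    (hf : DifferentiableAt ℝ f w) (i : Fin n) :
    sliceHol i (fun z => (starRingEnd ℂ) (f z)) w = (starRingEnd ℂ) (sliceAnti i f w) := by
  rw [sliceAnti, sliceHol, fderiv_conj_apply hf, fderiv_conj_apply hf]
  simp [sub_eq_add_neg, Complex.conj_ofNat]

theorem ContDiffAt.dHol {f : (Fin n → ℂ) → ℂ} {z : Fin n → ℂ} (hf : ContDiffAt ℝ ∞ f z)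
    (i : Fin n) : ContDiffAt ℝ ∞ (dHol i f) z :=
  ((hf.fderiv_apply_const _).sub (contDiffAt_const.mul (hf.fderiv_apply_const _))).div_const 2

theorem ContDiffAt.dAnti {f : (Fin n → ℂ) → ℂ} {z : Fin n → ℂ} (hf : ContDiffAt ℝ ∞ f z)
    (i : Fin n) : ContDiffAt ℝ ∞ (dAnti i f) z :=
  ((hf.fderiv_apply_const _).add (contDiffAt_const.mul (hf.fderiv_apply_const _))).div_const 2

/-- A family of holomorphic maps near `p`, smooth in the parameter. -/
structure IsHolomorphicFamily (Φ : ℝ → (Fin n → ℂ) → (Fin n → ℂ)) (p : ℝ × (Fin n → ℂ)) : Prop where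
  smooth : ∀ i, ContDiffAt ℝ ∞ (fun w : ℝ × (Fin n → ℂ) => Φ w.1 w.2 i) p
  hol : ∀ᶠ w in 𝓝 p, DifferentiableAt ℂ (Φ w.1) w.2

namespace IsHolomorphicFamily

variable {Φ : ℝ → (Fin n → ℂ) → (Fin n → ℂ)} {p : ℝ × (Fin n → ℂ)}

theorem contDiffAt (h : IsHolomorphicFamily Φ p) : ContDiffAt ℝ ∞ (fun w : ℝ × (Fin n → ℂ) => Φ w.1 w.2) p :=
  contDiffAt_pi.mpr h.smooth

theorem smooth_conj (h : IsHolomorphicFamily Φ p) (i : Fin n) :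
    ContDiffAt ℝ ∞ (fun w : ℝ × (Fin n → ℂ) => (starRingEnd ℂ) (Φ w.1 w.2 i)) p :=
  Complex.conjCLE.contDiff.contDiffAt.comp p (h.smooth i)

theorem fderiv_eq (h : IsHolomorphicFamily Φ p) : ∀ᶠ w in 𝓝 p, ∀ i v,
    fderiv ℝ (fun w : ℝ × (Fin n → ℂ) => Φ w.1 w.2 i) w (0, v) = fderiv ℂ (Φ w.1) w.2 v i := by
  have h1 := fun i => eventually_fderiv_slice (h.smooth i) (g := fun τ z => Φ τ z i)
    (Eventually.of_forall fun _ => rfl)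
  filter_upwards [h.hol, eventually_all.mpr h1] with w hw hw1 i v
  rw [← hw1 i v]
  have h2 : HasFDerivAt (fun z => Φ w.1 z i) (((ContinuousLinearMap.proj i).comp
      (fderiv ℂ (Φ w.1) w.2)).restrictScalars ℝ) w.2 :=
    (((ContinuousLinearMap.proj (R := ℂ) (φ := fun _ : Fin n => ℂ) i).hasFDerivAt.comp w.2
      hw.hasFDerivAt).restrictScalars ℝ)
  rw [h2.fderiv]
  rfl

theorem sliceHol_eq (h : IsHolomorphicFamily Φ p) : ∀ᶠ w in 𝓝 p, ∀ i j,
    sliceHol j (fun w : ℝ × (Fin n → ℂ) => Φ w.1 w.2 i) w =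
      fderiv ℂ (Φ w.1) w.2 (Pi.single j 1) i := by
  filter_upwards [h.fderiv_eq] with w hw i j
  have h1 : (Pi.single j Complex.I : Fin n → ℂ) = Complex.I • Pi.single j 1 := by
    rw [← Pi.single_smul, smul_eq_mul, mul_one]
  rw [sliceHol, hw, hw, h1, map_smul, Pi.smul_apply, smul_eq_mul]
  linear_combination (-1 / 2 * fderiv ℂ (Φ w.1) w.2 (Pi.single j 1) i) * Complex.I_mul_I

theorem sliceAnti_eq (h : IsHolomorphicFamily Φ p) : ∀ᶠ w in 𝓝 p, ∀ i j,
    sliceAnti j (fun w : ℝ × (Fin n → ℂ) => Φ w.1 w.2 i) w = 0 := by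
  filter_upwards [h.fderiv_eq] with w hw i j
  have h1 : (Pi.single j Complex.I : Fin n → ℂ) = Complex.I • Pi.single j 1 := by
    rw [← Pi.single_smul, smul_eq_mul, mul_one]
  rw [sliceAnti, hw, hw, h1, map_smul, Pi.smul_apply, smul_eq_mul]
  linear_combination (1 / 2 * fderiv ℂ (Φ w.1) w.2 (Pi.single j 1) i) * Complex.I_mul_I

/-- The germs of the coordinates of the maps. -/
def coord (h : IsHolomorphicFamily Φ p) (i : Fin n) : smoothGerm p := smoothGerm.mk _ (h.smooth i)

/-- The germs of the conjugate coordinates of the maps. -/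
def coordBar (h : IsHolomorphicFamily Φ p) (i : Fin n) : smoothGerm p := smoothGerm.mk _ (h.smooth_conj i)

/-- The germ of the composition of a smooth function with the maps. -/
def comp (h : IsHolomorphicFamily Φ p) (u : (Fin n → ℂ) → ℂ) (hu : ContDiffAt ℝ ∞ u (Φ p.1 p.2)) : smoothGerm p :=
  smoothGerm.mk (fun w => u (Φ w.1 w.2)) (ContDiffAt.comp p (g := u) hu h.contDiffAt)

theorem anti_coord (h : IsHolomorphicFamily Φ p) (i j : Fin n) : (germWirtinger p).anti i (h.coord j) = 0 := by
  rw [coord, germWirtinger_anti_mk]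
  refine mk_eq_mk (hg := contDiffAt_const (c := 0)).mpr ?_
  filter_upwards [h.sliceAnti_eq] with w hw
  exact hw j i

theorem hol_coordBar (h : IsHolomorphicFamily Φ p) (i j : Fin n) : (germWirtinger p).hol i (h.coordBar j) = 0 := by
  rw [coordBar, germWirtinger_hol_mk]
  refine mk_eq_mk (hg := contDiffAt_const (c := 0)).mpr ?_
  filter_upwards [h.sliceAnti_eq, (h.smooth j).eventually_differentiableAt] with w hw hw'
  rw [sliceHol_conj hw', hw j i, map_zero]

/-- The chain rule. -/
theorem deriv_comp (h : IsHolomorphicFamily Φ p) (u : (Fin n → ℂ) → ℂ) (hu : ContDiffAt ℝ ∞ u (Φ p.1 p.2))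
    (v : ℝ × (Fin n → ℂ)) : smoothGerm.deriv p v (h.comp u hu) =
      (∑ r, h.comp (dHol r u) (hu.dHol r) * smoothGerm.deriv p v (h.coord r)) +
      ∑ r, h.comp (dAnti r u) (hu.dAnti r) * smoothGerm.deriv p v (h.coordBar r) := by
  simp only [comp, coord, coordBar, deriv_mk, mk_mul, mk_sum, mk_add]
  rw [mk_eq_mk]
  have h1 : ∀ᶠ w : ℝ × (Fin n → ℂ) in 𝓝 p, DifferentiableAt ℝ u (Φ w.1 w.2) :=
    h.contDiffAt.continuousAt.eventually hu.eventually_differentiableAt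
  filter_upwards [h1, eventually_all.mpr fun i => (h.smooth i).eventually_differentiableAt]
    with w hw hw'
  have h2 : HasFDerivAt (fun w : ℝ × (Fin n → ℂ) => Φ w.1 w.2)
      (ContinuousLinearMap.pi fun i =>
        fderiv ℝ (fun w : ℝ × (Fin n → ℂ) => Φ w.1 w.2 i) w) w :=
    hasFDerivAt_pi.mpr fun i => (hw' i).hasFDerivAt
  have h3 : HasFDerivAt (fun w : ℝ × (Fin n → ℂ) => u (Φ w.1 w.2)) _ w :=
    HasFDerivAt.comp w (f := fun w : ℝ × (Fin n → ℂ) => Φ w.1 w.2) (g := u) hw.hasFDerivAt h2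
  rw [h3.fderiv, ContinuousLinearMap.comp_apply, apply_eq_sum_wirtinger, Finset.sum_add_distrib]
  congr 1
  refine Finset.sum_congr rfl fun r _ => ?_
  rw [fderiv_conj_apply (hw' r)]
  rfl

theorem hol_comp (h : IsHolomorphicFamily Φ p) (u : (Fin n → ℂ) → ℂ) (hu : ContDiffAt ℝ ∞ u (Φ p.1 p.2)) (i : Fin n) :
    (germWirtinger p).hol i (h.comp u hu) =
      ∑ r, h.comp (dHol r u) (hu.dHol r) * (germWirtinger p).hol i (h.coord r) := by
  have h1 : ∑ r, h.comp (dAnti r u) (hu.dAnti r) * (germWirtinger p).hol i (h.coordBar r) = 0 :=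
    Finset.sum_eq_zero fun r _ => by rw [h.hol_coordBar, mul_zero]
  rw [← add_zero (∑ r, _), ← h1]
  simp only [germWirtinger, Derivation.smul_apply, Derivation.add_apply, deriv_comp, mul_add,
    mul_smul_comm, Finset.sum_add_distrib, ← Finset.smul_sum]
  module

theorem anti_comp (h : IsHolomorphicFamily Φ p) (u : (Fin n → ℂ) → ℂ) (hu : ContDiffAt ℝ ∞ u (Φ p.1 p.2)) (i : Fin n) :
    (germWirtinger p).anti i (h.comp u hu) =
      ∑ r, h.comp (dAnti r u) (hu.dAnti r) * (germWirtinger p).anti i (h.coordBar r) := by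
  have h1 : ∑ r, h.comp (dHol r u) (hu.dHol r) * (germWirtinger p).anti i (h.coord r) = 0 :=
    Finset.sum_eq_zero fun r _ => by rw [h.anti_coord, mul_zero]
  rw [← zero_add (∑ r, _), ← h1]
  simp only [germWirtinger, Derivation.smul_apply, Derivation.add_apply, deriv_comp, mul_add,
    mul_smul_comm, Finset.sum_add_distrib, ← Finset.smul_sum]
  module

end IsHolomorphicFamily

end HolomorphicFamily

end

noncomputable section

/-! ### The velocity of a family and the first variation -/

section Variation

open Filter Topology smoothGerm

variable {n : ℕ}

namespace IsKahlerMetricOn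

variable {g : (Fin n → ℂ) → Matrix (Fin n) (Fin n) ℂ} {U : Set (Fin n → ℂ)}

theorem contDiffAt (hg : IsKahlerMetricOn g U) (hU : IsOpen U) {y : Fin n → ℂ} (hy : y ∈ U)
    (i j : Fin n) : ContDiffAt ℝ ∞ (fun z => g z i j) y :=
  (hg.smooth i j).contDiffAt (hU.mem_nhds hy)

theorem apply_eq_conj (hg : IsKahlerMetricOn g U) {y : Fin n → ℂ} (hy : y ∈ U) (i j : Fin n) :
    g y i j = (starRingEnd ℂ) (g y j i) :=
  ((hg.posDef y hy).isHermitian.apply i j).symm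

theorem anti_closed (hg : IsKahlerMetricOn g U) (hU : IsOpen U) {y : Fin n → ℂ} (hy : y ∈ U)
    (l i j : Fin n) : dAnti l (fun z => g z i j) y = dAnti j (fun z => g z i l) y := by
  have h1 : ∀ a b, (fun z => g z a b) =ᶠ[𝓝 y] fun z => (starRingEnd ℂ) (g z b a) := fun a b => by
    filter_upwards [hU.mem_nhds hy] with z hz
    exact hg.apply_eq_conj hz a b
  have h2 : ∀ a b c, dAnti c (fun z => g z a b) y =
      (starRingEnd ℂ) (dHol c (fun z => g z b a) y) := fun a b c => by
    rw [← dAnti_conj (hg.contDiffAt hU hy b a).eventually_differentiableAt.self_of_nhds, dAnti,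
      dAnti, (h1 a b).fderiv_eq]
  rw [h2, h2, hg.closed y hy]

end IsKahlerMetricOn

namespace IsHolomorphicFamily

variable {Φ : ℝ → (Fin n → ℂ) → (Fin n → ℂ)} {p : ℝ × (Fin n → ℂ)} (h : IsHolomorphicFamily Φ p)
  {g : (Fin n → ℂ) → Matrix (Fin n) (Fin n) ℂ} {U : Set (Fin n → ℂ)}

/-- The germ of the composition of a metric with the maps. -/
def metric (hg : IsKahlerMetricOn g U) (hU : IsOpen U) (hy : Φ p.1 p.2 ∈ U) :
    Matrix (Fin n) (Fin n) (smoothGerm p) :=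
  fun a b => h.comp (fun z => g z a b) (hg.contDiffAt hU hy a b)

theorem isKahlerAlong (hg : IsKahlerMetricOn g U) (hU : IsOpen U) (hy : Φ p.1 p.2 ∈ U) :
    (germWirtinger p).IsKahlerAlong h.coord h.coordBar (h.metric hg hU hy)
      (fun r a b => h.comp _ ((hg.contDiffAt hU hy a b).dHol r))
      (fun r a b => h.comp _ ((hg.contDiffAt hU hy a b).dAnti r)) := by
  have h1 : ∀ᶠ w : ℝ × (Fin n → ℂ) in 𝓝 p, Φ w.1 w.2 ∈ U :=
    h.contDiffAt.continuousAt.eventually (hU.mem_nhds hy)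
  refine ⟨h.anti_coord, h.hol_coordBar, fun r a b => ?_, fun r a b => ?_,
    fun i a b => h.hol_comp _ _ i, fun i a b => h.anti_comp _ _ i⟩
  · refine mk_eq_mk.mpr ?_
    filter_upwards [h1] with w hw
    exact hg.closed _ hw a b r
  · refine mk_eq_mk.mpr ?_
    filter_upwards [h1] with w hw
    exact hg.anti_closed hU hw r a b

theorem hasGerm_pullbackMetric (hg : IsKahlerMetricOn g U) (hU : IsOpen U) (hy : Φ p.1 p.2 ∈ U)
    (a b : Fin n) : HasGerm (fun τ z => pullbackMetric (Φ τ) g z a b)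
      ((germWirtinger p).pullback h.coord h.coordBar (h.metric hg hU hy) a b) := by
  unfold WirtingerStructure.pullback metric comp coord coordBar
  simp only [germWirtinger_hol_mk, germWirtinger_anti_mk, mk_mul, mk_sum]
  refine ⟨_, _, rfl, ?_⟩
  filter_upwards [h.sliceHol_eq, eventually_all.mpr fun i =>
    (h.smooth i).eventually_differentiableAt] with w hw hw'
  simp only [pullbackMetric, sliceAnti_conj (hw' _), hw]

theorem isClosed_pullback (hg : IsKahlerMetricOn g U) (hU : IsOpen U) (hy : Φ p.1 p.2 ∈ U) :
    (germWirtinger p).IsClosed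
      ((germWirtinger p).pullback h.coord h.coordBar (h.metric hg hU hy)) :=
  (h.isKahlerAlong hg hU hy).isClosed

theorem deriv_hol_comm (v : ℝ × (Fin n → ℂ)) (i : Fin n) (x : smoothGerm p) :
    smoothGerm.deriv p v ((germWirtinger p).hol i x) =
      (germWirtinger p).hol i (smoothGerm.deriv p v x) := by
  simp only [germWirtinger, Derivation.smul_apply, Derivation.add_apply, Derivation.map_smul,
    map_add]
  rw [deriv_comm v (0, Pi.single i 1), deriv_comm v (0, Pi.single i Complex.I)]

theorem deriv_anti_comm (v : ℝ × (Fin n → ℂ)) (i : Fin n) (x : smoothGerm p) :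
    smoothGerm.deriv p v ((germWirtinger p).anti i x) =
      (germWirtinger p).anti i (smoothGerm.deriv p v x) := by
  simp only [germWirtinger, Derivation.smul_apply, Derivation.add_apply, Derivation.map_smul,
    map_add]
  rw [deriv_comm v (0, Pi.single i 1), deriv_comm v (0, Pi.single i Complex.I)]

/-- `η` is the velocity of the family, expressed in the coordinates of the source. -/
structure IsVelocity (η ηbar : Fin n → smoothGerm p) : Prop where
  hol_eq : ∀ j, ∑ i, η i * (germWirtinger p).hol i (h.coord j) =
    smoothGerm.deriv p (1, 0) (h.coord j)
  anti_eq : ∀ j, ∑ i, ηbar i * (germWirtinger p).anti i (h.coordBar j) =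
    smoothGerm.deriv p (1, 0) (h.coordBar j)
  anti_eq_zero : ∀ i j, (germWirtinger p).anti i (η j) = 0
  hol_eq_zero : ∀ i j, (germWirtinger p).hol i (ηbar j) = 0
  eval_eq_zero : ∀ i, eval p (η i) = 0
  eval_bar_eq_zero : ∀ i, eval p (ηbar i) = 0
  eval_hol_eq_zero : ∀ i j, eval p ((germWirtinger p).hol i (η j)) = 0
  eval_anti_eq_zero : ∀ i j, eval p ((germWirtinger p).anti i (ηbar j)) = 0

variable {h} in
/-- The first variation of the graph expressions under pullback along a family of holomorphic maps
whose velocity vanishes to second order. -/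
theorem IsVelocity.hasDerivAt_jetEval {η ηbar : Fin n → smoothGerm p} (hη : h.IsVelocity η ηbar)
    (hg : IsKahlerMetricOn g U) (hU : IsOpen U) (hy : Φ p.1 p.2 ∈ U)
    (B : Matrix (Fin n) (Fin n) ℂ) {r q : ℕ} (s t : Fin q → Fin r) :
    HasDerivAt (fun τ => FinDigraph.jetEval
        (fun P Q => metricDeriv (pullbackMetric (Φ τ) g) P Q p.2) B s t)
      (FinDigraph.fieldSum (fun P Q => metricDeriv (pullbackMetric (Φ p.1) g) P Q p.2) B
          (fun c S => eval p ((germWirtinger p).holMulti S (η c))) s t +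
        FinDigraph.fieldSum (fun P Q => metricDeriv (pullbackMetric (Φ p.1) g) Q P p.2) B.transpose
          (fun c S => eval p ((germWirtinger p).antiMulti S (ηbar c))) t s) p.1 := by
  have hv := (h.isKahlerAlong hg hU hy).isVariation (deriv_hol_comm (1, 0))
    (deriv_anti_comm (1, 0)) (fun a b => h.deriv_comp _ _ _) hη.hol_eq hη.anti_eq
    hη.anti_eq_zero hη.hol_eq_zero
  refine FinDigraph.hasDerivAt_jetEval
    (J := fun τ P Q => metricDeriv (pullbackMetric (Φ τ) g) P Q p.2) B (fun S V a b => ?_) s t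
  have h1 := fun P Q => HasGerm.metricDeriv (h.hasGerm_pullbackMetric hg hU hy) P Q
  have h2 := (h1 (S.val.map a) (V.val.map b)).hasDerivAt
  rw [hv.map_apply_jet (eval p) hη.eval_eq_zero hη.eval_hol_eq_zero hη.eval_bar_eq_zero
    hη.eval_anti_eq_zero] at h2
  simp only [← (h1 _ _).eval_eq] at h2
  exact h2

end IsHolomorphicFamily

end Variation

namespace WirtingerStructure

/-- Existence of the velocity in a local differential algebra. -/
theorem exists_velocity {n : ℕ} {A : Type*} [CommRing A] [Algebra ℂ A] (W : WirtingerStructure n A)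
    {K : Type*} [Field K] (ev : A →+* K) (hev : ∀ x, ev x ≠ 0 → IsUnit x) {φ ψ : Fin n → A}
    (hφ : ∀ i j, W.anti i (φ j) = 0) (hψ : ∀ i j, W.anti i (ψ j) = 0)
    (hdet : (Matrix.of fun j i => ev (W.hol i (φ j))).det ≠ 0) (h0 : ∀ j, ev (ψ j) = 0)
    (h1 : ∀ i j, ev (W.hol i (ψ j)) = 0) :
    ∃ η : Fin n → A, (∀ j, ∑ i, η i * W.hol i (φ j) = ψ j) ∧ (∀ i j, W.anti i (η j) = 0) ∧
      (∀ i, ev (η i) = 0) ∧ ∀ i j, ev (W.hol i (η j)) = 0 := by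
  let X : Matrix (Fin n) (Fin n) A := Matrix.of fun j i => W.hol i (φ j)
  have hX : X.map ev = Matrix.of fun j i => ev (W.hol i (φ j)) := rfl
  have hunit : IsUnit X.det := by
    refine hev _ ?_
    rw [RingHom.map_det, RingHom.mapMatrix_apply, hX]
    exact hdet
  have heq : ∀ j, ∑ i, (X⁻¹.mulVec ψ) i * W.hol i (φ j) = ψ j := by
    intro j
    have h2 : X.mulVec (X⁻¹.mulVec ψ) = ψ := by
      rw [Matrix.mulVec_mulVec, Matrix.mul_nonsing_inv _ hunit, Matrix.one_mulVec]
    calc _ = ∑ i, X j i * X⁻¹.mulVec ψ i := Finset.sum_congr rfl fun i _ => mul_comm _ _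
      _ = ψ j := congrFun h2 j
  generalize X⁻¹.mulVec ψ = η at heq
  -- Homogeneous systems with the Jacobian as matrix have only the zero solution, over `A` and, in
  -- `hK`, after evaluation. For the differentiated equation this yields holomorphy of `η` and the
  -- vanishing of its 1-jet.
  have hA : ∀ ζ : Fin n → A, (∀ j, ∑ i, ζ i * W.hol i (φ j) = 0) → ζ = 0 := by
    intro ζ hζ
    have h2 : X.mulVec ζ = 0 := funext fun j => by
      rw [Pi.zero_apply, ← hζ j]
      change ∑ i, X j i * ζ i = _
      exact Finset.sum_congr rfl fun i _ => mul_comm _ _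
    have h3 : X⁻¹.mulVec (X.mulVec ζ) = ζ := by
      rw [Matrix.mulVec_mulVec, Matrix.nonsing_inv_mul _ hunit, Matrix.one_mulVec]
    rw [← h3, h2, Matrix.mulVec_zero]
  have hK : ∀ ζ : Fin n → K, (∀ j, ∑ i, ζ i * ev (W.hol i (φ j)) = 0) → ζ = 0 := by
    intro ζ hζ
    refine Matrix.eq_zero_of_mulVec_eq_zero hdet (funext fun j => ?_)
    rw [Pi.zero_apply, ← hζ j]
    change ∑ i, ev (W.hol i (φ j)) * ζ i = _
    exact Finset.sum_congr rfl fun i _ => mul_comm _ _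
  have hη0 : ∀ i, ev (η i) = 0 := by
    refine fun i => congrFun (hK (fun i => ev (η i)) fun j => ?_) i
    rw [← h0 j, ← heq j, map_sum]
    exact Finset.sum_congr rfl fun i _ => (map_mul _ _ _).symm
  refine ⟨η, heq, fun i j => ?_, hη0, fun i j => ?_⟩
  · refine congrFun (hA (fun j => W.anti i (η j)) fun j => ?_) j
    have h2 := congrArg (W.anti i) (heq j)
    rw [hψ, map_sum] at h2
    rw [← h2]
    refine Finset.sum_congr rfl fun k _ => ?_
    rw [Derivation.leibniz, ← W.hol_anti, hφ, map_zero, smul_zero, zero_add, smul_eq_mul, mul_comm]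
  · refine congrFun (hK (fun j => ev (W.hol i (η j))) fun j => ?_) j
    have h2 := congrArg (fun x => ev (W.hol i x)) (heq j)
    simp only [h1, map_sum] at h2
    rw [← h2]
    refine Finset.sum_congr rfl fun k _ => ?_
    rw [Derivation.leibniz, map_add, smul_eq_mul, smul_eq_mul, map_mul, map_mul, hη0, zero_mul,
      zero_add, mul_comm]

end WirtingerStructure

/-- It makes a Jacobian of germs invertible as soon as its value at the point is. -/
theorem smoothGerm.isUnit_of_eval_ne_zero {E : Type*} [NormedAddCommGroup E] [NormedSpace ℝ E]
    {p : E} (x : smoothGerm p) (hx : eval p x ≠ 0) : IsUnit x := by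
  obtain ⟨f, hf, rfl⟩ := exists_mk x
  rw [eval_mk] at hx
  refine IsUnit.of_mul_eq_one (mk (fun z => (f z)⁻¹) (hf.inv hx)) ?_
  rw [mk_mul]
  refine mk_eq_mk (hg := contDiffAt_const (c := 1)).mpr ?_
  filter_upwards [hf.continuousAt.eventually_ne hx] with z hz
  exact mul_inv_cancel₀ hz

end

/-! ### The first variation of a combination of digraphs -/

noncomputable section

open FinDigraph

theorem labelledSum_op (K N : ℕ) (Z : FinDigraph → ℂ) :
    labelledSum K N Z = labelledSum K N fun G => Z G.op := by
  unfold labelledSum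
  refine Finset.sum_congr rfl fun p _ => ?_
  rw [Finset.sum_comm]
  rfl

/-- The variation of a combination of digraphs in terms of its defects under contraction. -/
def defectSum {n : ℕ} (K N : ℕ) (Y : FinDigraph → ℂ)
    (J : Multiset (Fin n) → Multiset (Fin n) → ℂ) (B : Matrix (Fin n) (Fin n) ℂ)
    (ξ : Fin n → Multiset (Fin n) → ℂ) : ℂ :=
  ∑ p ∈ Finset.range N, labelWeight K p *
    ∑ v : Fin p, ∑ σ : Fin (K + p) → Fin (p + 1), ∑ t : Fin (K + p) → Fin p,
      if 2 ≤ (fiber σ 0).card then contractionDefect Y v σ t * expandTerm v σ t J B ξ else 0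

/-- No semistable digraph of weight `K` has `2 * K + 1` vertices, so there is no boundary term. -/
theorem IsDigraphFunction.labelledSum_eq_defectSum {n K : ℕ} {Y : FinDigraph → ℂ}
    (hY : IsDigraphFunction K Y) (J : Multiset (Fin n) → Multiset (Fin n) → ℂ)
    (B : Matrix (Fin n) (Fin n) ℂ) (ξ : Fin n → Multiset (Fin n) → ℂ)
    (hB : (Matrix.of fun a b => J {a} {b}) * B = 1) :
    labelledSum K (2 * K + 1) (fun G => Y G * fieldSum J B ξ G.src G.tgt) =
      defectSum K (2 * K + 1) Y J B ξ := by
  refine labelledSum_mul_fieldSum J B ξ (fun c a => ?_) Y hY.iso hY.loop K (2 * K + 1) fun s t => ?_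
  · have h := congrFun (congrFun hB c) a
    rwa [Matrix.one_apply] at h
  · by_contra h
    have h1 := (hY.semistable _ h).nV_le (K := K) rfl
    change 2 * K + 1 ≤ 2 * K at h1
    omega

theorem metricDeriv_singleton {n : ℕ} (g : (Fin n → ℂ) → Matrix (Fin n) (Fin n) ℂ) (a b : Fin n) :
    metricDeriv g {a} {b} = fun z => g z a b := by
  simp [metricDeriv, metricDerivList]

theorem hasDerivAt_labelledSum {K N : ℕ} {Z : ℝ → FinDigraph → ℂ} {Z' : FinDigraph → ℂ} {τ : ℝ}
    (h : ∀ (p q : ℕ) (s t : Fin q → Fin p), HasDerivAt (fun τ => Z τ ⟨p, q, s, t⟩)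
      (Z' ⟨p, q, s, t⟩) τ) :
    HasDerivAt (fun τ => labelledSum K N (Z τ)) (labelledSum K N Z') τ := by
  unfold labelledSum
  exact HasDerivAt.fun_sum fun p _ => HasDerivAt.const_mul _ (HasDerivAt.fun_sum fun s _ =>
    HasDerivAt.fun_sum fun t _ => h _ _ s t)

theorem labelledSum_add (K N : ℕ) (Z Z' : FinDigraph → ℂ) :
    labelledSum K N (fun G => Z G + Z' G) = labelledSum K N Z + labelledSum K N Z' := by
  simp only [labelledSum, Finset.sum_add_distrib, mul_add]

theorem FinDigraph.eval_mk {n p q : ℕ} (s t : Fin q → Fin p)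
    (g : (Fin n → ℂ) → Matrix (Fin n) (Fin n) ℂ) (z : Fin n → ℂ) :
    FinDigraph.eval ⟨p, q, s, t⟩ g z =
      jetEval (fun P Q => metricDeriv g P Q z) (g z)⁻¹ s t := rfl

theorem FinDigraph.op_mk {p q : ℕ} (s t : Fin q → Fin p) :
    FinDigraph.op ⟨p, q, s, t⟩ = ⟨p, q, t, s⟩ := rfl

open smoothGerm in
/-- The first variation of a combination of digraphs along a family of holomorphic maps whose
velocity vanishes to second order. -/
theorem IsHolomorphicFamily.IsVelocity.hasDerivAt_graphCombination {n K : ℕ}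
    {Φ : ℝ → (Fin n → ℂ) → (Fin n → ℂ)} {p : ℝ × (Fin n → ℂ)} {h : IsHolomorphicFamily Φ p}
    {g : (Fin n → ℂ) → Matrix (Fin n) (Fin n) ℂ} {U : Set (Fin n → ℂ)}
    {η ηbar : Fin n → smoothGerm p} (hη : h.IsVelocity η ηbar) (hg : IsKahlerMetricOn g U)
    (hU : IsOpen U) (hy : Φ p.1 p.2 ∈ U) {M : Matrix (Fin n) (Fin n) ℂ}
    (hM : ∀ τ, pullbackMetric (Φ τ) g p.2 = M) (hdet : IsUnit M.det)
    (c : StabClass (K : ℤ) → ℂ) :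
    HasDerivAt (fun τ => graphCombination n c (pullbackMetric (Φ τ) g) p.2)
      (defectSum K (2 * K + 1) (extendByZero c)
          (fun P Q => metricDeriv (pullbackMetric (Φ p.1) g) P Q p.2) M⁻¹
          (fun c S => smoothGerm.eval p ((germWirtinger p).holMulti S (η c))) +
        defectSum K (2 * K + 1) (fun G => extendByZero c G.op)
          (fun P Q => metricDeriv (pullbackMetric (Φ p.1) g) Q P p.2) M⁻¹.transpose
          (fun c S => smoothGerm.eval p ((germWirtinger p).antiMulti S (ηbar c)))) p.1 := by
  have hJ : (Matrix.of fun a b => metricDeriv (pullbackMetric (Φ p.1) g) {a} {b} p.2) = M := by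
    ext a b
    rw [Matrix.of_apply, metricDeriv_singleton]
    exact congrFun (congrFun (hM _) a) b
  rw [← (isDigraphFunction_extendByZero c).labelledSum_eq_defectSum,
    ← (isDigraphFunction_extendByZero_op c).labelledSum_eq_defectSum]
  -- The antiholomorphic half is the holomorphic one for the reversed digraphs and the transposed
  -- metric.
  · rw [labelledSum_op K _ fun G => extendByZero c G.op * _, ← labelledSum_add]
    simp only [graphCombination_eq_labelledSum (Nat.lt_succ_self (2 * K)) c]
    refine hasDerivAt_labelledSum fun r q s t => ?_
    simp only [eval_mk, op_mk, hM, ← mul_add]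
    exact (hη.hasDerivAt_jetEval hg hU hy M⁻¹ s t).const_mul (extendByZero c ⟨r, q, s, t⟩)
  · have h1 : (Matrix.of fun a b => metricDeriv (pullbackMetric (Φ p.1) g) {b} {a} p.2) =
        M.transpose := by
      rw [← hJ]
      rfl
    rw [h1, ← Matrix.transpose_mul, Matrix.nonsing_inv_mul _ hdet, Matrix.transpose_one]
  · rw [hJ, Matrix.mul_nonsing_inv _ hdet]

end

noncomputable section

/-! ### Metric jets under affine maps -/

section Affine

open Filter Topology smoothGerm

variable {n : ℕ}

theorem HasGerm.eventually_eq {p : ℝ × (Fin n → ℂ)} {u u' : ℝ → (Fin n → ℂ) → ℂ} {x : smoothGerm p}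
    (h : HasGerm u x) (h' : HasGerm u' x) : ∀ᶠ w in 𝓝 p, u w.1 w.2 = u' w.1 w.2 := by
  obtain ⟨f, hf, rfl, hu⟩ := h
  obtain ⟨f', hf', he, hu'⟩ := h'
  filter_upwards [hu, hu', mk_eq_mk.mp he] with w h1 h2 h3
  rw [h1, h2, h3]

theorem HasGerm.contDiffAt {p : ℝ × (Fin n → ℂ)} {u : (Fin n → ℂ) → ℂ} {x : smoothGerm p}
    (h : HasGerm (fun _ => u) x) : ContDiffAt ℝ ∞ u p.2 := by
  obtain ⟨f, hf, rfl, hu⟩ := h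
  have h3 : Tendsto (fun z : Fin n → ℂ => (p.1, z)) (𝓝 p.2) (𝓝 p) :=
    (Continuous.prodMk_right p.1).tendsto p.2
  refine ContDiffAt.congr_of_eventuallyEq (f := fun z => f (p.1, z)) ?_ (h3.eventually hu)
  exact ContDiffAt.comp p.2 (f := fun z : Fin n → ℂ => (p.1, z)) (g := f) hf
    (contDiffAt_const.prodMk contDiffAt_id)

theorem pullbackMetric_id (g : (Fin n → ℂ) → Matrix (Fin n) (Fin n) ℂ) :
    pullbackMetric (fun z => z) g = g := by
  funext z
  ext i j
  simp [pullbackMetric, Pi.single_apply]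

theorem isHolomorphicFamily_id (p : ℝ × (Fin n → ℂ)) :
    IsHolomorphicFamily (fun _ (z : Fin n → ℂ) => z) p where
  smooth i := ((contDiff_apply ℝ ℂ i).comp contDiff_snd).contDiffAt
  hol := Eventually.of_forall fun _ => differentiableAt_id

namespace IsKahlerMetricOn

variable {g : (Fin n → ℂ) → Matrix (Fin n) (Fin n) ℂ} {U : Set (Fin n → ℂ)}

/-- A single metric is its own pullback along the constant family of identity maps. -/
theorem exists_closed_germ (hg : IsKahlerMetricOn g U) (hU : IsOpen U) {y : Fin n → ℂ}
    (hy : y ∈ U) : ∃ h : Matrix (Fin n) (Fin n) (smoothGerm ((0 : ℝ), y)),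
      (germWirtinger ((0 : ℝ), y)).IsClosed h ∧
      ∀ P Q, HasGerm (fun _ => metricDeriv g P Q) ((germWirtinger ((0 : ℝ), y)).jet h P Q) := by
  have h1 := isHolomorphicFamily_id ((0 : ℝ), y)
  have h2 := h1.hasGerm_pullbackMetric hg hU hy
  rw [pullbackMetric_id] at h2
  exact ⟨_, h1.isClosed_pullback hg hU hy, fun P Q => HasGerm.metricDeriv h2 P Q⟩

theorem contDiffAt_metricDeriv (hg : IsKahlerMetricOn g U) (hU : IsOpen U) {y : Fin n → ℂ}
    (hy : y ∈ U) (P Q : Multiset (Fin n)) : ContDiffAt ℝ ∞ (metricDeriv g P Q) y := by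
  obtain ⟨h, -, h2⟩ := hg.exists_closed_germ hU hy
  exact (h2 P Q).contDiffAt

/-- `metricDeriv` sorts its indices, so the added index need not be the outermost derivative;
closedness makes the order immaterial. -/
theorem metricDeriv_cons_left (hg : IsKahlerMetricOn g U) (hU : IsOpen U) {y : Fin n → ℂ}
    (hy : y ∈ U) (c : Fin n) {P Q : Multiset (Fin n)} (hP : P ≠ 0) :
    metricDeriv g (c ::ₘ P) Q =ᶠ[𝓝 y] dHol c (metricDeriv g P Q) := by
  obtain ⟨h, h1, h2⟩ := hg.exists_closed_germ hU hy
  have h3 := (h2 P Q).dHol c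
  rw [← h1.jet_cons_left c hP] at h3
  have h4 : Tendsto (fun z : Fin n → ℂ => ((0 : ℝ), z)) (𝓝 y) (𝓝 ((0 : ℝ), y)) :=
    (Continuous.prodMk_right (0 : ℝ)).tendsto y
  exact h4.eventually ((h2 (c ::ₘ P) Q).eventually_eq h3)

theorem metricDeriv_cons_right (hg : IsKahlerMetricOn g U) (hU : IsOpen U) {y : Fin n → ℂ}
    (hy : y ∈ U) (c : Fin n) {P Q : Multiset (Fin n)} (hQ : Q ≠ 0) :
    metricDeriv g P (c ::ₘ Q) =ᶠ[𝓝 y] dAnti c (metricDeriv g P Q) := by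
  obtain ⟨h, h1, h2⟩ := hg.exists_closed_germ hU hy
  have h3 := (h2 P Q).dAnti c
  rw [← h1.jet_cons_right c hQ] at h3
  have h4 : Tendsto (fun z : Fin n → ℂ => ((0 : ℝ), z)) (𝓝 y) (𝓝 ((0 : ℝ), y)) :=
    (Continuous.prodMk_right (0 : ℝ)).tendsto y
  exact h4.eventually ((h2 P (c ::ₘ Q)).eventually_eq h3)

end IsKahlerMetricOn

theorem metricDeriv_zero_left (g : (Fin n → ℂ) → Matrix (Fin n) (Fin n) ℂ) (Q : Multiset (Fin n)) :
    metricDeriv g 0 Q = 0 := by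
  simp [metricDeriv, metricDerivList]

theorem metricDeriv_zero_right (g : (Fin n → ℂ) → Matrix (Fin n) (Fin n) ℂ) (P : Multiset (Fin n)) :
    metricDeriv g P 0 = 0 := by
  unfold metricDeriv
  rw [Multiset.sort_zero]
  cases P.sort (· ≤ ·) <;> rfl

theorem sum_fin_succ_arrow_cons {α M : Type*} [Fintype α] [AddCommMonoid M] {k : ℕ}
    (f : (Fin (k + 1) → α) → M) : ∑ a, f a = ∑ a : Fin k → α, ∑ i, f (Fin.cons i a) := by
  rw [FinDigraph.sum_fin_succ_arrow, Finset.sum_comm]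

theorem map_fin_cons {α : Type*} {k : ℕ} (i : α) (a : Fin k → α) :
    (Finset.univ : Finset (Fin (k + 1))).val.map (Fin.cons i a : Fin (k + 1) → α) =
      i ::ₘ (Finset.univ : Finset (Fin k)).val.map a := by
  rw [Fin.univ_succ, Finset.cons_val, Multiset.map_cons, Finset.map_val, Multiset.map_map]
  rfl

namespace IsHolomorphicFamily

variable {Φ : ℝ → (Fin n → ℂ) → (Fin n → ℂ)} {p : ℝ × (Fin n → ℂ)} (h : IsHolomorphicFamily Φ p)
  {g : (Fin n → ℂ) → Matrix (Fin n) (Fin n) ℂ} {U : Set (Fin n → ℂ)}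

/-- The germ of the composition of a derivative of the metric with the maps. -/
def jetComp (hg : IsKahlerMetricOn g U) (hU : IsOpen U) (hy : Φ p.1 p.2 ∈ U)
    (P Q : Multiset (Fin n)) : smoothGerm p :=
  h.comp (metricDeriv g P Q) (hg.contDiffAt_metricDeriv hU hy P Q)

variable (hg : IsKahlerMetricOn g U) (hU : IsOpen U) (hy : Φ p.1 p.2 ∈ U)

theorem comp_congr {u u' : (Fin n → ℂ) → ℂ} (hu : ContDiffAt ℝ ∞ u (Φ p.1 p.2))
    (hu' : ContDiffAt ℝ ∞ u' (Φ p.1 p.2)) (he : u =ᶠ[𝓝 (Φ p.1 p.2)] u') :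
    h.comp u hu = h.comp u' hu' :=
  mk_eq_mk.mpr (h.contDiffAt.continuousAt.eventually he)

theorem hol_jetComp (c : Fin n) {P Q : Multiset (Fin n)} (hP : P ≠ 0) :
    (germWirtinger p).hol c (h.jetComp hg hU hy P Q) =
      ∑ r, h.jetComp hg hU hy (r ::ₘ P) Q * (germWirtinger p).hol c (h.coord r) := by
  rw [jetComp, hol_comp]
  refine Finset.sum_congr rfl fun r _ => congrArg (· * _) ?_
  exact h.comp_congr _ _ (hg.metricDeriv_cons_left hU hy r hP).symm

theorem anti_jetComp (c : Fin n) {P Q : Multiset (Fin n)} (hQ : Q ≠ 0) :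
    (germWirtinger p).anti c (h.jetComp hg hU hy P Q) =
      ∑ r, h.jetComp hg hU hy P (r ::ₘ Q) * (germWirtinger p).anti c (h.coordBar r) := by
  rw [jetComp, anti_comp]
  refine Finset.sum_congr rfl fun r _ => congrArg (· * _) ?_
  exact h.comp_congr _ _ (hg.metricDeriv_cons_right hU hy r hQ).symm

theorem jetComp_zero_left (Q : Multiset (Fin n)) : h.jetComp hg hU hy 0 Q = 0 := by
  refine (h.comp_congr _ contDiffAt_const ?_).trans (b := h.comp (fun _ => 0) contDiffAt_const) rfl
  rw [metricDeriv_zero_left]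
  rfl

theorem jetComp_zero_right (P : Multiset (Fin n)) : h.jetComp hg hU hy P 0 = 0 := by
  refine (h.comp_congr _ contDiffAt_const ?_).trans (b := h.comp (fun _ => 0) contDiffAt_const) rfl
  rw [metricDeriv_zero_right]
  rfl

variable {L Lbar : Matrix (Fin n) (Fin n) ℂ}

/-- Jets of the pullback of a metric under an affine map. -/
theorem jet_pullback_affine
    (hL : ∀ r i, (germWirtinger p).hol i (h.coord r) = algebraMap ℂ _ (L r i))
    (hL' : ∀ r i, (germWirtinger p).anti i (h.coordBar r) = algebraMap ℂ _ (Lbar r i)) {k l : ℕ}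
    (a : Fin k → Fin n) (b : Fin l → Fin n) :
    (germWirtinger p).jet ((germWirtinger p).pullback h.coord h.coordBar (h.metric hg hU hy))
        (Finset.univ.val.map a) (Finset.univ.val.map b) =
      ∑ a' : Fin k → Fin n, ∑ b' : Fin l → Fin n, ((∏ e, L (a' e) (a e)) * ∏ e, Lbar (b' e) (b e)) •
        h.jetComp hg hU hy (Finset.univ.val.map a') (Finset.univ.val.map b') := by
  have hcl := h.isClosed_pullback hg hU hy
  set W := germWirtinger p
  set H := W.pullback h.coord h.coordBar (h.metric hg hU hy)
  rcases k with _ | k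
  -- Both sides vanish without unbarred or without barred indices. The induction therefore starts at
  -- one index of each kind, which is the pulled-back metric itself.
  · simp [WirtingerStructure.jet_zero_left, jetComp_zero_left]
  rcases l with _ | l
  · simp [WirtingerStructure.jet_zero_right, jetComp_zero_right]
  induction k with
  | zero =>
    induction l with
    | zero =>
      have h1 : ∀ c : Fin 1 → Fin n, (Finset.univ : Finset (Fin 1)).val.map c = {c 0} := fun c => rfl
      simp only [h1, hcl.jet_singleton]
      rw [← (Equiv.funUnique (Fin 1) (Fin n)).symm.sum_comp]
      refine Finset.sum_congr rfl fun i _ => ?_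
      rw [← (Equiv.funUnique (Fin 1) (Fin n)).symm.sum_comp]
      refine Finset.sum_congr rfl fun j _ => ?_
      have h2 : h.metric hg hU hy i j = h.jetComp hg hU hy {i} {j} :=
        h.comp_congr _ _ (by rw [metricDeriv_singleton])
      rw [hL, hL', h2, Algebra.smul_def]
      have h3 : ∀ f : Fin (0 + 1) → ℂ, ∏ e, f e = f 0 := fun f => Fin.prod_univ_one f
      simp only [h3, Equiv.funUnique_symm_apply, uniqueElim_const, map_mul]
      ring
    | succ l ih =>
      obtain ⟨c, b, rfl⟩ : ∃ c b', b = (Fin.cons c b' : Fin (l + 1 + 1) → Fin n) :=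
        ⟨b 0, Fin.tail b, (Fin.cons_self_tail b).symm⟩
      rw [map_fin_cons, hcl.jet_cons_right c (by simp [Fin.univ_succ]), ih, map_sum]
      refine Finset.sum_congr rfl fun a' _ => ?_
      rw [map_sum, sum_fin_succ_arrow_cons (k := l + 1)]
      refine Finset.sum_congr rfl fun b' _ => ?_
      rw [Derivation.map_smul, anti_jetComp _ _ _ _ _ (by simp [Fin.univ_succ]), Finset.smul_sum]
      refine Finset.sum_congr rfl fun i _ => ?_
      rw [map_fin_cons, Fin.prod_univ_succ (n := l + 1) (f := fun e => Lbar _ _), hL']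
      simp only [Fin.cons_zero, Fin.cons_succ, Algebra.smul_def, map_mul]
      ring
  | succ k ih =>
    obtain ⟨c, a, rfl⟩ : ∃ c a', a = (Fin.cons c a' : Fin (k + 1 + 1) → Fin n) :=
      ⟨a 0, Fin.tail a, (Fin.cons_self_tail a).symm⟩
    rw [map_fin_cons, hcl.jet_cons_left c (by simp [Fin.univ_succ]), ih, map_sum,
      sum_fin_succ_arrow_cons (k := k + 1)]
    refine Finset.sum_congr rfl fun a' _ => ?_
    rw [map_sum, Finset.sum_comm]
    refine Finset.sum_congr rfl fun b' _ => ?_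
    rw [Derivation.map_smul, hol_jetComp _ _ _ _ _ (by simp [Fin.univ_succ]), Finset.smul_sum]
    refine Finset.sum_congr rfl fun i _ => ?_
    rw [map_fin_cons, Fin.prod_univ_succ (n := k + 1) (f := fun e => L _ _), hL]
    simp only [Fin.cons_zero, Fin.cons_succ, Algebra.smul_def, map_mul]
    ring

end IsHolomorphicFamily

end Affine

end

noncomputable section

/-! ### Graph expressions under linear changes of coordinates -/

namespace FinDigraph

variable {n p q : ℕ}

/-- A labelling of the edges as a family of labellings of the fibers. -/
def fiberLabelEquiv {α : Type*} (s : Fin q → Fin p) :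
    (Fin q → α) ≃ ((v : Fin p) → {e // s e = v} → α) where
  toFun a _ e := a e.1
  invFun P e := P (s e) ⟨e, rfl⟩
  left_inv _ := rfl
  right_inv P := by
    funext v ⟨e, he⟩
    subst he
    rfl

theorem fiber_val_map {α : Type*} (s : Fin q → Fin p) (v : Fin p) (a : Fin q → α) :
    (fiber s v).val.map a = (Finset.univ : Finset {e // s e = v}).val.map fun e => a e.1 := by
  have h : fiber s v = (Finset.univ : Finset {e // s e = v}).map ⟨Subtype.val,
      Subtype.val_injective⟩ := by
    ext e
    simp
  rw [h, Finset.map_val, Multiset.map_map]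
  rfl

variable {J J' : Multiset (Fin n) → Multiset (Fin n) → ℂ} {L Lbar : Matrix (Fin n) (Fin n) ℂ}

/-- The edges at a vertex form a subtype and not some `Fin k`; the transformation law is carried
there along a bijection. -/
theorem jet_transform_fintype
    (hJ : ∀ (k l : ℕ) (a : Fin k → Fin n) (b : Fin l → Fin n),
      J' (Finset.univ.val.map a) (Finset.univ.val.map b) =
        ∑ a' : Fin k → Fin n, ∑ b' : Fin l → Fin n,
          ((∏ e, L (a' e) (a e)) * ∏ e, Lbar (b' e) (b e)) *
            J (Finset.univ.val.map a') (Finset.univ.val.map b'))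
    {α β : Type} [Fintype α] [Fintype β] [DecidableEq α] [DecidableEq β]
    (a : α → Fin n) (b : β → Fin n) :
    J' (Finset.univ.val.map a) (Finset.univ.val.map b) =
      ∑ a' : α → Fin n, ∑ b' : β → Fin n,
        ((∏ e, L (a' e) (a e)) * ∏ e, Lbar (b' e) (b e)) *
          J (Finset.univ.val.map a') (Finset.univ.val.map b') := by
  have hmap : ∀ {γ : Type} [Fintype γ] (c : γ → Fin n), (Finset.univ : Finset γ).val.map c =
      Finset.univ.val.map fun i => c ((Fintype.equivFin γ).symm i) := by
    intro γ _ c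
    rw [← Finset.map_univ_equiv (Fintype.equivFin γ).symm, Finset.map_val, Multiset.map_map]
    rfl
  rw [hmap a, hmap b, hJ]
  refine (Fintype.sum_equiv ((Fintype.equivFin α).arrowCongr (Equiv.refl _)) _ _ fun a' => ?_).symm
  refine Fintype.sum_equiv ((Fintype.equivFin β).arrowCongr (Equiv.refl _)) _ _ fun b' => ?_
  rw [hmap a', hmap b']
  refine congrArg₂ _ (congrArg₂ _ ?_ ?_) rfl
  · exact Fintype.prod_equiv (Fintype.equivFin α) _ _ fun e => by simp
  · exact Fintype.prod_equiv (Fintype.equivFin β) _ _ fun e => by simp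

theorem sum_sum_prod {R : Type*} [CommSemiring R] {κ : Type*} [Fintype κ] [DecidableEq κ]
    {α β : κ → Type*} [∀ v, Fintype (α v)] [∀ v, Fintype (β v)] (f : ∀ v, α v → β v → R) :
    ∑ a : (v : κ) → α v, ∑ b : (v : κ) → β v, ∏ v, f v (a v) (b v) =
      ∏ v, ∑ i : α v, ∑ j : β v, f v i j := by
  classical
  rw [Finset.prod_univ_sum, Fintype.piFinset_univ]
  refine Finset.sum_congr rfl fun a _ => ?_
  rw [Finset.prod_univ_sum, Fintype.piFinset_univ]

theorem sum_comm_four {R : Type*} [AddCommMonoid R] {α β : Type*} [Fintype α] [Fintype β]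
    (f : α → α → β → β → R) :
    ∑ a, ∑ b, ∑ c, ∑ d, f a b c d = ∑ c, ∑ d, ∑ a, ∑ b, f a b c d := by
  calc _ = ∑ a, ∑ c, ∑ d, ∑ b, f a b c d := by
        refine Finset.sum_congr rfl fun a _ => ?_
        rw [Finset.sum_comm]
        exact Finset.sum_congr rfl fun c _ => Finset.sum_comm
    _ = _ := by
        rw [Finset.sum_comm]
        exact Finset.sum_congr rfl fun c _ => Finset.sum_comm

/-- Invariance of `jetEval` under linear coordinate changes. -/
theorem jetEval_transform
    (hJ : ∀ (k l : ℕ) (a : Fin k → Fin n) (b : Fin l → Fin n),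
      J' (Finset.univ.val.map a) (Finset.univ.val.map b) =
        ∑ a' : Fin k → Fin n, ∑ b' : Fin l → Fin n,
          ((∏ e, L (a' e) (a e)) * ∏ e, Lbar (b' e) (b e)) *
            J (Finset.univ.val.map a') (Finset.univ.val.map b'))
    {B B' : Matrix (Fin n) (Fin n) ℂ} (hB : Lbar * B' * L.transpose = B) (s t : Fin q → Fin p) :
    jetEval J' B' s t = jetEval J B s t := by
  -- Every edge has one tail and one head, so the factors produced at the vertices amount to one
  -- entry of `L` and one of `Lbar` per edge; `h2` absorbs them in the inverse metric on that edge.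
  have h1 : ∀ a b : Fin q → Fin n,
      ∏ v, J' ((fiber s v).val.map a) ((fiber t v).val.map b) =
        ∑ a' : Fin q → Fin n, ∑ b' : Fin q → Fin n,
          ((∏ e, L (a' e) (a e)) * ∏ e, Lbar (b' e) (b e)) *
            ∏ v, J ((fiber s v).val.map a') ((fiber t v).val.map b') := by
    intro a b
    simp only [fiber_val_map, jet_transform_fintype hJ]
    rw [← sum_sum_prod, ← (fiberLabelEquiv s).sum_comp]
    refine Finset.sum_congr rfl fun a' _ => ?_
    rw [← (fiberLabelEquiv t).sum_comp]
    refine Finset.sum_congr rfl fun b' _ => ?_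
    rw [Finset.prod_mul_distrib, Finset.prod_mul_distrib]
    refine congrArg₂ _ (congrArg₂ _ ?_ ?_) rfl
    · exact Fintype.prod_fiberwise s fun e => L (a' e) (a e)
    · exact Fintype.prod_fiberwise t fun e => Lbar (b' e) (b e)
  have h2 : ∀ i j, ∑ i', ∑ j', B' j' i' * (L i i' * Lbar j j') = B j i := by
    intro i j
    rw [← hB, Matrix.mul_apply]
    refine Finset.sum_congr rfl fun i' _ => ?_
    rw [Matrix.mul_apply, Finset.sum_mul]
    refine Finset.sum_congr rfl fun j' _ => ?_
    rw [Matrix.transpose_apply]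
    ring
  unfold jetEval
  simp only [h1, Finset.mul_sum]
  calc _ = ∑ a' : Fin q → Fin n, ∑ b' : Fin q → Fin n, ∑ a : Fin q → Fin n, ∑ b : Fin q → Fin n,
        (∏ e, B' (b e) (a e) * (L (a' e) (a e) * Lbar (b' e) (b e))) *
          ∏ v, J ((fiber s v).val.map a') ((fiber t v).val.map b') := by
        rw [sum_comm_four]
        simp only [Finset.prod_mul_distrib, mul_assoc]
    _ = _ := by
        refine Finset.sum_congr rfl fun a' _ => Finset.sum_congr rfl fun b' _ => ?_
        simp only [← Finset.sum_mul]
        congr 1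
        rw [sum_sum_prod fun e i j => B' j i * (L (a' e) i * Lbar (b' e) j)]
        exact Finset.prod_congr rfl fun e _ => h2 _ _

end FinDigraph

end

noncomputable section

/-! ### Weyl functions give invariants -/

section Invariance

open Filter Topology smoothGerm

variable {n : ℕ}

/-- Joint smoothness in the parameter and the point rests on the smoothness of holomorphic
functions, `DifferentiableOn.contDiffOn_of_isOpen`. -/
theorem isHolomorphicFamily_add_smul {α ψ : (Fin n → ℂ) → (Fin n → ℂ)} {V : Set (Fin n → ℂ)}
    (hα : DifferentiableOn ℂ α V) (hψ : DifferentiableOn ℂ ψ V) (hV : IsOpen V)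
    {p : ℝ × (Fin n → ℂ)} (hp : p.2 ∈ V) :
    IsHolomorphicFamily (fun τ z => α z + (τ : ℂ) • ψ z) p where
  smooth i := by
    have h1 : ∀ f : (Fin n → ℂ) → (Fin n → ℂ), DifferentiableOn ℂ f V →
        ContDiffAt ℝ ∞ (fun w : ℝ × (Fin n → ℂ) => f w.2 i) p := by
      intro f hf
      have h2 : ContDiffAt ℝ ∞ f p.2 :=
        ((hf.contDiffOn_of_isOpen hV).contDiffAt (hV.mem_nhds hp)).restrict_scalars ℝ
      exact contDiffAt_pi.mp (ContDiffAt.comp p (f := fun w : ℝ × (Fin n → ℂ) => w.2) (g := f) h2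
        contDiffAt_snd) i
    have h3 : ContDiffAt ℝ ∞ (fun w : ℝ × (Fin n → ℂ) => (w.1 : ℂ)) p :=
      (Complex.ofRealCLM.contDiff.comp contDiff_fst).contDiffAt
    exact (h1 α hα).add (h3.mul (h1 ψ hψ))
  hol := by
    have h1 : ∀ᶠ w : ℝ × (Fin n → ℂ) in 𝓝 p, w.2 ∈ V :=
      continuousAt_snd.eventually (hV.mem_nhds hp)
    filter_upwards [h1] with w hw
    exact ((hα w.2 hw).differentiableAt (hV.mem_nhds hw)).fun_add
      (((hψ w.2 hw).differentiableAt (hV.mem_nhds hw)).fun_const_smul _)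

namespace IsHolomorphicFamily

variable {Φ : ℝ → (Fin n → ℂ) → (Fin n → ℂ)} {p : ℝ × (Fin n → ℂ)} (h : IsHolomorphicFamily Φ p)

theorem hasGerm_coord (j : Fin n) : HasGerm (fun τ z => Φ τ z j) (h.coord j) :=
  ⟨_, h.smooth j, rfl, Eventually.of_forall fun _ => rfl⟩

theorem hasGerm_coordBar (j : Fin n) :
    HasGerm (fun τ z => (starRingEnd ℂ) (Φ τ z j)) (h.coordBar j) :=
  ⟨_, h.smooth_conj j, rfl, Eventually.of_forall fun _ => rfl⟩

theorem eval_hol_coord (i j : Fin n) :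
    smoothGerm.eval p ((germWirtinger p).hol i (h.coord j)) =
      fderiv ℂ (Φ p.1) p.2 (Pi.single i 1) j := by
  rw [coord, germWirtinger_hol_mk, eval_mk]
  exact h.sliceHol_eq.self_of_nhds j i

theorem eval_anti_coordBar (i j : Fin n) :
    smoothGerm.eval p ((germWirtinger p).anti i (h.coordBar j)) =
      (starRingEnd ℂ) (fderiv ℂ (Φ p.1) p.2 (Pi.single i 1) j) := by
  rw [coordBar, germWirtinger_anti_mk, eval_mk,
    sliceAnti_conj (h.smooth j).eventually_differentiableAt.self_of_nhds]
  exact congrArg _ (h.sliceHol_eq.self_of_nhds j i)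

/-- A family with constant 1-jets along `p.2` has a velocity that vanishes to second order. -/
theorem exists_isVelocity (h' : ∀ τ, IsHolomorphicFamily Φ (τ, p.2)) {y : Fin n → ℂ}
    (hy : ∀ τ, Φ τ p.2 = y) {L : Matrix (Fin n) (Fin n) ℂ}
    (hL : ∀ τ i j, fderiv ℂ (Φ τ) p.2 (Pi.single i 1) j = L j i) (hdet : L.det ≠ 0) :
    ∃ η ηbar, h.IsVelocity η ηbar := by
  -- Applied to the value and the first derivatives of the family at the point, which do not depend
  -- on the parameter, this shows that the time derivative of the family has zero 1-jet there.
  have hz : ∀ {f : ℝ → ℂ} {c d : ℂ}, HasDerivAt f d p.1 → (∀ τ, f τ = c) → d = 0 := by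
    intro f c d hf hc
    have h1 : f = fun _ => c := funext hc
    rw [h1] at hf
    exact hf.unique (hasDerivAt_const _ _)
  have hd : ∀ i j τ, dHol i (fun z => Φ τ z j) p.2 = L j i := by
    intro i j τ
    rw [← hL τ, ← (h' τ).eval_hol_coord]
    exact (((h' τ).hasGerm_coord j).dHol i).eval_eq
  have hd' : ∀ i j τ, dAnti i (fun z => (starRingEnd ℂ) (Φ τ z j)) p.2 =
      (starRingEnd ℂ) (L j i) := by
    intro i j τ
    rw [← hL τ, ← (h' τ).eval_anti_coordBar]
    exact (((h' τ).hasGerm_coordBar j).dAnti i).eval_eq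
  obtain ⟨η, h1, h2, h3, h4⟩ := (germWirtinger p).exists_velocity (smoothGerm.eval p)
    isUnit_of_eval_ne_zero (φ := h.coord) (ψ := fun j => smoothGerm.deriv p (1, 0) (h.coord j))
    h.anti_coord (fun i j => by rw [← deriv_anti_comm, h.anti_coord, map_zero])
    (by
      simp only [h.eval_hol_coord, hL]
      exact hdet)
    (fun j => hz (h.hasGerm_coord j).hasDerivAt fun τ => congrFun (hy τ) j)
    (fun i j => by
      rw [← deriv_hol_comm]
      exact hz ((h.hasGerm_coord j).dHol i).hasDerivAt (hd i j))
  obtain ⟨ηbar, h1', h2', h3', h4'⟩ := (germWirtinger p).swap.exists_velocity (smoothGerm.eval p)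
    isUnit_of_eval_ne_zero (φ := h.coordBar)
    (ψ := fun j => smoothGerm.deriv p (1, 0) (h.coordBar j))
    h.hol_coordBar (fun i j => (by
      rw [← deriv_hol_comm, h.hol_coordBar, map_zero] :
      (germWirtinger p).hol i (smoothGerm.deriv p (1, 0) (h.coordBar j)) = 0))
    (by
      have h5 : (Matrix.of fun j i => smoothGerm.eval p ((germWirtinger p).swap.hol i
          (h.coordBar j))) = L.map (starRingEnd ℂ) := by
        ext j i
        rw [Matrix.of_apply, Matrix.map_apply, ← hL p.1]
        exact h.eval_anti_coordBar i j
      rw [h5, ← RingHom.mapMatrix_apply, ← RingHom.map_det]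
      exact (map_ne_zero _).mpr hdet)
    (fun j => hz (h.hasGerm_coordBar j).hasDerivAt fun τ =>
      congrArg (starRingEnd ℂ) (congrFun (hy τ) j))
    (fun i j => (by
      rw [← deriv_anti_comm]
      exact hz ((h.hasGerm_coordBar j).dAnti i).hasDerivAt (hd' i j) :
      smoothGerm.eval p ((germWirtinger p).anti i
        (smoothGerm.deriv p (1, 0) (h.coordBar j))) = 0))
  exact ⟨η, ηbar, ⟨h1, h1', h2, h2', h3, h3', h4, h4'⟩⟩

end IsHolomorphicFamily

/-- The affine map `z ↦ y + L (z - x)`. -/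
def affineMap (x y : Fin n → ℂ) (L : Matrix (Fin n) (Fin n) ℂ) (z : Fin n → ℂ) : Fin n → ℂ :=
  y + L.mulVec (z - x)

theorem hasFDerivAt_affineMap (x y : Fin n → ℂ) (L : Matrix (Fin n) (Fin n) ℂ) (z : Fin n → ℂ) :
    HasFDerivAt (affineMap x y L) (LinearMap.toContinuousLinearMap L.mulVecLin) z := by
  have h1 := (LinearMap.toContinuousLinearMap L.mulVecLin).hasFDerivAt (x := z - x)
  exact (h1.comp z ((hasFDerivAt_id z).sub_const x)).const_add y

theorem fderiv_affineMap_apply (x y : Fin n → ℂ) (L : Matrix (Fin n) (Fin n) ℂ) (z : Fin n → ℂ)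
    (i j : Fin n) : fderiv ℂ (affineMap x y L) z (Pi.single i 1) j = L j i := by
  rw [(hasFDerivAt_affineMap x y L z).fderiv]
  simp

theorem pullbackMetric_of_fderiv {φ : (Fin n → ℂ) → (Fin n → ℂ)} {x : Fin n → ℂ}
    {L : Matrix (Fin n) (Fin n) ℂ} (h : ∀ i j, fderiv ℂ φ x (Pi.single i 1) j = L j i)
    (g : (Fin n → ℂ) → Matrix (Fin n) (Fin n) ℂ) :
    pullbackMetric φ g x = L.transpose * g (φ x) * L.map (starRingEnd ℂ) := by
  ext i j
  simp only [pullbackMetric, h, Matrix.mul_apply, Matrix.transpose_apply, Matrix.map_apply,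
    Finset.sum_mul]
  rw [Finset.sum_comm]
  exact Finset.sum_congr rfl fun q _ => Finset.sum_congr rfl fun p _ => by ring

variable {g : (Fin n → ℂ) → Matrix (Fin n) (Fin n) ℂ} {U : Set (Fin n → ℂ)}

/-- Second derivatives of an affine map vanish, so all jets of the metric transform as tensors. -/
theorem FinDigraph.eval_pullback_affine (hg : IsKahlerMetricOn g U) (hU : IsOpen U)
    {x y : Fin n → ℂ} (hy : y ∈ U) {L : Matrix (Fin n) (Fin n) ℂ} (hL : L.det ≠ 0)
    (G : FinDigraph) : G.eval (pullbackMetric (affineMap x y L) g) x = G.eval g y := by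
  obtain ⟨r, q, s, t⟩ := G
  have hx : affineMap x y L x = y := by simp [affineMap]
  have hdiff : Differentiable ℂ (affineMap x y L) := fun z =>
    (hasFDerivAt_affineMap x y L z).differentiableAt
  have h : IsHolomorphicFamily (fun _ => affineMap x y L) ((0 : ℝ), x) := by
    have h1 := isHolomorphicFamily_add_smul hdiff.differentiableOn
      (differentiableOn_const (0 : Fin n → ℂ)) isOpen_univ (p := ((0 : ℝ), x)) (Set.mem_univ _)
    simpa using h1
  have hy' : affineMap x y L x ∈ U := hx.symm ▸ hy
  have hhol : ∀ r i, (germWirtinger ((0 : ℝ), x)).hol i (h.coord r) = algebraMap ℂ _ (L r i) := by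
    intro r i
    rw [IsHolomorphicFamily.coord, germWirtinger_hol_mk]
    refine mk_eq_mk (hg := contDiffAt_const).mpr ?_
    filter_upwards [h.sliceHol_eq] with w hw
    rw [hw, fderiv_affineMap_apply]
  have hanti : ∀ r i, (germWirtinger ((0 : ℝ), x)).anti i (h.coordBar r) =
      algebraMap ℂ _ (L.map (starRingEnd ℂ) r i) := by
    intro r i
    rw [IsHolomorphicFamily.coordBar, germWirtinger_anti_mk]
    refine mk_eq_mk (hg := contDiffAt_const).mpr ?_
    filter_upwards [h.sliceHol_eq, (h.smooth r).eventually_differentiableAt] with w hw hw'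
    rw [sliceAnti_conj hw', hw, fderiv_affineMap_apply]
    rfl
  rw [eval_mk, eval_mk]
  refine jetEval_transform (L := L) (Lbar := L.map (starRingEnd ℂ)) (fun k l a b => ?_) ?_ s t
  · have h1 := HasGerm.metricDeriv (h.hasGerm_pullbackMetric hg hU hy') (Finset.univ.val.map a)
      (Finset.univ.val.map b)
    have h2 := h1.eval_eq
    rw [h.jet_pullback_affine hg hU hy' hhol hanti] at h2
    refine h2.trans ?_
    simp only [map_sum, Algebra.smul_def, map_mul]
    refine Finset.sum_congr rfl fun a' _ => Finset.sum_congr rfl fun b' _ => ?_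
    refine congrArg₂ _ ?_ (congrArg _ hx)
    rw [← map_mul, ← map_mul]
    rfl
  · rw [pullbackMetric_of_fderiv (fun i j => fderiv_affineMap_apply x y L x i j), hx,
      Matrix.mul_inv_rev, Matrix.mul_inv_rev]
    have h1 : IsUnit (L.map (starRingEnd ℂ)).det := by
      rw [← RingHom.mapMatrix_apply, ← RingHom.map_det]
      exact (isUnit_iff_ne_zero.mpr hL).map _
    have h2 : IsUnit L.transpose.det := by
      rw [Matrix.det_transpose]
      exact isUnit_iff_ne_zero.mpr hL
    rw [← Matrix.mul_assoc, Matrix.mul_nonsing_inv _ h1, Matrix.one_mul, Matrix.mul_assoc,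
      Matrix.nonsing_inv_mul _ h2, Matrix.mul_one]

theorem graphCombination_pullback_affine (hg : IsKahlerMetricOn g U) (hU : IsOpen U)
    {x y : Fin n → ℂ} (hy : y ∈ U) {L : Matrix (Fin n) (Fin n) ℂ} (hL : L.det ≠ 0) {K : ℕ}
    (c : StabClass (K : ℤ) → ℂ) :
    graphCombination n c (pullbackMetric (affineMap x y L) g) x = graphCombination n c g y := by
  simp only [graphCombination_eq_labelledSum (Nat.lt_succ_self (2 * K)) c,
    FinDigraph.eval_pullback_affine hg hU hy hL]

theorem defectSum_eq_zero {K N : ℕ} {Y : FinDigraph → ℂ}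
    (hY : ∀ (p : ℕ) (v : Fin p) (σ : Fin (K + p) → Fin (p + 1)) (t : Fin (K + p) → Fin p),
      2 ≤ (FinDigraph.fiber σ 0).card → contractionDefect Y v σ t = 0)
    (J : Multiset (Fin n) → Multiset (Fin n) → ℂ) (B : Matrix (Fin n) (Fin n) ℂ)
    (ξ : Fin n → Multiset (Fin n) → ℂ) : defectSum K N Y J B ξ = 0 := by
  unfold defectSum
  refine Finset.sum_eq_zero fun p _ => mul_eq_zero_of_right _ ?_
  refine Finset.sum_eq_zero fun v _ => Finset.sum_eq_zero fun σ _ =>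
    Finset.sum_eq_zero fun t _ => ?_
  split_ifs with h
  · rw [hY p v σ t h, zero_mul]
  · rfl

/-- Combinations whose coefficients depend only on the stabilization graph are invariant. -/
theorem IsWeylFunction.isWeylInvariant {K : ℕ} {c : StabClass (K : ℤ) → ℂ} (hc : IsWeylFunction c)
    (n : ℕ) : IsWeylInvariant n (graphCombination n c) := by
  intro φ hφ hφ' g hg x hx
  have hU := φ.open_target
  have hV := φ.open_source
  have hy := φ.map_source hx
  have hφx : HasFDerivAt φ (fderiv ℂ φ x) x :=
    ((hφ x hx).differentiableAt (hV.mem_nhds hx)).hasFDerivAt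
  let L : Matrix (Fin n) (Fin n) ℂ := LinearMap.toMatrix' (fderiv ℂ φ x).toLinearMap
  have hLapp : ∀ i j, fderiv ℂ φ x (Pi.single i 1) j = L j i := fun i j => by
    simp [L, LinearMap.toMatrix'_apply]
  have hLdet : L.det ≠ 0 := by
    have h1 : HasFDerivAt φ.symm (fderiv ℂ φ.symm (φ x)) (φ x) :=
      ((hφ' _ hy).differentiableAt (hU.mem_nhds hy)).hasFDerivAt
    have h2 : HasFDerivAt (φ.symm ∘ φ) (ContinuousLinearMap.id ℂ (Fin n → ℂ)) x := by
      refine (hasFDerivAt_id x).congr_of_eventuallyEq ?_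
      filter_upwards [hV.mem_nhds hx] with z hz
      exact φ.left_inv hz
    have h3 := (h1.comp x hφx).unique h2
    have h4 : LinearMap.toMatrix' (fderiv ℂ φ.symm (φ x)).toLinearMap * L = 1 := by
      rw [← LinearMap.toMatrix'_comp, ← LinearMap.toMatrix'_id]
      exact congrArg (fun f : (Fin n → ℂ) →L[ℂ] (Fin n → ℂ) => LinearMap.toMatrix' f.toLinearMap) h3
    intro h5
    have h6 := congrArg Matrix.det h4
    rw [Matrix.det_mul, h5, mul_zero, Matrix.det_one] at h6
    exact zero_ne_one h6
  let ℓ := affineMap x (φ x) L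
  have hℓx : ℓ x = φ x := by simp [ℓ, affineMap]
  have hℓ : Differentiable ℂ ℓ := fun z => (hasFDerivAt_affineMap x (φ x) L z).differentiableAt
  -- The segment from the affine part of `φ` at `x` to `φ`. All its maps have the same 1-jet at `x`,
  -- so the Jacobian there stays invertible and the pulled-back metric at `x` stays constant.
  let Φ : ℝ → (Fin n → ℂ) → (Fin n → ℂ) := fun τ z => ℓ z + (τ : ℂ) • (φ z - ℓ z)
  have hfam : ∀ τ, IsHolomorphicFamily Φ (τ, x) := fun τ =>
    isHolomorphicFamily_add_smul hℓ.differentiableOn (hφ.sub hℓ.differentiableOn) hV hx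
  have hΦx : ∀ τ, Φ τ x = φ x := fun τ => by
    simp only [Φ, hℓx, sub_self, smul_zero, add_zero]
  have hΦL : ∀ τ i j, fderiv ℂ (Φ τ) x (Pi.single i 1) j = L j i := by
    intro τ i j
    have h1 : HasFDerivAt (Φ τ) _ x := (hasFDerivAt_affineMap x (φ x) L x).add
      ((hφx.sub (hasFDerivAt_affineMap x (φ x) L x)).const_smul (τ : ℂ))
    rw [h1.fderiv]
    have h2 := fderiv_affineMap_apply x (φ x) L x i j
    rw [(hasFDerivAt_affineMap x (φ x) L x).fderiv] at h2
    simp only [add_apply, smul_apply,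
      sub_apply, Pi.add_apply, Pi.smul_apply, Pi.sub_apply, h2, hLapp, sub_self,
      smul_zero, add_zero]
  have hM : ∀ τ, pullbackMetric (Φ τ) g x =
      L.transpose * g (φ x) * L.map (starRingEnd ℂ) := fun τ => by
    rw [pullbackMetric_of_fderiv (hΦL τ), hΦx]
  have hMdet : IsUnit (L.transpose * g (φ x) * L.map (starRingEnd ℂ)).det := by
    rw [Matrix.det_mul, Matrix.det_mul, Matrix.det_transpose, ← RingHom.mapMatrix_apply,
      ← RingHom.map_det]
    have h1 : (g (φ x)).det ≠ 0 := (hg.posDef _ hy).det_pos.ne'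
    exact isUnit_iff_ne_zero.mpr (mul_ne_zero (mul_ne_zero hLdet h1) ((map_ne_zero _).mpr hLdet))
  have hderiv : ∀ τ, HasDerivAt (fun τ => graphCombination n c (pullbackMetric (Φ τ) g) x) 0 τ := by
    intro τ
    obtain ⟨η, ηbar, hη⟩ := (hfam τ).exists_isVelocity hfam hΦx hΦL hLdet
    have h1 := hη.hasDerivAt_graphCombination hg hU (by rw [hΦx]; exact hy) hM hMdet c
    rwa [defectSum_eq_zero fun p v σ t hσ => (hc.defect_eq_zero hσ).1,
      defectSum_eq_zero fun p v σ t hσ => (hc.defect_eq_zero hσ).2, add_zero] at h1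
  have hconst := is_const_of_deriv_eq_zero (fun τ => (hderiv τ).differentiableAt)
    (fun τ => (hderiv τ).deriv) 1 0
  have h1 : Φ 1 = φ := by
    funext z
    simp [Φ]
  have h0 : Φ 0 = ℓ := by
    funext z
    simp [Φ]
  simp only [h1, h0] at hconst
  rw [hconst]
  exact graphCombination_pullback_affine hg hU hy hLdet c

end Invariance

end

noncomputable section

/-! ### Derivatives of squarefree monomials -/

section Monomials

open Filter Topology smoothGerm

variable {n : ℕ}

/-- The germ of the coordinate function `z_i`. -/
def zGerm (p : ℝ × (Fin n → ℂ)) (i : Fin n) : smoothGerm p := (isHolomorphicFamily_id p).coord i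

/-- The germ of the conjugate coordinate function `z̄_i`. -/
def zbarGerm (p : ℝ × (Fin n → ℂ)) (i : Fin n) : smoothGerm p :=
  (isHolomorphicFamily_id p).coordBar i

variable {p : ℝ × (Fin n → ℂ)}

theorem hol_zGerm (i j : Fin n) :
    (germWirtinger p).hol i (zGerm p j) = if j = i then 1 else 0 := by
  rw [zGerm, IsHolomorphicFamily.coord, germWirtinger_hol_mk]
  have h1 : (if j = i then 1 else 0 : smoothGerm p) =
      mk (fun _ => if j = i then 1 else 0) contDiffAt_const := by
    split_ifs <;> rfl
  rw [h1, mk_eq_mk]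
  filter_upwards [(isHolomorphicFamily_id p).sliceHol_eq] with w hw
  rw [hw]
  simp [Pi.single_apply]

theorem anti_zGerm (i j : Fin n) : (germWirtinger p).anti i (zGerm p j) = 0 :=
  (isHolomorphicFamily_id p).anti_coord i j

theorem hol_zbarGerm (i j : Fin n) : (germWirtinger p).hol i (zbarGerm p j) = 0 :=
  (isHolomorphicFamily_id p).hol_coordBar i j

theorem anti_zbarGerm (i j : Fin n) :
    (germWirtinger p).anti i (zbarGerm p j) = if j = i then 1 else 0 := by
  rw [zbarGerm, IsHolomorphicFamily.coordBar, germWirtinger_anti_mk]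
  have h1 : (if j = i then 1 else 0 : smoothGerm p) =
      mk (fun _ => if j = i then 1 else 0) contDiffAt_const := by
    split_ifs <;> rfl
  rw [h1, mk_eq_mk]
  filter_upwards [(isHolomorphicFamily_id p).sliceHol_eq,
    ((isHolomorphicFamily_id p).smooth j).eventually_differentiableAt] with w hw hw'
  rw [sliceAnti_conj hw', hw]
  by_cases h : j = i <;> simp [h]

theorem eval_zGerm (i : Fin n) : smoothGerm.eval p (zGerm p i) = p.2 i := rfl

theorem eval_zbarGerm (i : Fin n) :
    smoothGerm.eval p (zbarGerm p i) = (starRingEnd ℂ) (p.2 i) := rfl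

end Monomials

namespace WirtingerStructure

variable {n : ℕ} {A : Type*} [CommRing A] [Algebra ℂ A] {W : WirtingerStructure n A}
  {Z : Fin n → A}

theorem derivation_multiset_prod_eq_zero (D : Derivation ℂ A A) {S : Multiset A}
    (h : ∀ x ∈ S, D x = 0) : D S.prod = 0 := by
  induction S using Multiset.induction with
  | empty => simp
  | cons x S ih =>
    rw [Multiset.prod_cons, Derivation.leibniz, h x (Multiset.mem_cons_self _ _),
      ih fun y hy => h y (Multiset.mem_cons_of_mem hy), smul_zero, smul_zero, add_zero]

theorem hol_prod (hZ : ∀ i j, W.hol i (Z j) = if j = i then 1 else 0) {S : Multiset (Fin n)}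
    (hS : S.Nodup) (c : Fin n) :
    W.hol c (S.map Z).prod = if c ∈ S then ((S.erase c).map Z).prod else 0 := by
  have h0 : ∀ {S : Multiset (Fin n)}, c ∉ S → W.hol c (S.map Z).prod = 0 := by
    intro S hc
    refine derivation_multiset_prod_eq_zero _ fun x hx => ?_
    obtain ⟨j, hj, rfl⟩ := Multiset.mem_map.mp hx
    rw [hZ, if_neg fun h : j = c => hc (h ▸ hj)]
  split_ifs with hc
  · obtain ⟨S, rfl⟩ := Multiset.exists_cons_of_mem hc
    rw [Multiset.erase_cons_head, Multiset.map_cons, Multiset.prod_cons, Derivation.leibniz,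
      h0 (Multiset.nodup_cons.mp hS).1, hZ, if_pos rfl, smul_zero, zero_add, smul_eq_mul, mul_one]
  · exact h0 hc

theorem holMulti_zero_right (S : Multiset (Fin n)) : W.holMulti S 0 = 0 := by
  induction S using Multiset.induction with
  | empty => rfl
  | cons i S ih => rw [holMulti_cons, ih, map_zero]

theorem holMulti_smul (a : ℂ) (S : Multiset (Fin n)) (x : A) :
    W.holMulti S (a • x) = a • W.holMulti S x := by
  induction S using Multiset.induction with
  | empty => rfl
  | cons i S ih => rw [holMulti_cons, holMulti_cons, ih, Derivation.map_smul]

/-- The derivatives of a squarefree monomial at the origin. -/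
theorem map_holMulti_prod (hZ : ∀ i j, W.hol i (Z j) = if j = i then 1 else 0) {R : Type*}
    [CommRing R] (ev : A →+* R) (hev : ∀ i, ev (Z i) = 0) (P : Multiset (Fin n))
    {S : Multiset (Fin n)} (hS : S.Nodup) :
    ev (W.holMulti P (S.map Z).prod) = if P = S then 1 else 0 := by
  induction P using Multiset.induction generalizing S with
  | empty =>
    rw [holMulti_zero]
    rcases S.empty_or_exists_mem with rfl | ⟨c, hc⟩
    · simp
    · obtain ⟨S, rfl⟩ := Multiset.exists_cons_of_mem hc
      rw [if_neg (Multiset.cons_ne_zero).symm, Multiset.map_cons, Multiset.prod_cons, map_mul, hev,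
        zero_mul]
  | cons c P ih =>
    rw [holMulti_cons, W.holMulti_comm _ (W.hol_hol c), hol_prod hZ hS]
    split_ifs with h1 h2 h2
    · rw [ih (hS.erase c), if_pos]
      rw [← h2, Multiset.erase_cons_head]
    · rw [ih (hS.erase c), if_neg]
      intro h3
      exact h2 (by rw [h3, Multiset.cons_erase h1])
    · exact absurd (h2 ▸ Multiset.mem_cons_self c P) h1
    · rw [holMulti_zero_right, map_zero]

/-- The derivatives of a squarefree monomial in `z` and `z̄` at the origin. -/
theorem map_holMulti_antiMulti_prod {Zbar : Fin n → A}
    (hZ : ∀ i j, W.hol i (Z j) = if j = i then 1 else 0)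
    (hZbar : ∀ i j, W.anti i (Zbar j) = if j = i then 1 else 0)
    (hZ' : ∀ i j, W.anti i (Z j) = 0) (hZbar' : ∀ i j, W.hol i (Zbar j) = 0) {R : Type*}
    [CommRing R] (ev : A →+* R) (hev : ∀ i, ev (Z i) = 0) (hev' : ∀ i, ev (Zbar i) = 0)
    (P Q : Multiset (Fin n)) {S T : Multiset (Fin n)} (hS : S.Nodup) (hT : T.Nodup) :
    ev (W.holMulti P (W.antiMulti Q ((S.map Z).prod * (T.map Zbar).prod))) =
      (if P = S then 1 else 0) * if Q = T then 1 else 0 := by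
  have h1 : ∀ i, W.anti i (S.map Z).prod = 0 := fun i =>
    derivation_multiset_prod_eq_zero _ fun x hx => by
      obtain ⟨j, -, rfl⟩ := Multiset.mem_map.mp hx
      exact hZ' i j
  have h2 : ∀ i, W.hol i (W.antiMulti Q (T.map Zbar).prod) = 0 := fun i => by
    rw [W.antiMulti_comm _ (W.hol_anti i), derivation_multiset_prod_eq_zero]
    · exact W.swap.holMulti_zero_right Q
    · intro x hx
      obtain ⟨j, -, rfl⟩ := Multiset.mem_map.mp hx
      exact hZbar' i j
  rw [W.antiMulti_mul_of_anti_eq_zero h1, mul_comm]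
  have h3 : W.holMulti P (W.antiMulti Q (T.map Zbar).prod * (S.map Z).prod) =
      W.antiMulti Q (T.map Zbar).prod * W.holMulti P (S.map Z).prod :=
    W.swap.antiMulti_mul_of_anti_eq_zero h2 P _
  rw [h3, map_mul, map_holMulti_prod hZ ev hev P hS]
  have h4 : ev (W.antiMulti Q (T.map Zbar).prod) = if Q = T then 1 else 0 :=
    map_holMulti_prod (W := W.swap) hZbar ev hev' Q hT
  rw [h4, mul_comm]

end WirtingerStructure

end

noncomputable section

/-! ### Kähler metrics with a potential -/

section Potential

open Filter Topology smoothGerm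

variable {n : ℕ} {p : ℝ × (Fin n → ℂ)}

theorem HasGerm.add {u u' : ℝ → (Fin n → ℂ) → ℂ} {x x' : smoothGerm p} (h : HasGerm u x)
    (h' : HasGerm u' x') : HasGerm (fun τ z => u τ z + u' τ z) (x + x') := by
  obtain ⟨f, hf, rfl, hu⟩ := h
  obtain ⟨f', hf', rfl, hu'⟩ := h'
  refine ⟨_, _, (mk_add hf hf').symm, ?_⟩
  filter_upwards [hu, hu'] with w h1 h2
  rw [h1, h2]

theorem HasGerm.mul {u u' : ℝ → (Fin n → ℂ) → ℂ} {x x' : smoothGerm p} (h : HasGerm u x)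
    (h' : HasGerm u' x') : HasGerm (fun τ z => u τ z * u' τ z) (x * x') := by
  obtain ⟨f, hf, rfl, hu⟩ := h
  obtain ⟨f', hf', rfl, hu'⟩ := h'
  refine ⟨_, _, (mk_mul hf hf').symm, ?_⟩
  filter_upwards [hu, hu'] with w h1 h2
  rw [h1, h2]

theorem HasGerm.const_smul (c : ℂ) {u : ℝ → (Fin n → ℂ) → ℂ} {x : smoothGerm p} (h : HasGerm u x) :
    HasGerm (fun τ z => c * u τ z) (c • x) := by
  obtain ⟨f, hf, rfl, hu⟩ := h
  refine ⟨_, _, (smul_mk c hf).symm, ?_⟩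
  filter_upwards [hu] with w h1
  rw [h1]

theorem hasGerm_const (c : ℂ) : HasGerm (fun _ _ => c) (algebraMap ℂ (smoothGerm p) c) :=
  ⟨fun _ => c, contDiffAt_const, rfl, Eventually.of_forall fun _ => rfl⟩

theorem HasGerm.sum {ι : Type*} (I : Finset ι) {u : ι → ℝ → (Fin n → ℂ) → ℂ} {x : ι → smoothGerm p}
    (h : ∀ i, HasGerm (u i) (x i)) :
    HasGerm (fun τ z => ∑ i ∈ I, u i τ z) (∑ i ∈ I, x i) := by
  induction I using Finset.cons_induction with
  | empty =>
    have := hasGerm_const (p := p) 0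
    rw [map_zero] at this
    exact this
  | cons i I hi ih =>
    simp only [Finset.sum_cons]
    exact (h i).add ih

theorem HasGerm.multiset_prod {ι : Type*} (S : Multiset ι) {u : ι → ℝ → (Fin n → ℂ) → ℂ}
    {x : ι → smoothGerm p} (h : ∀ i, HasGerm (u i) (x i)) :
    HasGerm (fun τ z => (S.map fun i => u i τ z).prod) (S.map x).prod := by
  induction S using Multiset.induction with
  | empty =>
    have := hasGerm_const (p := p) 1
    rw [map_one] at this
    simpa using this
  | cons i S ih =>
    simp only [Multiset.map_cons, Multiset.prod_cons]
    exact (h i).mul ih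

theorem hasGerm_coordinate (i : Fin n) : HasGerm (fun _ z => z i) (zGerm p i) :=
  (isHolomorphicFamily_id p).hasGerm_coord i

theorem hasGerm_coordinate_conj (i : Fin n) :
    HasGerm (fun _ z => (starRingEnd ℂ) (z i)) (zbarGerm p i) :=
  (isHolomorphicFamily_id p).hasGerm_coordBar i

/-- The metric with potential `u`. -/
def potentialMetric (u : (Fin n → ℂ) → ℂ) (z : Fin n → ℂ) : Matrix (Fin n) (Fin n) ℂ :=
  Matrix.of fun i j => dHol i (dAnti j u) z

variable {u : (Fin n → ℂ) → ℂ}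

theorem hasGerm_potentialMetric {x : smoothGerm p} (hx : HasGerm (fun _ => u) x) (i j : Fin n) :
    HasGerm (fun _ z => potentialMetric u z i j)
      ((germWirtinger p).hol i ((germWirtinger p).anti j x)) := (hx.dAnti j).dHol i

/-- The matrix entry is itself a mixed second derivative, so its own two indices join the others. -/
theorem metricDeriv_potentialMetric {x : smoothGerm p} (hx : HasGerm (fun _ => u) x)
    {P Q : Multiset (Fin n)} (hP : P ≠ 0) (hQ : Q ≠ 0) :
    metricDeriv (potentialMetric u) P Q p.2 =
      smoothGerm.eval p ((germWirtinger p).holMulti P ((germWirtinger p).antiMulti Q x)) := by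
  set W := germWirtinger p
  have h1 : W.IsClosed fun i j => W.hol i (W.anti j x) :=
    ⟨fun i a b => W.hol_hol _ _ _, fun j a b => by
      rw [← W.hol_anti, ← W.hol_anti, W.anti_anti]⟩
  have h2 := (HasGerm.metricDeriv (hasGerm_potentialMetric hx) P Q).eval_eq
  obtain ⟨a, ha⟩ := Multiset.exists_mem_of_ne_zero hP
  obtain ⟨P, rfl⟩ := Multiset.exists_cons_of_mem ha
  obtain ⟨b, hb⟩ := Multiset.exists_mem_of_ne_zero hQ
  obtain ⟨Q, rfl⟩ := Multiset.exists_cons_of_mem hb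
  refine h2.trans (congrArg _ (?_ : W.jet (fun i j => W.hol i (W.anti j x)) _ _ = _))
  rw [h1.jet_cons_cons, ← W.antiMulti_comm _ (W.hol_anti a), ← W.holMulti_comm _ (W.hol_hol a),
    W.holMulti_cons, W.antiMulti_cons, ← W.antiMulti_comm _ (W.anti_anti b)]

theorem dHol_conj {f : (Fin n → ℂ) → ℂ} {z : Fin n → ℂ} (hf : DifferentiableAt ℝ f z) (i : Fin n) :
    dHol i (fun w => (starRingEnd ℂ) (f w)) z = (starRingEnd ℂ) (dAnti i f z) := by
  rw [dHol, dAnti, fderiv_conj_apply hf, fderiv_conj_apply hf]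
  simp [sub_eq_add_neg, Complex.conj_ofNat]

/-- Reality of `u` makes the matrix Hermitian, so the quadratic form is real and its real part
decides positivity. Closedness is the commutation of derivatives. -/
theorem isKahlerMetricOn_potentialMetric {U : Set (Fin n → ℂ)}
    (x : ∀ z : Fin n → ℂ, smoothGerm ((0 : ℝ), z)) (hx : ∀ z, HasGerm (fun _ => u) (x z))
    (hconj : ∀ z, (starRingEnd ℂ) (u z) = u z) (hU : ∀ z ∈ U,
      (∀ v : Fin n → ℂ, v ≠ 0 → 0 < (star v ⬝ᵥ (potentialMetric u z).mulVec v).re)) :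
    IsKahlerMetricOn (potentialMetric u) U where
  smooth i j := fun z _ => (hasGerm_potentialMetric (hx z) i j).contDiffAt.contDiffWithinAt
  posDef z hz := by
    have hherm : (potentialMetric u z).IsHermitian := by
      ext i j
      rw [Matrix.conjTranspose_apply]
      have h1 : (fun z => (starRingEnd ℂ) (u z)) = u := funext hconj
      have h2 : ∀ z i, (starRingEnd ℂ) (dAnti i u z) = dHol i u z := by
        intro z i
        have h3 : DifferentiableAt ℝ u z :=
          (hx z).contDiffAt.eventually_differentiableAt.self_of_nhds
        rw [← dHol_conj h3, h1]
      have h4 : DifferentiableAt ℝ (dAnti i u) z :=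
        ((hx z).contDiffAt.dAnti i).eventually_differentiableAt.self_of_nhds
      have h5 : (starRingEnd ℂ) (potentialMetric u z j i) = dAnti j (dHol i u) z := by
        rw [potentialMetric, Matrix.of_apply, ← dAnti_conj h4]
        congr 1
        exact funext fun z => h2 z i
      refine h5.trans ?_
      have h6 := (((hx z).dHol i).dAnti j).eval_eq
      have h7 := (hasGerm_potentialMetric (hx z) i j).eval_eq
      rw [(germWirtinger _).hol_anti] at h7
      exact h6.trans h7.symm
    refine Matrix.PosDef.of_dotProduct_mulVec_pos hherm fun v hv => ?_
    rw [Complex.lt_def]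
    refine ⟨hU z hz v hv, ?_⟩
    have h1 : (starRingEnd ℂ) (star v ⬝ᵥ (potentialMetric u z).mulVec v) =
        star v ⬝ᵥ (potentialMetric u z).mulVec v := by
      rw [starRingEnd_apply, ← Matrix.star_dotProduct, Matrix.star_mulVec, hherm.eq,
        Matrix.dotProduct_mulVec]
    exact (Complex.conj_eq_iff_im.mp h1).symm
  closed z hz i j l := by
    have h1 := ((hasGerm_potentialMetric (hx z) i j).dHol l).eval_eq
    have h2 := ((hasGerm_potentialMetric (hx z) l j).dHol i).eval_eq
    rw [(germWirtinger _).hol_hol] at h1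
    exact h1.trans h2.symm

end Potential

end

/-! ### Test metrics -/

noncomputable section

/-- With E = M - 1, the bound on the entries and 2|v_i||v_j| ≤ |v_i|² + |v_j|² give |v* E v| ≤
n/(n+1) |v|² < |v|². -/
theorem re_star_dotProduct_mulVec_pos {n : ℕ} {M : Matrix (Fin n) (Fin n) ℂ}
    (hM : ∀ i j, ‖M i j - (1 : Matrix (Fin n) (Fin n) ℂ) i j‖ ≤ 1 / (n + 1)) {v : Fin n → ℂ}
    (hv : v ≠ 0) : 0 < (star v ⬝ᵥ M.mulVec v).re := by
  set E := M - 1 with hE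
  have h1 : star v ⬝ᵥ M.mulVec v = star v ⬝ᵥ v + star v ⬝ᵥ E.mulVec v := by
    rw [hE, Matrix.sub_mulVec, Matrix.one_mulVec, dotProduct_sub, add_sub_cancel]
  have h2 : (star v ⬝ᵥ v).re = ∑ i, ‖v i‖ ^ 2 := by
    simp only [dotProduct, Pi.star_apply, RCLike.star_def, Complex.re_sum]
    refine Finset.sum_congr rfl fun i _ => ?_
    rw [← Complex.normSq_eq_conj_mul_self, Complex.ofReal_re, Complex.normSq_eq_norm_sq]
  have h3 : ‖star v ⬝ᵥ E.mulVec v‖ ≤ n / (n + 1) * ∑ i, ‖v i‖ ^ 2 := by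
    calc ‖star v ⬝ᵥ E.mulVec v‖ ≤ ∑ i, ∑ j, 1 / (n + 1 : ℝ) * ((‖v i‖ ^ 2 + ‖v j‖ ^ 2) / 2) := by
          simp only [dotProduct, Matrix.mulVec, Finset.mul_sum]
          refine (norm_sum_le _ _).trans (Finset.sum_le_sum fun i _ => ?_)
          refine (norm_sum_le _ _).trans (Finset.sum_le_sum fun j _ => ?_)
          rw [norm_mul, norm_mul, Pi.star_apply, norm_star]
          have h4 := hM i j
          have h5 : ‖v i‖ * ‖v j‖ ≤ (‖v i‖ ^ 2 + ‖v j‖ ^ 2) / 2 := by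
            linarith [two_mul_le_add_sq ‖v i‖ ‖v j‖]
          calc ‖v i‖ * (‖E i j‖ * ‖v j‖) = ‖E i j‖ * (‖v i‖ * ‖v j‖) := by ring
            _ ≤ _ := mul_le_mul h4 h5 (by positivity) (by positivity)
      _ = n / (n + 1) * ∑ i, ‖v i‖ ^ 2 := by
          simp only [← Finset.mul_sum, ← Finset.sum_div, Finset.sum_add_distrib, Finset.sum_const,
            Finset.card_univ, Fintype.card_fin, nsmul_eq_mul]
          ring
  have h4 : 0 < ∑ i, ‖v i‖ ^ 2 := by
    obtain ⟨i, hi⟩ := Function.ne_iff.mp hv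
    refine Finset.sum_pos' (fun i _ => by positivity) ⟨i, Finset.mem_univ i, ?_⟩
    have : v i ≠ 0 := hi
    positivity
  have h5 : (n / (n + 1) : ℝ) < 1 := by
    rw [div_lt_one (by positivity)]
    linarith
  rw [h1, Complex.add_re, h2]
  have h6 := neg_le_of_abs_le (Complex.abs_re_le_norm (star v ⬝ᵥ E.mulVec v))
  nlinarith

section TestMetric

open Filter Topology FinDigraph

variable {n r : ℕ}

/-- A potential with prescribed derivatives at the origin. -/
def testPotential (A B : Fin r → Multiset (Fin n)) (ε : Fin r → ℂ) (z : Fin n → ℂ) : ℂ :=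
  (∑ i, z i * (starRingEnd ℂ) (z i)) +
    ∑ u, (ε u * (((A u).map fun i => z i).prod * ((B u).map fun i => (starRingEnd ℂ) (z i)).prod) +
      (starRingEnd ℂ) (ε u) *
        (((B u).map fun i => z i).prod * ((A u).map fun i => (starRingEnd ℂ) (z i)).prod))

variable (A B : Fin r → Multiset (Fin n)) (ε : Fin r → ℂ)

/-- The germ of `testPotential`. -/
def testPotentialGerm (p : ℝ × (Fin n → ℂ)) : smoothGerm p :=
  (∑ i, zGerm p i * zbarGerm p i) +
    ∑ u, (ε u • (((A u).map (zGerm p)).prod * ((B u).map (zbarGerm p)).prod) +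
      (starRingEnd ℂ) (ε u) • (((B u).map (zGerm p)).prod * ((A u).map (zbarGerm p)).prod))

theorem hasGerm_testPotential (p : ℝ × (Fin n → ℂ)) :
    HasGerm (fun _ => testPotential A B ε) (testPotentialGerm A B ε p) := by
  refine HasGerm.add (HasGerm.sum _ fun i =>
    (hasGerm_coordinate i).mul (hasGerm_coordinate_conj i)) (HasGerm.sum _ fun u => ?_)
  exact (((HasGerm.multiset_prod (A u) hasGerm_coordinate).mul
    (HasGerm.multiset_prod (B u) hasGerm_coordinate_conj)).const_smul _).add
    (((HasGerm.multiset_prod (B u) hasGerm_coordinate).mul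
    (HasGerm.multiset_prod (A u) hasGerm_coordinate_conj)).const_smul _)

theorem conj_testPotential (z : Fin n → ℂ) :
    (starRingEnd ℂ) (testPotential A B ε z) = testPotential A B ε z := by
  have h1 : ∀ (S : Multiset (Fin n)) (f : Fin n → ℂ),
      (starRingEnd ℂ) (S.map f).prod = (S.map fun i => (starRingEnd ℂ) (f i)).prod := by
    intro S f
    rw [map_multiset_prod, Multiset.map_map]
    rfl
  simp only [testPotential, map_add, map_sum, map_mul, h1, Complex.conj_conj]
  congr 1
  · exact Finset.sum_congr rfl fun i _ => mul_comm _ _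
  · exact Finset.sum_congr rfl fun u _ => by ring

variable {A B}

open Classical in
theorem metricDeriv_testPotential (hA : ∀ u, (A u).Nodup) (hB : ∀ u, (B u).Nodup)
    {P Q : Multiset (Fin n)} (hP : P ≠ 0) (hQ : Q ≠ 0) :
    metricDeriv (potentialMetric (testPotential A B ε)) P Q 0 =
      (∑ i, (if P = {i} then 1 else 0) * if Q = {i} then 1 else 0) +
        testJet A B ε (fun u => (starRingEnd ℂ) (ε u)) P Q := by
  have h1 := metricDeriv_potentialMetric (hasGerm_testPotential A B ε ((0 : ℝ), 0)) hP hQ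
  refine h1.trans ?_
  have h2 : ∀ S T : Multiset (Fin n), S.Nodup → T.Nodup →
      smoothGerm.eval ((0 : ℝ), (0 : Fin n → ℂ)) ((germWirtinger _).holMulti P
        ((germWirtinger _).antiMulti Q ((S.map (zGerm _)).prod * (T.map (zbarGerm _)).prod))) =
      (if P = S then 1 else 0) * if Q = T then 1 else 0 := fun S T hS hT => by
    have := WirtingerStructure.map_holMulti_antiMulti_prod (W := germWirtinger ((0 : ℝ), (0 : Fin n → ℂ)))
      hol_zGerm anti_zbarGerm anti_zGerm hol_zbarGerm
      (smoothGerm.eval ((0 : ℝ), (0 : Fin n → ℂ))) eval_zGerm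
      (fun i => (eval_zbarGerm i).trans (map_zero _)) P Q hS hT
    convert this
  have h3 : ∀ i, zGerm ((0 : ℝ), (0 : Fin n → ℂ)) i * zbarGerm _ i =
      (Multiset.map (zGerm _) {i}).prod * (Multiset.map (zbarGerm _) {i}).prod := fun i => by simp
  have h4 : ∀ (a : ℂ) (x : smoothGerm ((0 : ℝ), (0 : Fin n → ℂ))),
      smoothGerm.eval _ ((germWirtinger _).holMulti P ((germWirtinger _).antiMulti Q (a • x))) =
      a * smoothGerm.eval _ ((germWirtinger _).holMulti P ((germWirtinger _).antiMulti Q x)) := by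
    intro a x
    have h5 : (germWirtinger ((0 : ℝ), (0 : Fin n → ℂ))).antiMulti Q (a • x) =
        a • (germWirtinger _).antiMulti Q x :=
      (germWirtinger ((0 : ℝ), (0 : Fin n → ℂ))).swap.holMulti_smul a Q x
    rw [h5, WirtingerStructure.holMulti_smul, Algebra.smul_def, map_mul]
    rfl
  simp only [testPotentialGerm, WirtingerStructure.holMulti_add, WirtingerStructure.antiMulti_add,
    WirtingerStructure.holMulti_sum, WirtingerStructure.antiMulti_sum, map_add, map_sum, h4]
  congr 1
  · refine Finset.sum_congr rfl fun i _ => ?_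
    rw [h3, h2 _ _ (Multiset.nodup_singleton i) (Multiset.nodup_singleton i)]
  · refine Finset.sum_congr rfl fun u _ => ?_
    rw [h2 _ _ (hA u) (hB u), h2 _ _ (hB u) (hA u)]
    simp only [ite_and, ite_mul, one_mul, zero_mul]

theorem metricDeriv_testPotential_of_three_le (hA : ∀ u, (A u).Nodup) (hB : ∀ u, (B u).Nodup)
    {P Q : Multiset (Fin n)} (hP : P ≠ 0) (hQ : Q ≠ 0) (h : 3 ≤ P.card + Q.card) :
    metricDeriv (potentialMetric (testPotential A B ε)) P Q 0 =
      testJet A B ε (fun u => (starRingEnd ℂ) (ε u)) P Q := by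
  classical
  rw [metricDeriv_testPotential ε hA hB hP hQ, add_eq_right]
  refine Finset.sum_eq_zero fun i _ => ?_
  split_ifs with h1 h2
  · rw [h1, h2] at h
    simp at h
  all_goals simp

/-- The added monomials have degree at least three, so at the origin only |z|² is seen. -/
theorem potentialMetric_testPotential_zero (hA : ∀ u, (A u).Nodup) (hB : ∀ u, (B u).Nodup)
    (hAB : ∀ u, 3 ≤ (A u).card + (B u).card) :
    potentialMetric (testPotential A B ε) 0 = 1 := by
  classical
  ext i j
  have h1 := metricDeriv_testPotential ε hA hB (Multiset.singleton_ne_zero i)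
    (Multiset.singleton_ne_zero j)
  rw [metricDeriv_singleton] at h1
  refine h1.trans ?_
  have h2 : testJet A B ε (fun u => (starRingEnd ℂ) (ε u)) {i} {j} = 0 := by
    unfold testJet
    refine Finset.sum_eq_zero fun u _ => ?_
    have h3 := hAB u
    rw [if_neg, if_neg, mul_zero, mul_zero, add_zero]
    · rintro ⟨h4, h5⟩
      rw [← h4, ← h5] at h3
      simp at h3
    · rintro ⟨h4, h5⟩
      rw [← h4, ← h5] at h3
      simp at h3
  rw [h2, add_zero, Matrix.one_apply]
  simp [Multiset.singleton_inj]

/-- The matrix is the identity at the origin and varies continuously, so it stays positive definite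
nearby. -/
theorem exists_isKahlerMetricOn_testPotential (hA : ∀ u, (A u).Nodup) (hB : ∀ u, (B u).Nodup)
    (hAB : ∀ u, 3 ≤ (A u).card + (B u).card) :
    ∃ U, IsOpen U ∧ (0 : Fin n → ℂ) ∈ U ∧
      IsKahlerMetricOn (potentialMetric (testPotential A B ε)) U := by
  have h1 : ∀ᶠ z in 𝓝 (0 : Fin n → ℂ), ∀ i j,
      ‖potentialMetric (testPotential A B ε) z i j - (1 : Matrix (Fin n) (Fin n) ℂ) i j‖ <
        1 / (n + 1) := by
    refine eventually_all.mpr fun i => eventually_all.mpr fun j => ?_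
    have h2 := (hasGerm_potentialMetric (hasGerm_testPotential A B ε ((0 : ℝ), 0)) i j).contDiffAt
    have h3 : ContinuousAt (fun z : Fin n → ℂ => ‖potentialMetric (testPotential A B ε) z i j -
        (1 : Matrix (Fin n) (Fin n) ℂ) i j‖) 0 := (h2.continuousAt.sub continuousAt_const).norm
    refine h3.eventually (Iio_mem_nhds ?_)
    change ‖potentialMetric (testPotential A B ε) 0 i j - _‖ < _
    rw [potentialMetric_testPotential_zero ε hA hB hAB, sub_self, norm_zero]
    positivity
  obtain ⟨U, h2, h3, h4⟩ := _root_.mem_nhds_iff.mp h1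
  refine ⟨U, h3, h4, ?_⟩
  exact isKahlerMetricOn_potentialMetric _ (fun z => hasGerm_testPotential A B ε ((0 : ℝ), z))
    (conj_testPotential A B ε) fun z hz v hv =>
      re_star_dotProduct_mulVec_pos (fun i j => (h2 hz i j).le) hv

end TestMetric

end

noncomputable section

/-! ### Shears and the vanishing of paired defects -/

section Shear

open Filter Topology smoothGerm FinDigraph

variable {n : ℕ}

theorem HasGerm.unique {p : ℝ × (Fin n → ℂ)} {u : ℝ → (Fin n → ℂ) → ℂ} {x x' : smoothGerm p}
    (h : HasGerm u x) (h' : HasGerm u x') : x = x' := by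
  obtain ⟨f, hf, rfl, hu⟩ := h
  obtain ⟨f', hf', rfl, hu'⟩ := h'
  rw [mk_eq_mk]
  filter_upwards [hu, hu'] with w h1 h2
  rw [← h1, h2]

theorem HasGerm.ite {p : ℝ × (Fin n → ℂ)} {u : ℝ → (Fin n → ℂ) → ℂ} {x : smoothGerm p}
    (P : Prop) [Decidable P] (h : HasGerm u x) :
    HasGerm (fun τ z => if P then u τ z else 0) (if P then x else 0) := by
  split_ifs
  · exact h
  · have := hasGerm_const (p := p) 0
    rw [map_zero] at this
    exact this

theorem contDiffAt_ofReal_fst (p : ℝ × (Fin n → ℂ)) :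
    ContDiffAt ℝ ∞ (fun w : ℝ × (Fin n → ℂ) => (w.1 : ℂ)) p :=
  (Complex.ofRealCLM.contDiff.comp contDiff_fst).contDiffAt

/-- The germ of the parameter. -/
def timeGerm (p : ℝ × (Fin n → ℂ)) : smoothGerm p :=
  mk (fun w => (w.1 : ℂ)) (contDiffAt_ofReal_fst p)

variable {p : ℝ × (Fin n → ℂ)}

theorem hasGerm_timeGerm : HasGerm (fun τ _ => (τ : ℂ)) (timeGerm p) :=
  ⟨_, _, rfl, Eventually.of_forall fun _ => rfl⟩

theorem deriv_timeGerm (v : ℝ × (Fin n → ℂ)) :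
    smoothGerm.deriv p v (timeGerm p) = algebraMap ℂ _ (v.1 : ℂ) := by
  rw [timeGerm, deriv_mk]
  refine (mk_eq_mk.mpr (Eventually.of_forall fun w => ?_)).trans
    (b := mk (fun _ => (v.1 : ℂ)) contDiffAt_const) rfl
  have h1 : HasFDerivAt (fun w : ℝ × (Fin n → ℂ) => (w.1 : ℂ))
      (Complex.ofRealCLM.comp (ContinuousLinearMap.fst ℝ ℝ (Fin n → ℂ))) w :=
    (Complex.ofRealCLM.comp (ContinuousLinearMap.fst ℝ ℝ (Fin n → ℂ))).hasFDerivAt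
  change fderiv ℝ (fun w : ℝ × (Fin n → ℂ) => (w.1 : ℂ)) w v = _
  rw [h1.fderiv]
  rfl

theorem hol_timeGerm (i : Fin n) : (germWirtinger p).hol i (timeGerm p) = 0 := by
  simp [germWirtinger, deriv_timeGerm]

theorem anti_timeGerm (i : Fin n) : (germWirtinger p).anti i (timeGerm p) = 0 := by
  simp [germWirtinger, deriv_timeGerm]

theorem deriv_zGerm (j : Fin n) : smoothGerm.deriv p (1, 0) (zGerm p j) = 0 := by
  rw [zGerm, IsHolomorphicFamily.coord, deriv_mk]
  refine (mk_eq_mk.mpr (Eventually.of_forall fun w => ?_)).trans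
    (b := mk (fun _ => 0) contDiffAt_const) rfl
  have h1 : HasFDerivAt (fun w : ℝ × (Fin n → ℂ) => w.2 j)
      ((ContinuousLinearMap.proj j).comp (ContinuousLinearMap.snd ℝ ℝ (Fin n → ℂ))) w :=
    ((ContinuousLinearMap.proj j).comp (ContinuousLinearMap.snd ℝ ℝ (Fin n → ℂ))).hasFDerivAt
  change fderiv ℝ (fun w : ℝ × (Fin n → ℂ) => w.2 j) w (1, 0) = 0
  rw [h1.fderiv]
  rfl

theorem deriv_zbarGerm (j : Fin n) : smoothGerm.deriv p (1, 0) (zbarGerm p j) = 0 := by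
  rw [zbarGerm, IsHolomorphicFamily.coordBar, deriv_mk]
  refine (mk_eq_mk.mpr (Eventually.of_forall fun w => ?_)).trans
    (b := mk (fun _ => 0) contDiffAt_const) rfl
  have h1 : HasFDerivAt (fun w : ℝ × (Fin n → ℂ) => w.2 j)
      ((ContinuousLinearMap.proj j).comp (ContinuousLinearMap.snd ℝ ℝ (Fin n → ℂ))) w :=
    ((ContinuousLinearMap.proj j).comp (ContinuousLinearMap.snd ℝ ℝ (Fin n → ℂ))).hasFDerivAt
  change fderiv ℝ (fun w : ℝ × (Fin n → ℂ) => (starRingEnd ℂ) (w.2 j)) w (1, 0) = 0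
  rw [fderiv_conj_apply h1.differentiableAt, h1.fderiv]
  simp

/-- The vector field `a z_S ∂_i`. -/
def shearField (S : Multiset (Fin n)) (i : Fin n) (a : ℂ) (z : Fin n → ℂ) : Fin n → ℂ :=
  Pi.single i (a * (S.map fun j => z j).prod)

variable {S : Multiset (Fin n)} {i : Fin n}

/-- The moving coordinate `z i` does not occur in the monomial, so the field is constant along its
flow lines. This gives the flow and its inverse in closed form. -/
theorem shearField_add_smul (hi : i ∉ S) (a c : ℂ) (z w : Fin n → ℂ) :
    shearField S i a (z + c • shearField S i a w) = shearField S i a z := by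
  unfold shearField
  congr 3
  refine Multiset.map_congr rfl fun j hj => ?_
  have h1 : j ≠ i := fun h => hi (h ▸ hj)
  simp [h1]

theorem differentiable_shearField (S : Multiset (Fin n)) (i : Fin n) (a : ℂ) :
    Differentiable ℂ (shearField S i a) := by
  have h1 : Differentiable ℂ fun z : Fin n → ℂ => (S.map fun j => z j).prod := by
    induction S using Multiset.induction with
    | empty => simp
    | cons j S ih =>
      simp only [Multiset.map_cons, Multiset.prod_cons]
      exact (differentiable_apply j).mul ih
  refine differentiable_pi.mpr fun j => ?_
  by_cases h : j = i
  · subst h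
    simpa [shearField] using h1.const_mul a
  · simp [shearField, h]

/-- The flow of `shearField S i a`. -/
def shear (hi : i ∉ S) (a c : ℂ) : (Fin n → ℂ) ≃ₜ (Fin n → ℂ) where
  toFun z := z + c • shearField S i a z
  invFun z := z + (-c) • shearField S i a z
  left_inv z := by
    simp only [shearField_add_smul hi]
    module
  right_inv z := by
    simp only [shearField_add_smul hi]
    module
  continuous_toFun :=
    continuous_id.add ((differentiable_shearField S i a).continuous.const_smul c)
  continuous_invFun :=
    continuous_id.add ((differentiable_shearField S i a).continuous.const_smul (-c))

/-- A global biholomorphism is cut down so that its target is the domain `U` of the metric. -/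
theorem IsWeylInvariant.apply_homeomorph
    {P : ((Fin n → ℂ) → Matrix (Fin n) (Fin n) ℂ) → (Fin n → ℂ) → ℂ} (hP : IsWeylInvariant n P)
    (e : (Fin n → ℂ) ≃ₜ (Fin n → ℂ)) (he : Differentiable ℂ e) (he' : Differentiable ℂ e.symm)
    {g : (Fin n → ℂ) → Matrix (Fin n) (Fin n) ℂ} {U : Set (Fin n → ℂ)}
    (hg : IsKahlerMetricOn g U) (hU : IsOpen U) {x : Fin n → ℂ} (hx : e x ∈ U) :
    P (pullbackMetric e g) x = P g (e x) := by
  have h1 := hP (e.symm.toOpenPartialHomeomorph.restrOpen U hU).symm he.differentiableOn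
    he'.differentiableOn g
  refine h1 ?_ x ?_
  · have : (e.symm.toOpenPartialHomeomorph.restrOpen U hU).symm.target = U := by simp
    rw [this]
    exact hg
  · simpa using hx

theorem isHolomorphicFamily_shear (S : Multiset (Fin n)) (i : Fin n) (a : ℂ)
    (p : ℝ × (Fin n → ℂ)) :
    IsHolomorphicFamily (fun τ z => z + (τ : ℂ) • shearField S i a z) p :=
  isHolomorphicFamily_add_smul (α := fun z => z) differentiableOn_id
    (differentiable_shearField S i a).differentiableOn isOpen_univ (Set.mem_univ _)

theorem coord_shear (S : Multiset (Fin n)) (i : Fin n) (a : ℂ) (p : ℝ × (Fin n → ℂ)) (j : Fin n) :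
    (isHolomorphicFamily_shear S i a p).coord j = zGerm p j +
      timeGerm p * if j = i then a • (S.map (zGerm p)).prod else 0 := by
  refine ((isHolomorphicFamily_shear S i a p).hasGerm_coord j).unique ?_
  have h1 := (hasGerm_coordinate (p := p) j).add (hasGerm_timeGerm.mul
    (((HasGerm.multiset_prod S hasGerm_coordinate).const_smul a).ite (j = i)))
  convert h1 using 5
  simp [shearField, Pi.single_apply]

theorem coordBar_shear (S : Multiset (Fin n)) (i : Fin n) (a : ℂ) (p : ℝ × (Fin n → ℂ))
    (j : Fin n) :
    (isHolomorphicFamily_shear S i a p).coordBar j = zbarGerm p j +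
      timeGerm p * if j = i then (starRingEnd ℂ) a • (S.map (zbarGerm p)).prod else 0 := by
  refine ((isHolomorphicFamily_shear S i a p).hasGerm_coordBar j).unique ?_
  have h1 := (hasGerm_coordinate_conj (p := p) j).add (hasGerm_timeGerm.mul
    (((HasGerm.multiset_prod S hasGerm_coordinate_conj).const_smul ((starRingEnd ℂ) a)).ite
      (j = i)))
  convert h1 using 3
  rename_i τ z
  by_cases h : j = i
  · subst h
    simp [shearField, map_multiset_prod, Multiset.map_map]
  · simp [shearField, h]

section Origin

variable (τ : ℝ)

theorem eval_holMulti_prod_zGerm (hS : S.Nodup) (P : Multiset (Fin n)) :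
    smoothGerm.eval (τ, (0 : Fin n → ℂ))
      ((germWirtinger (τ, (0 : Fin n → ℂ))).holMulti P (S.map (zGerm _)).prod) =
      if P = S then 1 else 0 :=
  WirtingerStructure.map_holMulti_prod hol_zGerm _ eval_zGerm P hS

theorem eval_antiMulti_prod_zbarGerm (hS : S.Nodup) (P : Multiset (Fin n)) :
    smoothGerm.eval (τ, (0 : Fin n → ℂ))
      ((germWirtinger (τ, (0 : Fin n → ℂ))).antiMulti P (S.map (zbarGerm _)).prod) =
      if P = S then 1 else 0 :=
  WirtingerStructure.map_holMulti_prod (W := (germWirtinger (τ, (0 : Fin n → ℂ))).swap)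
    anti_zbarGerm _ (fun i => (eval_zbarGerm i).trans (map_zero _)) P hS

theorem eval_smul (a : ℂ) (x : smoothGerm p) :
    smoothGerm.eval p (a • x) = a * smoothGerm.eval p x := by
  rw [Algebra.smul_def, map_mul]
  rfl

theorem ne_of_two_le_card {S : Multiset (Fin n)} (h : 2 ≤ S.card) (j : Fin n) :
    (0 : Multiset (Fin n)) ≠ S ∧ ({j} : Multiset (Fin n)) ≠ S := by
  constructor <;> rintro rfl <;> simp at h

theorem fderiv_shear (hS : S.Nodup) (hS' : 2 ≤ S.card) (i : Fin n) (a : ℂ) (k j : Fin n) :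
    fderiv ℂ (fun z => z + (τ : ℂ) • shearField S i a z) 0 (Pi.single k 1) j =
      (1 : Matrix (Fin n) (Fin n) ℂ) j k := by
  refine ((isHolomorphicFamily_shear S i a (τ, 0)).eval_hol_coord k j).symm.trans ?_
  rw [coord_shear, map_add, hol_zGerm, Derivation.leibniz, hol_timeGerm, smul_zero, add_zero,
    smul_eq_mul, map_add, map_mul]
  have h1 : smoothGerm.eval (τ, (0 : Fin n → ℂ)) ((germWirtinger _).hol k
      (if j = i then a • (S.map (zGerm _)).prod else 0)) = 0 := by
    split_ifs
    · rw [Derivation.map_smul, eval_smul]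
      have := eval_holMulti_prod_zGerm τ hS {k}
      rw [if_neg (ne_of_two_le_card hS' k).2] at this
      rw [show (germWirtinger (τ, (0 : Fin n → ℂ))).hol k (S.map (zGerm _)).prod =
        (germWirtinger _).holMulti {k} (S.map (zGerm _)).prod from rfl, this, mul_zero]
    · rw [map_zero, map_zero]
  rw [h1, mul_zero, add_zero, Matrix.one_apply]
  split_ifs <;> simp

/-- A field is preserved by its own flow, so in source coordinates the velocity is the field itself
at every time. Degree at least two makes its 1-jet vanish at the origin. -/
theorem isVelocity_shear (hi : i ∉ S) (hS : S.Nodup) (hS' : 2 ≤ S.card) (a : ℂ) :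
    (isHolomorphicFamily_shear S i a (τ, 0)).IsVelocity
      (fun j => if j = i then a • (S.map (zGerm _)).prod else 0)
      (fun j => if j = i then (starRingEnd ℂ) a • (S.map (zbarGerm _)).prod else 0) where
  hol_eq j := by
    have h1 : (germWirtinger (τ, (0 : Fin n → ℂ))).hol i (S.map (zGerm _)).prod = 0 := by
      rw [WirtingerStructure.hol_prod hol_zGerm hS, if_neg hi]
    have h2 : smoothGerm.deriv (τ, (0 : Fin n → ℂ)) (1, 0) (S.map (zGerm _)).prod = 0 :=
      WirtingerStructure.derivation_multiset_prod_eq_zero _ fun x hx => by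
        obtain ⟨j, -, rfl⟩ := Multiset.mem_map.mp hx
        exact deriv_zGerm j
    simp only [coord_shear, ite_mul, zero_mul, Finset.sum_ite_eq', Finset.mem_univ, if_true,
      map_add, hol_zGerm, Derivation.leibniz, hol_timeGerm, deriv_zGerm, deriv_timeGerm]
    by_cases h : j = i
    · simp [h, h1, h2]
    · simp [h]
  anti_eq j := by
    have h1 : (germWirtinger (τ, (0 : Fin n → ℂ))).anti i (S.map (zbarGerm _)).prod = 0 := by
      refine (WirtingerStructure.hol_prod (W := (germWirtinger (τ, (0 : Fin n → ℂ))).swap)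
        anti_zbarGerm hS i).trans (if_neg hi)
    have h2 : smoothGerm.deriv (τ, (0 : Fin n → ℂ)) (1, 0) (S.map (zbarGerm _)).prod = 0 :=
      WirtingerStructure.derivation_multiset_prod_eq_zero _ fun x hx => by
        obtain ⟨j, -, rfl⟩ := Multiset.mem_map.mp hx
        exact deriv_zbarGerm j
    simp only [coordBar_shear, ite_mul, zero_mul, Finset.sum_ite_eq', Finset.mem_univ, if_true,
      map_add, anti_zbarGerm, Derivation.leibniz, anti_timeGerm, deriv_zbarGerm, deriv_timeGerm]
    by_cases h : j = i
    · simp [h, h1, h2]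
    · simp [h]
  anti_eq_zero k j := by
    split_ifs
    · rw [Derivation.map_smul, WirtingerStructure.derivation_multiset_prod_eq_zero, smul_zero]
      intro x hx
      obtain ⟨j, -, rfl⟩ := Multiset.mem_map.mp hx
      exact anti_zGerm _ _
    · exact map_zero _
  hol_eq_zero k j := by
    split_ifs
    · rw [Derivation.map_smul, WirtingerStructure.derivation_multiset_prod_eq_zero, smul_zero]
      intro x hx
      obtain ⟨j, -, rfl⟩ := Multiset.mem_map.mp hx
      exact hol_zbarGerm _ _
    · exact map_zero _
  eval_eq_zero j := by
    split_ifs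
    · have h1 := eval_holMulti_prod_zGerm τ hS 0
      rw [if_neg (ne_of_two_le_card hS' j).1, WirtingerStructure.holMulti_zero] at h1
      rw [eval_smul, h1, mul_zero]
    · exact map_zero _
  eval_bar_eq_zero j := by
    split_ifs
    · have h1 := eval_antiMulti_prod_zbarGerm τ hS 0
      rw [if_neg (ne_of_two_le_card hS' j).1, WirtingerStructure.antiMulti_zero] at h1
      rw [eval_smul, h1, mul_zero]
    · exact map_zero _
  eval_hol_eq_zero k j := by
    split_ifs
    · have h1 := eval_holMulti_prod_zGerm τ hS {k}
      rw [if_neg (ne_of_two_le_card hS' k).2] at h1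
      rw [Derivation.map_smul, eval_smul]
      exact mul_eq_zero_of_right _ h1
    · rw [map_zero, map_zero]
  eval_anti_eq_zero k j := by
    split_ifs
    · have h1 := eval_antiMulti_prod_zbarGerm τ hS {k}
      rw [if_neg (ne_of_two_le_card hS' k).2] at h1
      rw [Derivation.map_smul, eval_smul]
      exact mul_eq_zero_of_right _ h1
    · rw [map_zero, map_zero]

theorem eval_holMulti_shear (hS : S.Nodup) (a : ℂ) :
    (fun c P => smoothGerm.eval (τ, (0 : Fin n → ℂ)) ((germWirtinger _).holMulti P
      (if c = i then a • (S.map (zGerm _)).prod else 0))) = fun c P => a * testField i S c P := by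
  funext c P
  unfold testField
  by_cases h : c = i
  · rw [if_pos h, WirtingerStructure.holMulti_smul, eval_smul, eval_holMulti_prod_zGerm _ hS]
    simp [h]
  · rw [if_neg h, WirtingerStructure.holMulti_zero_right, map_zero]
    simp [h]

theorem eval_antiMulti_shear (hS : S.Nodup) (a : ℂ) :
    (fun c P => smoothGerm.eval (τ, (0 : Fin n → ℂ)) ((germWirtinger _).antiMulti P
      (if c = i then a • (S.map (zbarGerm _)).prod else 0))) =
      fun c P => a * testField i S c P := by
  funext c P
  unfold testField
  by_cases h : c = i
  · rw [if_pos h]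
    have h1 : (germWirtinger (τ, (0 : Fin n → ℂ))).antiMulti P (a • (S.map (zbarGerm _)).prod) =
        a • (germWirtinger _).antiMulti P (S.map (zbarGerm _)).prod :=
      (germWirtinger (τ, (0 : Fin n → ℂ))).swap.holMulti_smul a P _
    rw [h1, eval_smul, eval_antiMulti_prod_zbarGerm _ hS]
    simp [h]
  · rw [if_neg h]
    refine (congrArg _ ((germWirtinger (τ, (0 : Fin n → ℂ))).swap.holMulti_zero_right P)).trans ?_
    simp [h]

end Origin

theorem defectSum_const_mul (K N : ℕ) (Y : FinDigraph → ℂ)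
    (J : Multiset (Fin n) → Multiset (Fin n) → ℂ) (B : Matrix (Fin n) (Fin n) ℂ)
    (ξ : Fin n → Multiset (Fin n) → ℂ) (a : ℂ) :
    defectSum K N Y J B (fun c P => a * ξ c P) = a * defectSum K N Y J B ξ := by
  have h1 : ∀ {p q : ℕ} (v : Fin p) (σ : Fin q → Fin (p + 1)) (t : Fin q → Fin p),
      expandTerm v σ t J B (fun c P => a * ξ c P) = a * expandTerm v σ t J B ξ := by
    intro p q v σ t
    simp only [expandTerm, Finset.mul_sum]
    refine Finset.sum_congr rfl fun c _ => Finset.sum_congr rfl fun _ _ =>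
      Finset.sum_congr rfl fun _ _ => by ring
  simp only [defectSum, h1, Finset.mul_sum, mul_ite, mul_zero]
  refine Finset.sum_congr rfl fun _ _ => Finset.sum_congr rfl fun _ _ =>
    Finset.sum_congr rfl fun _ _ => Finset.sum_congr rfl fun _ _ => ?_
  split_ifs
  · ring
  · rfl

/-- The defects of an invariant combination of digraphs pair to zero with all monomial vector
fields. -/
theorem IsWeylInvariant.defectSum_eq_zero {K : ℕ} {c : StabClass (K : ℤ) → ℂ}
    (hc : IsWeylInvariant n (graphCombination n c))
    {g : (Fin n → ℂ) → Matrix (Fin n) (Fin n) ℂ} {U : Set (Fin n → ℂ)} (hU : IsOpen U)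
    (h0 : (0 : Fin n → ℂ) ∈ U) (hg : IsKahlerMetricOn g U) (hg0 : g 0 = 1) (hi : i ∉ S)
    (hS : S.Nodup) (hS' : 2 ≤ S.card) :
    defectSum K (2 * K + 1) (extendByZero c) (fun P Q => metricDeriv g P Q 0) 1
        (testField i S) = 0 ∧
      defectSum K (2 * K + 1) (fun G => extendByZero c G.op) (fun P Q => metricDeriv g Q P 0) 1
        (testField i S) = 0 := by
  have hzero : ∀ (a : ℂ) (τ : ℝ), (0 : Fin n → ℂ) + (τ : ℂ) • shearField S i a 0 = 0 := by
    intro a τ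
    obtain ⟨j, hj⟩ := Multiset.card_pos_iff_exists_mem.mp (by omega : 0 < S.card)
    obtain ⟨T, rfl⟩ := Multiset.exists_cons_of_mem hj
    simp [shearField]
  -- By invariance the value along the flow is constant in time, while its derivative at time `0`,
  -- where the map is the identity, is this sum.
  have key : ∀ a : ℂ,
      a * defectSum K (2 * K + 1) (extendByZero c) (fun P Q => metricDeriv g P Q 0) 1
        (testField i S) +
      (starRingEnd ℂ) a * defectSum K (2 * K + 1) (fun G => extendByZero c G.op)
        (fun P Q => metricDeriv g Q P 0) 1 (testField i S) = 0 := by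
    intro a
    have hM : ∀ τ : ℝ, pullbackMetric (fun z => z + (τ : ℂ) • shearField S i a z) g 0 = 1 := by
      intro τ
      rw [pullbackMetric_of_fderiv (fderiv_shear τ hS hS' i a), hzero, hg0]
      simp
    have h1 := (isVelocity_shear 0 hi hS hS' a).hasDerivAt_graphCombination hg hU
      (by rw [hzero]; exact h0) hM (by simp) c
    have h2 : (fun τ : ℝ => graphCombination n c
        (pullbackMetric (fun z => z + (τ : ℂ) • shearField S i a z) g) 0) =
        fun _ => graphCombination n c g 0 := by
      funext τ
      have h3 := hc.apply_homeomorph (shear hi a (τ : ℂ))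
        (differentiable_id.add ((differentiable_shearField S i a).const_smul (τ : ℂ)))
        (differentiable_id.add ((differentiable_shearField S i a).const_smul (-(τ : ℂ))))
        hg hU (x := 0) (by rw [show shear hi a (τ : ℂ) 0 = 0 from hzero a τ]; exact h0)
      rw [show shear hi a (τ : ℂ) 0 = 0 from hzero a τ] at h3
      exact h3
    have h4 : pullbackMetric (fun z => z + ((0 : ℝ) : ℂ) • shearField S i a z) g = g := by
      simp only [Complex.ofReal_zero, zero_smul, add_zero]
      exact pullbackMetric_id g
    simp only [h2, h4, eval_holMulti_shear 0 hS, eval_antiMulti_shear 0 hS, defectSum_const_mul,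
      inv_one, Matrix.transpose_one] at h1
    exact h1.unique (hasDerivAt_const _ _)
  -- The relation is linear in `a` in one half and antilinear in the other, so the values 1 and i
  -- separate the halves.
  have h1 := key 1
  have h2 := key Complex.I
  rw [map_one, one_mul, one_mul] at h1
  rw [Complex.conj_I] at h2
  rw [neg_mul, ← sub_eq_add_neg, ← mul_sub] at h2
  have h3 := (mul_eq_zero.mp h2).resolve_left Complex.I_ne_zero
  constructor
  · linear_combination (1 / 2 : ℂ) * h1 + (1 / 2 : ℂ) * h3
  · linear_combination (1 / 2 : ℂ) * h1 - (1 / 2 : ℂ) * h3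

end Shear

end

/-! ### Invariants come from Weyl functions -/

noncomputable section

open FinDigraph

/-- The monomials at the vertices of one expanded digraph, used as potential and as vector field,
isolate the defect of that digraph. -/
theorem isWeylFunction_of_isWeylInvariant {K n : ℕ} (hn : 3 * K ≤ n) {c : StabClass (K : ℤ) → ℂ}
    (hc : IsWeylInvariant n (graphCombination n c)) : IsWeylFunction c := by
  refine isWeylFunction_of_defect fun Y hY r v σ t hσ hs => ?_
  have hr : r + 1 ≤ 2 * K := hs.nV_le (K := K) (by simp [expand]; omega)
  -- Here the bound on the dimension enters: the expanded digraph has `K + r + 1 ≤ 3 * K` edges,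
  -- which get distinct coordinates.
  let ι : Fin (K + r + 1) → Fin n := Fin.castLE (by omega)
  have hι : Function.Injective ι := Fin.castLE_injective _
  let A : Fin r → Multiset (Fin n) := fun u => (fiber (expandSrc v σ) u.succ).val.map ι
  let B : Fin r → Multiset (Fin n) := fun u => (fiber (expandTgt t) u.succ).val.map ι
  let S : Multiset (Fin n) := (fiber (expandSrc v σ) 0).val.map ι
  have hA : ∀ u, (A u).Nodup := fun u => Multiset.Nodup.map hι (Finset.nodup _)
  have hB : ∀ u, (B u).Nodup := fun u => Multiset.Nodup.map hι (Finset.nodup _)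
  have hS : S.Nodup := Multiset.Nodup.map hι (Finset.nodup _)
  have hS' : 2 ≤ S.card := by
    simp only [S, Multiset.card_map, Finset.card_val, fiber_expandSrc_zero, Finset.card_map]
    exact hσ
  -- The inward edge of the new vertex gives the direction of the shear and the outward edges its
  -- monomial; the edge `0` is not among the latter.
  have hi : ι 0 ∉ S := by
    simp only [S, Multiset.mem_map_of_injective hι, Finset.mem_val, fiber_expandSrc_zero]
    simp [Fin.succ_ne_zero]
  have hAB : ∀ u, 3 ≤ (A u).card + (B u).card := by
    intro u
    have h1 := (hs u.succ).2.2
    simp only [A, B, Multiset.card_map, Finset.card_val]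
    rw [add_comm]
    exact h1
  choose U hU h0 hg using fun ε => exists_isKahlerMetricOn_testPotential ε hA hB hAB
  have key := fun ε => hc.defectSum_eq_zero (hU ε) (h0 ε) (hg ε)
    (potentialMetric_testPotential_zero ε hA hB hAB) hi hS hS'
  rcases hY with rfl | rfl
  · exact (isDigraphFunction_extendByZero c).defect_eq_zero_of_test (by omega) hσ hs hι
      (fun _ => rfl) (fun _ => rfl) rfl _
      (fun ε P Q hP hQ h => metricDeriv_testPotential_of_three_le ε hA hB hP hQ h)
      fun ε => (key ε).1
  -- Reversal exchanges barred and unbarred indices, which is compensated by conjugating the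
  -- parameters of the potential.
  · refine (isDigraphFunction_extendByZero_op c).defect_eq_zero_of_test (by omega) hσ hs hι
      (fun _ => rfl) (fun _ => rfl) rfl
      (fun ε P Q => metricDeriv (potentialMetric (testPotential A B
        fun u => (starRingEnd ℂ) (ε u))) Q P 0)
      (fun ε P Q hP hQ h => ?_) fun ε => (key _).2
    rw [metricDeriv_testPotential_of_three_le _ hA hB hQ hP (by omega)]
    unfold testJet
    refine Finset.sum_congr rfl fun u _ => ?_
    rw [add_comm]
    simp only [Complex.conj_conj, and_comm (a := Q = A u), and_comm (a := Q = B u)]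
    rfl

/-- The bound 3|V| ≤ 2|E| for semistable digraphs excludes |E| < |V|. -/
theorem stabClass_isEmpty {k : ℤ} (hk : k < 0) : IsEmpty (StabClass k) := by
  refine ⟨fun H => Quotient.ind (motive := fun _ => False) (fun H => ?_) H⟩
  have h1 := H.2.1.three_mul_nV_le
  have h2 := H.2.2.1
  unfold FinDigraph.weight at h2
  omega

theorem corollary3p6 (k : ℤ) (c : StabClass k → ℂ) :
    ((∀ n : ℕ, IsWeylInvariant n (graphCombination n c)) ↔ IsWeylFunction c) ∧
      ∀ n : ℕ, 3 * k ≤ (n : ℤ) →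
        (IsWeylInvariant n (graphCombination n c) ↔ IsWeylFunction c) := by
  rcases lt_or_ge k 0 with hk | hk
  · have := stabClass_isEmpty hk
    have h1 : IsWeylFunction c := fun H => isEmptyElim (Quotient.mk _ H : StabClass k)
    have h2 : ∀ n : ℕ, IsWeylInvariant n (graphCombination n c) := by
      intro n φ _ _ g _ x _
      exact (finsum_of_isEmpty _).trans (finsum_of_isEmpty _).symm
    exact ⟨⟨fun _ => h1, fun _ => h2⟩, fun n _ => ⟨fun _ => h1, fun _ => h2 n⟩⟩
  · obtain ⟨K, rfl⟩ := Int.eq_ofNat_of_zero_le hk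
    -- Invariance in the single dimension `3 * K` is all that is needed of invariance in every
    -- dimension.
    refine ⟨⟨fun h => isWeylFunction_of_isWeylInvariant le_rfl (h (3 * K)),
      fun h n => h.isWeylInvariant n⟩, fun n hn => ⟨fun h => ?_, fun h => h.isWeylInvariant n⟩⟩
    exact isWeylFunction_of_isWeylInvariant (by omega) h

end
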